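/- **Setting.** Let $U\subset\mathbb{R}^n$ be a non-empty connected open set with $\mathbb{R}^{>0}\cdot U\subset U$ and let $h$ be a homogeneous cubic polynomial with $h>0$ on $U$, such that $g_{\mathcal H}:=-\partial^2h|_{T\mathcal H}$ is positive definite on the hypersurface $\mathcal H:=\{x\in U\mid h(x)=1\}$; that is, $(\mathcal H,g_{\mathcal H})$ is a projective special real manifold. For $c\in\mathbb{R}$ set $$U_c:=\begin{cases}\{x\in U\mid h(x)+c>0\}, & c\le 0,\\ \{x\in U\mid h(x)-2c>0\}, & c>0,\end{cases}\qquad M_c:=\mathbb{R}^n+iU_c\subset\mathbb{C}^n,$$ with coordinates $z=y+ix$. Let $F(z)=-h(z)$, and let $\mathrm dF:z\mapsto(z,\partial F/\partial z)\in T^*\mathbb{C}^n=\mathbb{C}^{2n}$. On $\mathbb{C}^{2k}$ let $\Omega=\sum \mathrm dz^i\wedge \mathrm dw_i$, $\gamma=i\,\Omega(\cdot,\bar\cdot)$. A holomorphic immersion $\phi$ of a $k$-dimensional complex manifold into $\mathbb{C}^{2k}$ is Lagrangian if $\phi^*\Omega=0$ and Kählerian if $\phi^*\gamma$ is non-degenerate.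 A Kählerian Lagrangian immersion $\phi$ induces an affine special Kähler structure $(g,\nabla)$: $g$ is the pseudo-Kähler metric $\sum\frac{\partial^2K}{\partial z^i\partial\bar z^j}\mathrm dz^i\mathrm d\bar z^j$ with $K=\frac12\gamma(\phi,\phi)$, and $\nabla$ is the flat connection with $\nabla\,\mathrm d(\mathrm{Re}\,\phi)=0$. A special Kähler pair $(\phi,F)$ of an affine special Kähler manifold $M$ consists of such a $\phi=(z,w)$ inducing its structure and of a holomorphic $F$ with $\mathrm dF=\sum w_i\,\mathrm dz^i$. Its conification is $\Phi:\mathbb{C}^*\times M\to\mathbb{C}^{2n+2}$, $\Phi(z^0,p)=z^0\,(1,(2F-z^tw)(p),\phi(p))$; the pair is non-degenerate if $\Phi$ is Kählerian and $\gamma(\Phi,\Phi)\ne0$. The ASK/PSK-correspondence assigns to a connected affine special Kähler manifold $M$ and a non-degenerate germ $u$ at $p\in M$ of a special Kähler pair (such that continuation of $u$ along loops changes $u$ only by elements of $\mathrm{Sp}(\mathbb{R}^{2n})\ltimes \mathrm{Heis}_{2n+1}(\mathbb{R})$) the following manifold. Let $\mathrm{dom}(u)$ be the set of points that can be joined to $p$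 by a path in $M$ along which the analytic continuation of $u$ is non-degenerate. The conifications of the continuations of $u$ induce a conical affine special Kähler structure $(\hat g,\hat\nabla,\xi)$ on $\mathbb{C}^*\times\mathrm{dom}(u)$, with $\xi$ generating the scalings $(z^0,p)\mapsto (rz^0,p)$, $r>0$. The result is the quotient $\mathrm{dom}(u)=(\mathbb{C}^*\times\mathrm{dom}(u))/\mathbb{C}^*$ with the projective special Kähler metric $\bar g$ whose pullback is $-\frac{\hat g}{\hat K}+\frac{(\partial\hat K)(\bar\partial\hat K)}{\hat K^2}$, $\hat K=\hat g(\xi,\xi)$. **Theorem.** 1. For every $c\in\mathbb{R}$, $M_c$ is non-empty and $(\phi_c,F_c):=(\mathrm dF,\,F-2\sqrt{-1}\,c)$ is a non-degenerate special Kähler pair of $M_c$ with the affine special Kähler structure induced by $\mathrm dF$. The ASK/PSK-correspondence, applied to $M_c$ and the germ of this pair at any $p\in M_c$, gives the projective special Kähler manifold $(\bar M_c,\bar g_c)$ with $\bar M_c=M_c$ and $$\bar g_c=\frac14\begin{pmatrix}-\partial^2\log(h(x)+c)&0\\0&-\partial^2\log(h(x)+c)\end{pmatrix}$$ in the real coordinates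 $(y,x)$, where $\partial^2$ is the Hessian with respect to $x$. The metric $\bar g_c$ is positive definite. 2. For $c=0$ this is the supergravity r-map: $\bar M_0=\mathbb{R}^n+iU$, and $\bar g_0$ is the Kähler metric $\sum\frac{\partial^2 K}{\partial z^i\partial\bar z^j}\mathrm dz^i\mathrm d\bar z^j$ with Kähler potential $K(z)=-\log h(x)$. 3. If $cc'>0$, then $(\bar M_c,\bar g_c)$ and $(\bar M_{c'},\bar g_{c'})$ are isometric. 4. If $c<0$ and $(\mathcal H,g_{\mathcal H})$ is complete, then $(\bar M_c,\bar g_c)$ is complete. -/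

import Mathlib

open Set Filter Topology MeasureTheory
open scoped ContDiff ENNReal

namespace SpecialGeometry

noncomputable section

/-! ### Tensor fields on open subsets of `ℂ^k` -/

/-- `ℂ^k`. The complex structure `J` of an open subset is multiplication by `i`. -/
abbrev Cn (k : ℕ) := Fin k → ℂ

/-- `ℂ^{2k} = T^*ℂ^k` with canonical coordinates `(z, w)`. -/
abbrev Phase (k : ℕ) := Cn k × Cn k

/-- The complex structure `J`. -/
def J {k : ℕ} (u : Cn k) : Cn k := Complex.I • u

/-- A covariant 2-tensor field: `g p u v` is the value of `g_p` on the vectors `u, v`. -/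
abbrev Tensor2 (E : Type*) := E → E → E → ℝ

/-- A connection in the standard global chart: `Γ p u v = (∇_u v)_p` for the constant vector
fields `u`, `v`, so that `∇_u X = D_u X + Γ(u, X)` for a general vector field `X`. -/
abbrev Conn (E : Type*) := E → E → E → E

/-- The form `ω = g(·, J·)`. -/
def kform {k : ℕ} (g : Tensor2 (Cn k)) (p u v : Cn k) : ℝ := g p u (J v)

/-- Pseudo-Kähler metrics (with respect to `J`) on an open set `M ⊆ ℂ^k`. -/
structure IsPseudoKaehler {k : ℕ} (M : Set (Cn k)) (g : Tensor2 (Cn k)) : Prop where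
  isOpen : IsOpen M
  linear : ∀ p ∈ M, ∀ u, IsLinearMap ℝ (g p u)
  symm : ∀ p ∈ M, ∀ u v, g p u v = g p v u
  smooth : ∀ u v, ContDiffOn ℝ ∞ (fun p => g p u v) M
  nondegenerate : ∀ p ∈ M, ∀ u, (∀ v, g p u v = 0) → u = 0
  hermitian : ∀ p ∈ M, ∀ u v, g p (J u) (J v) = g p u v
  closed : ∀ p ∈ M, ∀ u v w,
    fderiv ℝ (fun q => kform g q v w) p u + fderiv ℝ (fun q => kform g q w u) p v
      + fderiv ℝ (fun q => kform g q u v) p w = 0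

/-- Affine special Kähler structures `(J, g, ∇)` on an open set `M ⊆ ℂ^k`: `g` is pseudo-Kähler,
`∇` is flat and torsion-free, `∇ω = 0` and `d^∇ J = 0`. -/
structure IsAffineSpecialKaehler {k : ℕ} (M : Set (Cn k)) (g : Tensor2 (Cn k))
    (Γ : Conn (Cn k)) : Prop where
  kaehler : IsPseudoKaehler M g
  linear_left : ∀ p ∈ M, ∀ v, IsLinearMap ℝ (fun u => Γ p u v)
  linear_right : ∀ p ∈ M, ∀ u, IsLinearMap ℝ (Γ p u)
  smooth : ∀ u v, ContDiffOn ℝ ∞ (fun p => Γ p u v) M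
  torsion_free : ∀ p ∈ M, ∀ u v, Γ p u v = Γ p v u
  flat : ∀ p ∈ M, ∀ u v w,
    fderiv ℝ (fun q => Γ q v w) p u + Γ p u (Γ p v w)
      - (fderiv ℝ (fun q => Γ q u w) p v + Γ p v (Γ p u w)) = 0
  parallel_form : ∀ p ∈ M, ∀ u v w,
    fderiv ℝ (fun q => kform g q v w) p u - kform g p (Γ p u v) w - kform g p v (Γ p u w) = 0
  ext_deriv_J : ∀ p ∈ M, ∀ u v,
    (Γ p u (J v) - J (Γ p u v)) - (Γ p v (J u) - J (Γ p v u)) = 0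

/-- `D` is the Levi-Civita connection of `g` on `M`. -/
structure IsLeviCivita {k : ℕ} (M : Set (Cn k)) (g : Tensor2 (Cn k)) (D : Conn (Cn k)) :
    Prop where
  linear_left : ∀ p ∈ M, ∀ v, IsLinearMap ℝ (fun u => D p u v)
  linear_right : ∀ p ∈ M, ∀ u, IsLinearMap ℝ (D p u)
  torsion_free : ∀ p ∈ M, ∀ u v, D p u v = D p v u
  metric : ∀ p ∈ M, ∀ u v w,
    fderiv ℝ (fun q => g q v w) p u = g p (D p u v) w + g p v (D p u w)

/-- Conical affine special Kähler structures: an affine special Kähler structure and a vector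
field `ξ` with `g(ξ, ξ) ≠ 0` and `∇ξ = Dξ = Id`, `D` the Levi-Civita connection. -/
structure IsConicalASK {k : ℕ} (M : Set (Cn k)) (g : Tensor2 (Cn k)) (Γ : Conn (Cn k))
    (ξ : Cn k → Cn k) : Prop where
  ask : IsAffineSpecialKaehler M g Γ
  smooth : ContDiffOn ℝ ∞ ξ M
  length_ne_zero : ∀ p ∈ M, g p (ξ p) (ξ p) ≠ 0
  nabla : ∀ p ∈ M, ∀ u, fderiv ℝ ξ p u + Γ p u (ξ p) = u
  leviCivita : ∃ D : Conn (Cn k), IsLeviCivita M g D ∧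
    ∀ p ∈ M, ∀ u, fderiv ℝ ξ p u + D p u (ξ p) = u

/-! ### Kählerian Lagrangian immersions and special Kähler pairs -/

/-- The complex symplectic form `Ω = ∑ dz^i ∧ dw_i` on `ℂ^{2k}`. -/
def Omega {k : ℕ} (a b : Phase k) : ℂ := ∑ i, (a.1 i * b.2 i - a.2 i * b.1 i)

/-- The standard real structure `τ` on `ℂ^{2k}`. -/
def tau {k : ℕ} (a : Phase k) : Phase k :=
  (fun i => (starRingEnd ℂ) (a.1 i), fun i => (starRingEnd ℂ) (a.2 i))

/-- The Hermitian form `γ = i Ω(·, τ·)`. -/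
def gam {k : ℕ} (a b : Phase k) : ℂ := Complex.I * Omega a (tau b)

/-- Holomorphic immersions `M → ℂ^{2k}` that are Lagrangian, i.e. `φ^*Ω = 0`. -/
structure IsLagrangianImmersion {k : ℕ} (M : Set (Cn k)) (φ : Cn k → Phase k) : Prop where
  holomorphic : DifferentiableOn ℂ φ M
  immersion : ∀ p ∈ M, Function.Injective (fderiv ℂ φ p)
  lagrangian : ∀ p ∈ M, ∀ u v, Omega (fderiv ℂ φ p u) (fderiv ℂ φ p v) = 0

/-- `φ` is Kählerian: `φ^*γ` is non-degenerate. -/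
def IsKaehlerian {k : ℕ} (M : Set (Cn k)) (φ : Cn k → Phase k) : Prop :=
  ∀ p ∈ M, ∀ u, (∀ v, gam (fderiv ℂ φ p u) (fderiv ℂ φ p v) = 0) → u = 0

/-- The metric induced by `φ`. It is normalised such that `K = γ(φ, φ)/2` is a Kähler potential,
i.e. `g = ∑ (∂²K / ∂z^i ∂z̄^j) dz^i dz̄^j`. -/
def inducedMetric {k : ℕ} (φ : Cn k → Phase k) : Tensor2 (Cn k) := fun p u v =>
  (gam (fderiv ℂ φ p u) (fderiv ℂ φ p v)).re / 2

/-- The real part `Re φ : M → ℝ^{2k}`. -/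
def rePart {k : ℕ} (φ : Cn k → Phase k) (p : Cn k) : (Fin k → ℝ) × (Fin k → ℝ) :=
  (fun i => ((φ p).1 i).re, fun i => ((φ p).2 i).re)

/-- The flat connection induced by `φ`: the pullback of the standard connection of `ℝ^{2k}` by
the local diffeomorphism `Re φ`, that is, `d(Re φ)(∇_u v) = D_u (d(Re φ) v)`. -/
def inducedConn {k : ℕ} (φ : Cn k → Phase k) : Conn (Cn k) := fun p u v =>
  (fderiv ℝ (rePart φ) p).inverse (fderiv ℝ (fun q => fderiv ℝ (rePart φ) q v) p u)

/-- `F` is a prepotential of `φ`: `dF = φ^*λ` for the Liouville form `λ = ∑ w_i dz^i`. -/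
structure IsPrepotential {k : ℕ} (M : Set (Cn k)) (φ : Cn k → Phase k) (F : Cn k → ℂ) :
    Prop where
  holomorphic : DifferentiableOn ℂ F M
  deriv_eq : ∀ p ∈ M, ∀ u, fderiv ℂ F p u = ∑ i, (φ p).2 i * (fderiv ℂ φ p u).1 i

/-- `(φ, F)` is a special Kähler pair of the open set `V`, where `V` carries (the restriction of)
the affine special Kähler structure `(J, g, ∇)`. -/
structure IsSpecialKaehlerPair {k : ℕ} (g : Tensor2 (Cn k)) (Γ : Conn (Cn k)) (V : Set (Cn k))
    (φ : Cn k → Phase k) (F : Cn k → ℂ) : Prop where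
  isOpen : IsOpen V
  immersion : IsLagrangianImmersion V φ
  kaehlerian : IsKaehlerian V φ
  metric_eq : ∀ p ∈ V, ∀ u v, g p u v = inducedMetric φ p u v
  conn_eq : ∀ p ∈ V, ∀ u v, Γ p u v = inducedConn φ p u v
  prepotential : IsPrepotential V φ F

/-! ### Conification -/

/-- The projection `ℂ × ℂ^n → ℂ^n`, `(z^0, p) ↦ p`. On `ℂ^* × M` it is the quotient map of the
principal action `λ · (z^0, p) = (λ z^0, p)` of `ℂ^*`. -/
def base {n : ℕ} (Z : Cn (n + 1)) : Cn n := fun i => Z i.succ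

/-- `ℂ^* × M`. -/
def cstarProd {n : ℕ} (M : Set (Cn n)) : Set (Cn (n + 1)) := {Z | Z 0 ≠ 0 ∧ base Z ∈ M}

/-- The vector field `ξ` on `ℂ^* × M` for which `ξ` and `Jξ` generate the `ℂ^*`-action. -/
def coneField {n : ℕ} (Z : Cn (n + 1)) : Cn (n + 1) := Fin.cons (Z 0) (fun _ => 0)

/-- The conification `con(φ, F)(z^0, p) = z^0 (1, (2F - z^t w)(p), φ(p))`, where the coordinates
of `ℂ^{2n+2}` are ordered as `((z^0, z), (w_0, w))`. -/
def con {n : ℕ} (φ : Cn n → Phase n) (F : Cn n → ℂ) (Z : Cn (n + 1)) : Phase (n + 1) :=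
  (Z 0 • (Fin.cons 1 (φ (base Z)).1 : Cn (n + 1)),
   Z 0 • (Fin.cons (2 * F (base Z) - ∑ i, (φ (base Z)).1 i * (φ (base Z)).2 i)
      (φ (base Z)).2 : Cn (n + 1)))

/-- The pair `(φ, F)` is non-degenerate on `V`: `Φ = con(φ, F)` is Kählerian on `ℂ^* × V` and
`γ(Φ, Φ) ≠ 0` there. -/
def IsNondegeneratePair {n : ℕ} (V : Set (Cn n)) (φ : Cn n → Phase n) (F : Cn n → ℂ) : Prop :=
  IsKaehlerian (cstarProd V) (con φ F) ∧
    ∀ Z ∈ cstarProd V, gam (con φ F Z) (con φ F Z) ≠ 0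

/-! ### Projective special Kähler metrics -/

/-- The function `K = g(ξ, ξ)`. -/
def conePotential {n : ℕ} (g : Tensor2 (Cn (n + 1))) (Z : Cn (n + 1)) : ℝ :=
  g Z (coneField Z) (coneField Z)

/-- The form `∂f` of a real function `f`. -/
def delForm {k : ℕ} (f : Cn k → ℝ) (p u : Cn k) : ℂ :=
  ((fderiv ℝ f p u : ℂ) - Complex.I * (fderiv ℝ f p (J u) : ℂ)) / 2

/-- The tensor field `g' = - g / K + (∂K)(∂̄K) / K²`. The product of one-forms is the symmetric
product, so that `(∂K)(∂̄K)(u, u) = |∂K(u)|²`. -/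
def horizontalTensor {n : ℕ} (g : Tensor2 (Cn (n + 1))) : Tensor2 (Cn (n + 1)) := fun Z u v =>
  - g Z u v / conePotential g Z
    + (delForm (conePotential g) Z u * (starRingEnd ℂ) (delForm (conePotential g) Z v)).re
      / conePotential g Z ^ 2

/-- `(Mbar, gbar)` is the projective special Kähler manifold obtained as the quotient by `ℂ^*` of
the conical affine special Kähler manifold `(ℂ^* × Mbar, J, g, ∇, ξ)`: the metric `gbar` is
determined by `π^* gbar = g'`, where `π : ℂ^* × Mbar → Mbar` is the quotient map. -/
structure IsPSKQuotient {n : ℕ} (g : Tensor2 (Cn (n + 1))) (Γ : Conn (Cn (n + 1)))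
    (Mbar : Set (Cn n)) (gbar : Tensor2 (Cn n)) : Prop where
  conical : IsConicalASK (cstarProd Mbar) g Γ coneField
  kaehler : IsPseudoKaehler Mbar gbar
  pullback : ∀ Z ∈ cstarProd Mbar, ∀ u v,
    gbar (base Z) (base u) (base v) = horizontalTensor g Z u v

/-! ### The ASK/PSK-correspondence -/

/-- The germ at `q` of `(φ, F)` is the germ of a special Kähler pair of `(M, J, g, ∇)`. -/
def IsPairGerm {n : ℕ} (M : Set (Cn n)) (g : Tensor2 (Cn n)) (Γ : Conn (Cn n)) (q : Cn n)
    (φ : Cn n → Phase n) (F : Cn n → ℂ) : Prop :=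
  ∃ V : Set (Cn n), q ∈ V ∧ V ⊆ M ∧ IsSpecialKaehlerPair g Γ V φ F

/-- The germ at `q` of `(φ, F)` is a non-degenerate germ of a special Kähler pair. -/
def IsNondegenerateGerm {n : ℕ} (M : Set (Cn n)) (g : Tensor2 (Cn n)) (Γ : Conn (Cn n))
    (q : Cn n) (φ : Cn n → Phase n) (F : Cn n → ℂ) : Prop :=
  ∃ V : Set (Cn n), q ∈ V ∧ V ⊆ M ∧ IsSpecialKaehlerPair g Γ V φ F ∧ IsNondegeneratePair V φ F

/-- `(φs t, Fs t)`, `t ∈ [0, 1]`, is the analytic continuation of the special Kähler pair germ of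
`(φ, F)` at `p` along the path `c` in `M`, i.e. the horizontal lift of `c` to the bundle of germs
of special Kähler pairs. -/
structure IsContinuation {n : ℕ} (M : Set (Cn n)) (g : Tensor2 (Cn n)) (Γ : Conn (Cn n))
    (φ : Cn n → Phase n) (F : Cn n → ℂ) {p q : Cn n} (c : Path p q)
    (φs : unitInterval → Cn n → Phase n) (Fs : unitInterval → Cn n → ℂ) : Prop where
  mem : ∀ t, c t ∈ M
  start : φs 0 =ᶠ[𝓝 p] φ ∧ Fs 0 =ᶠ[𝓝 p] F
  pair : ∀ t, IsPairGerm M g Γ (c t) (φs t) (Fs t)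
  locally_const : ∀ t, ∀ᶠ s in 𝓝 t, φs s =ᶠ[𝓝 (c s)] φs t ∧ Fs s =ᶠ[𝓝 (c s)] Fs t

/-- A continuation all of whose germs are non-degenerate. -/
def IsNondegenerateContinuation {n : ℕ} (M : Set (Cn n)) (g : Tensor2 (Cn n))
    (Γ : Conn (Cn n)) (φ : Cn n → Phase n) (F : Cn n → ℂ) {p q : Cn n} (c : Path p q)
    (φs : unitInterval → Cn n → Phase n) (Fs : unitInterval → Cn n → ℂ) : Prop :=
  IsContinuation M g Γ φ F c φs Fs ∧ ∀ t, IsNondegenerateGerm M g Γ (c t) (φs t) (Fs t)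

/-- The domain of non-degeneracy `dom(u)` of the germ `u` of `(φ, F)` at `p`. -/
def nondegDomain {n : ℕ} (M : Set (Cn n)) (g : Tensor2 (Cn n)) (Γ : Conn (Cn n)) (p : Cn n)
    (φ : Cn n → Phase n) (F : Cn n → ℂ) : Set (Cn n) :=
  {q | ∃ (c : Path p q) (φs : unitInterval → Cn n → Phase n) (Fs : unitInterval → Cn n → ℂ),
    IsNondegenerateContinuation M g Γ φ F c φs Fs}

/-- The affine action `a ↦ X a + v` on `ℂ^{2n}` of a real matrix `X` and a real vector `v`. -/
def affAct {n : ℕ} (X : Matrix (Fin n ⊕ Fin n) (Fin n ⊕ Fin n) ℝ) (v : Fin n ⊕ Fin n → ℝ)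
    (a : Phase n) : Phase n :=
  let b : Fin n ⊕ Fin n → ℂ :=
    (X.map Complex.ofReal).mulVec (Sum.elim a.1 a.2) + fun j => (v j : ℂ)
  (fun i => b (Sum.inl i), fun i => b (Sum.inr i))

/-- The first component `x φ` of the action of `x = (X, s, v) ∈ G = Sp(ℝ^{2n}) ⋉ Heis_{2n+1}(ℝ)` on
special Kähler pairs. -/
def actPhi {n : ℕ} (X : Matrix (Fin n ⊕ Fin n) (Fin n ⊕ Fin n) ℝ) (v : Fin n ⊕ Fin n → ℝ)
    (φ : Cn n → Phase n) : Cn n → Phase n := fun p => affAct X v (φ p)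

/-- The second component
`x · F = F - (1/2) z^t w + (1/2) z'^t w' + (1/2) Ω(xφ, v) - s` of this action, where `φ = (z, w)`
and `xφ = (z', w')`. -/
def actF {n : ℕ} (X : Matrix (Fin n ⊕ Fin n) (Fin n ⊕ Fin n) ℝ) (s : ℝ)
    (v : Fin n ⊕ Fin n → ℝ) (φ : Cn n → Phase n) (F : Cn n → ℂ) : Cn n → ℂ := fun p =>
  F p - (∑ i, (φ p).1 i * (φ p).2 i) / 2
    + (∑ i, (actPhi X v φ p).1 i * (actPhi X v φ p).2 i) / 2
    + Omega (actPhi X v φ p) (fun i => (v (Sum.inl i) : ℂ), fun i => (v (Sum.inr i) : ℂ)) / 2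
    - (s : ℂ)

/-- The holonomy group (at the germ of `(φ, F)` at `p`) of the bundle of special Kähler pairs of
`(M, J, g, ∇)` is contained in `G`: continuation along a loop changes the germ by an element
of `G`. -/
def HolonomyInG {n : ℕ} (M : Set (Cn n)) (g : Tensor2 (Cn n)) (Γ : Conn (Cn n)) (p : Cn n)
    (φ : Cn n → Phase n) (F : Cn n → ℂ) : Prop :=
  ∀ (c : Path p p) (φs : unitInterval → Cn n → Phase n) (Fs : unitInterval → Cn n → ℂ),
    IsContinuation M g Γ φ F c φs Fs →
      ∃ X ∈ Matrix.symplecticGroup (Fin n) ℝ, ∃ (s : ℝ) (v : Fin n ⊕ Fin n → ℝ),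
        φs 1 =ᶠ[𝓝 p] actPhi X v φ ∧ Fs 1 =ᶠ[𝓝 p] actF X s v φ F

/-- The ASK/PSK-correspondence maps the connected affine special Kähler manifold `(M, J, g, ∇)` and
the germ `u` at `p` of the special Kähler pair `(φ, F)` to `(Mbar, gbar)`. Here `Mbar = dom(u)`,
and `gbar` is the quotient metric of the conical affine special Kähler structure on
`ℂ^* × dom(u)` which near a point over `q ∈ dom(u)` is induced by the conification of the
continuation of `u` to `q`. -/
structure IsASKPSKImage {n : ℕ} (M : Set (Cn n)) (g : Tensor2 (Cn n)) (Γ : Conn (Cn n))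
    (p : Cn n) (φ : Cn n → Phase n) (F : Cn n → ℂ) (Mbar : Set (Cn n)) (gbar : Tensor2 (Cn n)) :
    Prop where
  connected : IsConnected M
  ask : IsAffineSpecialKaehler M g Γ
  germ : IsNondegenerateGerm M g Γ p φ F
  holonomy : HolonomyInG M g Γ p φ F
  domain_eq : Mbar = nondegDomain M g Γ p φ F
  quotient : ∃ (ghat : Tensor2 (Cn (n + 1))) (Γhat : Conn (Cn (n + 1))),
    IsPSKQuotient ghat Γhat Mbar gbar ∧
    ∀ (q : Cn n) (c : Path p q) (φs : unitInterval → Cn n → Phase n)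
      (Fs : unitInterval → Cn n → ℂ), IsNondegenerateContinuation M g Γ φ F c φs Fs →
      ∀ Z ∈ cstarProd Mbar, base Z = q → ∀ u v,
        ghat Z u v = inducedMetric (con (φs 1) (Fs 1)) Z u v ∧
        Γhat Z u v = inducedConn (con (φs 1) (Fs 1)) Z u v

/-! ### Isometries and completeness -/

/-- `(S, g)` and `(S', g')` are isometric: there is a diffeomorphism `f : S → S'` with
`f^* g' = g`. -/
def AreIsometric {E : Type*} [NormedAddCommGroup E] [NormedSpace ℝ E]
    (S : Set E) (g : Tensor2 E) (S' : Set E) (g' : Tensor2 E) : Prop :=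
  ∃ f f' : E → E, MapsTo f S S' ∧ MapsTo f' S' S ∧ InvOn f' f S S' ∧
    ContDiffOn ℝ ∞ f S ∧ ContDiffOn ℝ ∞ f' S' ∧
    ∀ p ∈ S, ∀ u v, g' (f p) (fderiv ℝ f p u) (fderiv ℝ f p v) = g p u v

/-- The length of a curve `c : [0, 1] → E` with respect to `g`. -/
def curveLength {E : Type*} [NormedAddCommGroup E] [NormedSpace ℝ E] (g : Tensor2 E)
    (c : ℝ → E) : ℝ≥0∞ :=
  ∫⁻ t in Icc (0 : ℝ) 1, ENNReal.ofReal
    (Real.sqrt (g (c t) (derivWithin c (Icc 0 1) t) (derivWithin c (Icc 0 1) t)))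

/-- The Riemannian distance of a submanifold `S` with Riemannian metric `g`: the infimum of the
lengths of the `C¹` curves in `S` between two points. -/
def riemDist {E : Type*} [NormedAddCommGroup E] [NormedSpace ℝ E] (S : Set E) (g : Tensor2 E)
    (x y : E) : ℝ≥0∞ :=
  ⨅ (c : ℝ → E) (_ : ContDiffOn ℝ 1 c (Icc 0 1) ∧ MapsTo c (Icc 0 1) S ∧ c 0 = x ∧ c 1 = y),
    curveLength g c

/-- The Riemannian manifold `(S, g)` is complete: every Cauchy sequence for the Riemannian distance
converges. -/
def IsRiemComplete {E : Type*} [NormedAddCommGroup E] [NormedSpace ℝ E] (S : Set E)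
    (g : Tensor2 E) : Prop :=
  ∀ a : ℕ → E, (∀ m, a m ∈ S) →
    (∀ ε : ℝ≥0∞, 0 < ε → ∃ N, ∀ m ≥ N, ∀ l ≥ N, riemDist S g (a m) (a l) < ε) →
    ∃ x ∈ S, Tendsto (fun m => riemDist S g (a m) x) atTop (𝓝 0)

/-! ### Projective special real manifolds and the r-map -/

/-- The Hessian of a real function. -/
def hess {E : Type*} [NormedAddCommGroup E] [NormedSpace ℝ E] (f : E → ℝ) : Tensor2 E :=
  fun x u v => fderiv ℝ (fun y => fderiv ℝ f y v) x u

/-- The function on `ℝ^n` given by the polynomial `h`. -/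
def realFun {n : ℕ} (h : MvPolynomial (Fin n) ℝ) (x : Fin n → ℝ) : ℝ := MvPolynomial.eval x h

/-- The centroaffine metric `g_U = -∂²h`. On tangent vectors of `{h = 1}` it is the metric of the
projective special real manifold. -/
def gU {n : ℕ} (h : MvPolynomial (Fin n) ℝ) : Tensor2 (Fin n → ℝ) :=
  fun x u v => - hess (realFun h) x u v

/-- The level set `{h = 1} ⊆ U`. -/
def levelSet {n : ℕ} (h : MvPolynomial (Fin n) ℝ) (U : Set (Fin n → ℝ)) : Set (Fin n → ℝ) :=
  {x ∈ U | realFun h x = 1}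

/-- The homogeneous cubic polynomial `h` and the conical domain `U`, on which `h` is positive, define
a projective special real manifold: `-∂²h` is positive definite on the tangent spaces of the
hypersurface `{h = 1} ⊆ U`. -/
structure IsProjectiveSpecialReal {n : ℕ} (h : MvPolynomial (Fin n) ℝ) (U : Set (Fin n → ℝ)) :
    Prop where
  homogeneous : h.IsHomogeneous 3
  isOpen : IsOpen U
  connected : IsConnected U
  cone : ∀ r : ℝ, 0 < r → ∀ x ∈ U, r • x ∈ U
  pos : ∀ x ∈ U, 0 < realFun h x
  posDef : ∀ x ∈ levelSet h U, ∀ v, fderiv ℝ (realFun h) x v = 0 → v ≠ 0 → 0 < gU h x v v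

/-- The set `U_c`. -/
def Uc {n : ℕ} (h : MvPolynomial (Fin n) ℝ) (U : Set (Fin n → ℝ)) (c : ℝ) : Set (Fin n → ℝ) :=
  {x ∈ U | (c ≤ 0 → 0 < realFun h x + c) ∧ (0 < c → 0 < realFun h x - 2 * c)}

/-- The imaginary part `x` of `z = y + i x`. -/
def imPart {n : ℕ} (z : Cn n) : Fin n → ℝ := fun i => (z i).im

/-- The real part `y` of `z = y + i x`. -/
def rePt {n : ℕ} (z : Cn n) : Fin n → ℝ := fun i => (z i).re

/-- The tube `ℝ^n + i U`. -/
def tube {n : ℕ} (U : Set (Fin n → ℝ)) : Set (Cn n) := {z | imPart z ∈ U}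

/-- The function `F - 2 i c`, where `F(z) = -h(z)`. -/
def prepot {n : ℕ} (h : MvPolynomial (Fin n) ℝ) (c : ℝ) (z : Cn n) : ℂ :=
  - MvPolynomial.aeval z h - 2 * Complex.I * (c : ℂ)

/-- The map `dF : z ↦ (z, ∂F/∂z)`. -/
def graphOfDifferential {n : ℕ} (F : Cn n → ℂ) (z : Cn n) : Phase n :=
  (z, fun i => fderiv ℂ F z (Pi.single i 1))

/-- The metric `(1/4) diag(-∂² log(h + c), -∂² log(h + c))` in the real coordinates `(y, x)` of
`z = y + i x`. -/
def deformedMetric {n : ℕ} (h : MvPolynomial (Fin n) ℝ) (c : ℝ) : Tensor2 (Cn n) := fun z u v =>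
  (- hess (fun x => Real.log (realFun h x + c)) (imPart z) (rePt u) (rePt v)
    - hess (fun x => Real.log (realFun h x + c)) (imPart z) (imPart u) (imPart v)) / 4

/-- The metric `∑ (∂²K / ∂z^i ∂z̄^j) dz^i dz̄^j` with Kähler potential `K`. -/
def metricOfPotential {k : ℕ} (K : Cn k → ℝ) : Tensor2 (Cn k) := fun z u v =>
  (hess K z u v + hess K z (J u) (J v)) / 4

/-- The supergravity r-map metric, with Kähler potential `-log h(x)`, on `ℝ^n + i U`. -/
def rMapMetric {n : ℕ} (h : MvPolynomial (Fin n) ℝ) : Tensor2 (Cn n) :=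
  metricOfPotential (fun z => - Real.log (realFun h (imPart z)))

end

end SpecialGeometry

open SpecialGeometry

namespace SpecialGeometry

noncomputable section

set_option maxSynthPendingDepth 3

/-! ### The polar form of a homogeneous cubic polynomial -/

/-! A homogeneous cubic is governed by its symmetric trilinear polarisation P = `polar`: h(x) =
P(x,x,x), dh = 3P(x,x,·), ∂²h = 6P(x,·,·), over ℝ and over ℂ alike. All metrics become algebra in P,
and z - z̄ = 2ix eliminates the real part y.

Euler's relation gives 2F - z^t w = h(z) - 4ic for the shifted prepotential, so the conification is
Φ = z⁰(1, z, h(z) - 4ic, -∂h(z)). Recognising the cube of z - z̄ yields γ(Φ,Φ) = -8|z⁰|²(h(x) + c)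
(`con_eq`, `gam_conePoint`). Thus the constant in F replaces h by h + c in the cone potential, and
the quotient metric is -∂² log(h + c)/4 in both blocks (`horizontalTensor_con`). For positivity,
`logMetric_self_eq` splits this Hessian into a term controlled by a reversed Cauchy-Schwarz
inequality, which comes from definiteness on the level set, and a radial term with the factor h -
2c. The set U_c is the part of U where h + c and h - 2c are both positive. The same computation
shows that Φ is Kählerian.

The special Kähler axioms hold for every Kählerian Lagrangian immersion φ: Re φ is a local
diffeomorphism and the Kähler form is the pullback of the constant symplectic form
(`isAffineSpecialKaehler_induced`, `isConicalASK_induced`). Since the pair is globally defined on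
the connected set M_c, the identity theorem makes every continuation a germ of that pair; hence
dom(u) = M_c and the holonomy is trivial (`isASKPSKImage_of_pair`).

The r-map case is c = 0. The isometries are the dilations z ↦ rz, which turn c into r³c. For c < 0,
the length of a curve controls its radial projection to the level set, the variation of log(h + c)
and, once x is confined to a compact set, the variation of y. A Cauchy sequence therefore converges:
the bound on log(h + c) keeps it away from h = -c, and completeness of the level set supplies a
limiting direction inside U (`isRiemComplete_deformedMetric`). -/

lemma pderiv_pderiv_comm {n : ℕ} (i j : Fin n) (f : MvPolynomial (Fin n) ℝ) :
    MvPolynomial.pderiv i (MvPolynomial.pderiv j f)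
      = MvPolynomial.pderiv j (MvPolynomial.pderiv i f) := by
  have h : ⁅MvPolynomial.pderiv (R := ℝ) i, MvPolynomial.pderiv (R := ℝ) j⁆ = 0 := by
    apply MvPolynomial.derivation_ext
    intro k
    simp [Derivation.commutator_apply, MvPolynomial.pderiv_X, Pi.single_apply, apply_ite]
  have := congrArg (fun D => D f) h
  simpa [Derivation.commutator_apply, sub_eq_zero] using this

/-- The coefficients `∂_i ∂_j ∂_k h / 6` of the polar form of `h`. -/
def polarCoeff {n : ℕ} (h : MvPolynomial (Fin n) ℝ) (i j k : Fin n) : ℝ :=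
  MvPolynomial.coeff 0
    (MvPolynomial.pderiv i (MvPolynomial.pderiv j (MvPolynomial.pderiv k h))) / 6

/-- The symmetric trilinear form over `𝕜` with `polar 𝕜 h x x x = h x`. -/
def polar (𝕜 : Type*) [RCLike 𝕜] {n : ℕ} (h : MvPolynomial (Fin n) ℝ) :
    (Fin n → 𝕜) →L[𝕜] (Fin n → 𝕜) →L[𝕜] (Fin n → 𝕜) →L[𝕜] 𝕜 :=
  ∑ i, ∑ j, ∑ k, (polarCoeff h i j k : 𝕜) •
    (ContinuousLinearMap.proj i : (Fin n → 𝕜) →L[𝕜] 𝕜).smulRight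
      ((ContinuousLinearMap.proj j : (Fin n → 𝕜) →L[𝕜] 𝕜).smulRight
        (ContinuousLinearMap.proj k : (Fin n → 𝕜) →L[𝕜] 𝕜))

section

variable {𝕜 : Type*} [RCLike 𝕜] {n : ℕ} (h : MvPolynomial (Fin n) ℝ)

lemma polar_apply (u v w : Fin n → 𝕜) :
    polar 𝕜 h u v w = ∑ i, ∑ j, ∑ k, (polarCoeff h i j k : 𝕜) * (u i * (v j * w k)) := by
  simp [polar, RCLike.real_smul_eq_coe_mul]

lemma polarCoeff_swap_left (i j k : Fin n) : polarCoeff h i j k = polarCoeff h j i k := by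
  rw [polarCoeff, pderiv_pderiv_comm, polarCoeff]

lemma polarCoeff_swap_right (i j k : Fin n) : polarCoeff h i j k = polarCoeff h i k j := by
  rw [polarCoeff, pderiv_pderiv_comm j k, polarCoeff]

lemma polar_swap_left (u v w : Fin n → 𝕜) : polar 𝕜 h u v w = polar 𝕜 h v u w := by
  rw [polar_apply, polar_apply, Finset.sum_comm]
  refine Finset.sum_congr rfl fun i _ => Finset.sum_congr rfl fun j _ =>
    Finset.sum_congr rfl fun k _ => ?_
  rw [polarCoeff_swap_left]
  ring

lemma polar_swap_right (u v w : Fin n → 𝕜) : polar 𝕜 h u v w = polar 𝕜 h u w v := by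
  rw [polar_apply, polar_apply]
  refine Finset.sum_congr rfl fun i _ => ?_
  rw [Finset.sum_comm]
  refine Finset.sum_congr rfl fun j _ => Finset.sum_congr rfl fun k _ => ?_
  rw [polarCoeff_swap_right]
  ring

lemma polar_rotate (u v w : Fin n → 𝕜) : polar 𝕜 h u v w = polar 𝕜 h v w u := by
  rw [polar_swap_left, polar_swap_right]

variable {h}

/-- Euler's identity applied to h, to its first derivatives and to its second derivatives gives 6h =
∑ x_i x_j x_k ∂_i∂_j∂_k h. The third derivatives have degree 0, so they equal their constant
coefficients. -/
lemma polar_self (hh : h.IsHomogeneous 3) (x : Fin n → 𝕜) :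
    polar 𝕜 h x x x = MvPolynomial.aeval x h := by
  have key : (6 : MvPolynomial (Fin n) ℝ) * h = ∑ i, ∑ j, ∑ k, MvPolynomial.X i *
      (MvPolynomial.X j * (MvPolynomial.X k *
        (MvPolynomial.pderiv k (MvPolynomial.pderiv j (MvPolynomial.pderiv i h))))) := by
    have e1 := hh.sum_X_mul_pderiv
    have e2 := fun i => (hh.pderiv (i := i)).sum_X_mul_pderiv
    have e3 := fun i j => ((hh.pderiv (i := i)).pderiv (i := j)).sum_X_mul_pderiv
    simp_rw [← Finset.mul_sum, e3]
    simp only [Nat.add_one_sub_one, one_smul]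
    simp_rw [e2, Nat.reduceSub, two_smul, mul_add, Finset.sum_add_distrib, e1]
    simp only [nsmul_eq_mul]
    push_cast
    ring
  have key2 := congrArg (MvPolynomial.aeval x) key
  simp only [map_mul, map_sum, MvPolynomial.aeval_X, map_ofNat] at key2
  have c : ∀ i j k, MvPolynomial.aeval x
      (MvPolynomial.pderiv k (MvPolynomial.pderiv j (MvPolynomial.pderiv i h)))
        = 6 * (polarCoeff h i j k : 𝕜) := by
    intro i j k
    have h0 : (MvPolynomial.pderiv k (MvPolynomial.pderiv j
        (MvPolynomial.pderiv i h))).IsHomogeneous 0 := ((hh.pderiv (i := i)).pderiv (i := j)).pderiv (i := k)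
    -- Three transpositions reverse the order of the indices, to match the order of differentiation
    -- on the left.
    rw [polarCoeff_swap_left, polarCoeff_swap_right, polarCoeff_swap_left, polarCoeff]
    have := MvPolynomial.totalDegree_eq_zero_iff_eq_C.1
      ((MvPolynomial.totalDegree_zero_iff_isHomogeneous _).2 h0)
    rw [this, MvPolynomial.aeval_C, MvPolynomial.coeff_C, if_pos rfl]
    simp only [RCLike.algebraMap_eq_ofReal]
    push_cast
    ring
  have : (6 : 𝕜) * polar 𝕜 h x x x = 6 * MvPolynomial.aeval x h := by
    rw [key2, polar_apply, Finset.mul_sum]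
    refine Finset.sum_congr rfl fun i _ => ?_
    rw [Finset.mul_sum]
    refine Finset.sum_congr rfl fun j _ => ?_
    rw [Finset.mul_sum]
    refine Finset.sum_congr rfl fun k _ => ?_
    rw [c]
    ring
  exact mul_left_cancel₀ (by norm_num) this

lemma polar_self_real (hh : h.IsHomogeneous 3) (x : Fin n → ℝ) :
    realFun h x = polar ℝ h x x x := by
  rw [polar_self hh, realFun, MvPolynomial.aeval_eq_eval]

variable (h)

lemma polar_ofReal (x y z : Fin n → ℝ) :
    polar ℂ h (fun i => (x i : ℂ)) (fun i => (y i : ℂ)) (fun i => (z i : ℂ))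
      = (polar ℝ h x y z : ℂ) := by
  simp [polar_apply]

lemma polar_conj (x y z : Cn n) :
    (starRingEnd ℂ) (polar ℂ h x y z) = polar ℂ h (star x) (star y) (star z) := by
  simp [polar_apply]

/-- The derivative of the cubic form `z ↦ polar z z z`. -/
lemma hasFDerivAt_polar_self (z : Fin n → 𝕜) :
    HasFDerivAt (fun z => polar 𝕜 h z z z) ((3 : 𝕜) • polar 𝕜 h z z) z := by
  have h1 : HasFDerivAt (fun z : Fin n → 𝕜 => z) (ContinuousLinearMap.id 𝕜 _) z := hasFDerivAt_id z
  have h2 := (((polar 𝕜 h).hasFDerivAt (x := z)).clm_apply h1).clm_apply h1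
  refine h2.congr_fderiv ?_
  ext1 u
  simp
  rw [polar_rotate h z u z, polar_rotate h u z z]
  ring

lemma hasFDerivAt_polar_diag (v : Fin n → 𝕜) (z : Fin n → 𝕜) :
    HasFDerivAt (fun z => polar 𝕜 h z z v) ((2 : 𝕜) • polar 𝕜 h z v) z := by
  have h1 : HasFDerivAt (fun z : Fin n → 𝕜 => z) (ContinuousLinearMap.id 𝕜 _) z := hasFDerivAt_id z
  have h2 := (((polar 𝕜 h).hasFDerivAt (x := z)).clm_apply h1).clm_apply (hasFDerivAt_const v z)
  refine h2.congr_fderiv ?_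
  ext1 u
  simp
  rw [polar_swap_left h u z v, polar_swap_right h z u v]
  ring

lemma hasFDerivAt_polar_left (u v : Fin n → 𝕜) (z : Fin n → 𝕜) :
    HasFDerivAt (fun z => polar 𝕜 h z u v) (polar 𝕜 h u v) z := by
  have h2 := (((polar 𝕜 h).hasFDerivAt (x := z)).clm_apply (hasFDerivAt_const u z)).clm_apply
    (hasFDerivAt_const v z)
  refine h2.congr_fderiv ?_
  ext1 w
  simp [polar_rotate h w u v]

end

section

variable {n : ℕ} {h : MvPolynomial (Fin n) ℝ}

lemma realFun_eq (hh : h.IsHomogeneous 3) : realFun h = fun x => polar ℝ h x x x :=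
  funext (polar_self_real hh)

lemma hasFDerivAt_realFun (hh : h.IsHomogeneous 3) (x : Fin n → ℝ) :
    HasFDerivAt (realFun h) ((3 : ℝ) • polar ℝ h x x) x := by
  rw [realFun_eq hh]
  exact hasFDerivAt_polar_self h x

lemma fderiv_realFun (hh : h.IsHomogeneous 3) (x v : Fin n → ℝ) :
    fderiv ℝ (realFun h) x v = 3 * polar ℝ h x x v := by
  simp [(hasFDerivAt_realFun hh x).fderiv]

lemma hess_realFun (hh : h.IsHomogeneous 3) (x u v : Fin n → ℝ) :
    hess (realFun h) x u v = 6 * polar ℝ h x u v := by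
  have : (fun y => fderiv ℝ (realFun h) y v) = fun y => 3 * polar ℝ h y y v :=
    funext fun y => fderiv_realFun hh y v
  rw [hess, this, ((hasFDerivAt_polar_diag h v x).const_mul 3).fderiv]
  simp
  rw [polar_swap_right]
  ring

lemma gU_eq (hh : h.IsHomogeneous 3) (x u v : Fin n → ℝ) :
    gU h x u v = -(6 * polar ℝ h x u v) := by
  rw [gU, hess_realFun hh]

lemma contDiff_polar {𝕜 : Type*} [RCLike 𝕜] {E : Type*} [NormedAddCommGroup E] [NormedSpace 𝕜 E]
    {m : WithTop ℕ∞} {f g k : E → Fin n → 𝕜} (hf : ContDiff 𝕜 m f) (hg : ContDiff 𝕜 m g)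
    (hk : ContDiff 𝕜 m k) : ContDiff 𝕜 m fun x => polar 𝕜 h (f x) (g x) (k x) :=
  have h1 : ContDiff 𝕜 m fun x => polar 𝕜 h (f x) := (polar 𝕜 h).contDiff.comp hf
  (h1.clm_apply hg).clm_apply hk

lemma contDiff_realFun (hh : h.IsHomogeneous 3) {m : WithTop ℕ∞} : ContDiff ℝ m (realFun h) := by
  rw [realFun_eq hh]
  exact contDiff_polar contDiff_id contDiff_id contDiff_id

end

/-! ### The Hermitian form and the real symplectic form -/

lemma gam_eq {k : ℕ} (a b : Phase k) : gam a b = Complex.I *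
    ∑ i, (a.1 i * (starRingEnd ℂ) (b.2 i) - a.2 i * (starRingEnd ℂ) (b.1 i)) := rfl

lemma gam_add_left {k : ℕ} (a b c : Phase k) : gam (a + b) c = gam a c + gam b c := by
  simp only [gam_eq, ← mul_add, ← Finset.sum_add_distrib]
  congr 1
  refine Finset.sum_congr rfl fun i _ => ?_
  simp
  ring

lemma gam_smul_left {k : ℕ} (r : ℂ) (a b : Phase k) : gam (r • a) b = r * gam a b := by
  simp only [gam_eq, Finset.mul_sum]
  refine Finset.sum_congr rfl fun i _ => ?_
  simp
  ring

lemma conj_gam {k : ℕ} (a b : Phase k) : (starRingEnd ℂ) (gam a b) = gam b a := by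
  simp only [gam_eq, map_mul, map_sum, Complex.conj_I, Finset.mul_sum]
  refine Finset.sum_congr rfl fun i _ => ?_
  simp
  ring

lemma gam_add_right {k : ℕ} (a b c : Phase k) : gam a (b + c) = gam a b + gam a c := by
  rw [← conj_gam, gam_add_left, map_add, conj_gam, conj_gam]

lemma gam_smul_right {k : ℕ} (r : ℂ) (a b : Phase k) :
    gam a (r • b) = (starRingEnd ℂ) r * gam a b := by
  rw [← conj_gam, gam_smul_left, map_mul, conj_gam]

lemma gam_real_smul_left {k : ℕ} (r : ℝ) (a b : Phase k) : gam (r • a) b = r * gam a b := by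
  rw [← gam_smul_left, Complex.coe_smul]

lemma gam_real_smul_right {k : ℕ} (r : ℝ) (a b : Phase k) : gam a (r • b) = r * gam a b := by
  rw [← Complex.coe_smul, gam_smul_right, Complex.conj_ofReal]

lemma re_gam_comm {k : ℕ} (a b : Phase k) : (gam a b).re = (gam b a).re := by
  rw [← conj_gam, Complex.conj_re]

/-- `γ` as a continuous real bilinear map. -/
def gamL (k : ℕ) : Phase k →L[ℝ] Phase k →L[ℝ] ℂ :=
  (LinearMap.mk₂ ℝ gam gam_add_left
    (fun r a b => by rw [gam_real_smul_left, Complex.real_smul])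
    gam_add_right
    (fun r a b => by rw [gam_real_smul_right, Complex.real_smul])).toContinuousBilinearMap

@[simp] lemma gamL_apply {k : ℕ} (a b : Phase k) : gamL k a b = gam a b := rfl

/-- The standard symplectic form of `ℝ^{2k}`. -/
def realOmega (k : ℕ) : ((Fin k → ℝ) × (Fin k → ℝ)) →L[ℝ] ((Fin k → ℝ) × (Fin k → ℝ)) →L[ℝ] ℝ :=
  (LinearMap.mk₂ ℝ (fun a b => ∑ i, (a.1 i * b.2 i - a.2 i * b.1 i))
    (fun a b c => by
      rw [← Finset.sum_add_distrib]
      exact Finset.sum_congr rfl fun i _ => by simp; ring)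
    (fun r a b => by
      rw [smul_eq_mul, Finset.mul_sum]
      exact Finset.sum_congr rfl fun i _ => by simp; ring)
    (fun a b c => by
      rw [← Finset.sum_add_distrib]
      exact Finset.sum_congr rfl fun i _ => by simp; ring)
    (fun r a b => by
      rw [smul_eq_mul, Finset.mul_sum]
      exact Finset.sum_congr rfl fun i _ => by simp; ring)).toContinuousBilinearMap

lemma realOmega_apply {k : ℕ} (a b : (Fin k → ℝ) × (Fin k → ℝ)) :
    realOmega k a b = ∑ i, (a.1 i * b.2 i - a.2 i * b.1 i) := rfl

lemma realOmega_neg_swap {k : ℕ} (a b : (Fin k → ℝ) × (Fin k → ℝ)) :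
    realOmega k a b = -realOmega k b a := by
  rw [realOmega_apply, realOmega_apply, ← Finset.sum_neg_distrib]
  exact Finset.sum_congr rfl fun i _ => by ring

/-- The real part `ℂ^{2k} → ℝ^{2k}`. -/
def phaseRe (k : ℕ) : Phase k →L[ℝ] (Fin k → ℝ) × (Fin k → ℝ) :=
  LinearMap.toContinuousLinearMap
    { toFun := fun a => (fun i => (a.1 i).re, fun i => (a.2 i).re)
      map_add' := fun a b => by ext <;> simp
      map_smul' := fun r a => by ext <;> simp }

lemma phaseRe_apply {k : ℕ} (a : Phase k) :
    phaseRe k a = (fun i => (a.1 i).re, fun i => (a.2 i).re) := rfl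

/-- Adding Re Ω(a, b) = 0 to Im γ(a, b) combines b and its conjugate into twice the real part of b.
On a Lagrangian immersion this identifies the Kähler form with the pullback of the constant
symplectic form by Re φ. -/
lemma im_gam_of_Omega_eq_zero {k : ℕ} {a b : Phase k} (hab : Omega a b = 0) :
    (gam a b).im = 2 * realOmega k (phaseRe k a) (phaseRe k b) := by
  have h1 : (gam a b).im = (gam a b).im + (Omega a b).re := by simp [hab]
  rw [h1, gam_eq, realOmega_apply, Omega, Complex.I_mul_im, Complex.re_sum, Complex.re_sum,
    ← Finset.sum_add_distrib, Finset.mul_sum]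
  refine Finset.sum_congr rfl fun i _ => ?_
  simp [phaseRe_apply]
  ring

lemma tau_of_phaseRe_eq_zero {k : ℕ} {a : Phase k} (ha : phaseRe k a = 0) : tau a = -a := by
  have h1 : ∀ i, (a.1 i).re = 0 := fun i => congrFun (congrArg Prod.fst ha) i
  have h2 : ∀ i, (a.2 i).re = 0 := fun i => congrFun (congrArg Prod.snd ha) i
  ext i <;> apply Complex.ext <;> simp [tau, h1, h2]

lemma Omega_neg_right {k : ℕ} (a b : Phase k) : Omega a (-b) = -Omega a b := by
  simp only [Omega, ← Finset.sum_neg_distrib]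
  exact Finset.sum_congr rfl fun i _ => by simp; ring

/-! ### Second derivatives of holomorphic maps -/

section SecondDerivative

variable {k : ℕ} {G : Type*} [NormedAddCommGroup G] [NormedSpace ℂ G]

/-- The second derivative of a holomorphic map. -/
def sndDeriv (φ : Cn k → G) (p u v : Cn k) : G := fderiv ℂ (fun q => fderiv ℂ φ q v) p u

variable {φ : Cn k → G}

lemma contDiff_fderiv_apply (hφ : ContDiff ℂ ∞ φ) (v : Cn k) :
    ContDiff ℂ ∞ fun q => fderiv ℂ φ q v :=
  (hφ.fderiv_right (m := ∞) (by simp)).clm_apply contDiff_const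

lemma sndDeriv_eq (hφ : ContDiff ℂ ∞ φ) (p u v : Cn k) :
    sndDeriv φ p u v = fderiv ℂ (fderiv ℂ φ) p u v := by
  have h1 : DifferentiableAt ℂ (fderiv ℂ φ) p :=
    (hφ.fderiv_right (m := ∞) (by simp)).differentiable (by simp) p
  rw [sndDeriv, (h1.hasFDerivAt.clm_apply (hasFDerivAt_const v p)).fderiv]
  simp

lemma sndDeriv_comm (hφ : ContDiff ℂ ∞ φ) (p u v : Cn k) :
    sndDeriv φ p u v = sndDeriv φ p v u := by
  rw [sndDeriv_eq hφ, sndDeriv_eq hφ]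
  refine (hφ.contDiffAt (x := p)).isSymmSndFDerivAt ?_ u v
  simp only [minSmoothness_of_isRCLikeNormedField]
  exact WithTop.coe_le_coe.2 le_top

lemma sndDeriv_smul_left (φ : Cn k → G) (p : Cn k) (r : ℂ) (u v : Cn k) :
    sndDeriv φ p (r • u) v = r • sndDeriv φ p u v := by simp [sndDeriv]

lemma sndDeriv_add_left (φ : Cn k → G) (p u u' v : Cn k) :
    sndDeriv φ p (u + u') v = sndDeriv φ p u v + sndDeriv φ p u' v := by simp [sndDeriv]

lemma sndDeriv_smul_right (hφ : ContDiff ℂ ∞ φ) (p : Cn k) (r : ℂ) (u v : Cn k) :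
    sndDeriv φ p u (r • v) = r • sndDeriv φ p u v := by simp [sndDeriv_eq hφ]

lemma sndDeriv_add_right (hφ : ContDiff ℂ ∞ φ) (p u v v' : Cn k) :
    sndDeriv φ p u (v + v') = sndDeriv φ p u v + sndDeriv φ p u v' := by simp [sndDeriv_eq hφ]

lemma contDiff_sndDeriv (hφ : ContDiff ℂ ∞ φ) (u v : Cn k) :
    ContDiff ℂ ∞ fun p => sndDeriv φ p u v :=
  contDiff_fderiv_apply (contDiff_fderiv_apply hφ v) u

/-- The real derivative of a directional derivative. -/
lemma hasFDerivAt_real_fderiv_apply (hφ : ContDiff ℂ ∞ φ) (v p : Cn k) :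
    HasFDerivAt (𝕜 := ℝ) (fun q => fderiv ℂ φ q v)
      ((fderiv ℂ (fun q => fderiv ℂ φ q v) p).restrictScalars ℝ) p :=
  (((contDiff_fderiv_apply hφ v).differentiable (by simp) p).hasFDerivAt).restrictScalars ℝ

end SecondDerivative

/-! ### Affine special Kähler structures induced by Kählerian Lagrangian immersions -/

section Induced

variable {k : ℕ} {φ : Cn k → Phase k}

lemma fderiv_rePart (hφ : ContDiff ℂ ∞ φ) (p : Cn k) :
    fderiv ℝ (rePart φ) p = (phaseRe k).comp ((fderiv ℂ φ p).restrictScalars ℝ) :=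
  ((phaseRe k).hasFDerivAt.comp p
    ((hφ.differentiable (by simp) p).hasFDerivAt.restrictScalars ℝ)).fderiv

lemma fderiv_rePart_apply (hφ : ContDiff ℂ ∞ φ) (p u : Cn k) :
    fderiv ℝ (rePart φ) p u = phaseRe k (fderiv ℂ φ p u) := by
  rw [fderiv_rePart hφ]
  rfl

lemma fderiv_fderiv_rePart (hφ : ContDiff ℂ ∞ φ) (p u v : Cn k) :
    fderiv ℝ (fun q => fderiv ℝ (rePart φ) q v) p u = phaseRe k (sndDeriv φ p u v) := by
  simp_rw [fderiv_rePart_apply hφ]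
  have := (phaseRe k).hasFDerivAt.comp p (hasFDerivAt_real_fderiv_apply hφ v p)
  exact congrArg (fun L => L u) this.fderiv

lemma contDiff_rePart (hφ : ContDiff ℂ ∞ φ) : ContDiff ℝ ∞ (rePart φ) :=
  (phaseRe k).contDiff.comp (hφ.restrict_scalars ℝ)

lemma inducedConn_eq (hφ : ContDiff ℂ ∞ φ) (p u v : Cn k) :
    inducedConn φ p u v = (fderiv ℝ (rePart φ) p).inverse (phaseRe k (sndDeriv φ p u v)) := by
  rw [inducedConn, fderiv_fderiv_rePart hφ]

lemma kform_inducedMetric (φ : Cn k → Phase k) (p u v : Cn k) :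
    kform (inducedMetric φ) p u v = (gam (fderiv ℂ φ p u) (fderiv ℂ φ p v)).im / 2 := by
  simp [kform, inducedMetric, J, gam_smul_right]

/-- A vector w with Re dφ(w) = 0 satisfies τ(dφ w) = -dφ w, so γ(dφ v, dφ w) = -iΩ(dφ v, dφ w) = 0
for all v, and the Kählerian condition forces w = 0. Hence Re φ is a local diffeomorphism. -/
lemma phaseRe_injOn {a b : Cn k} {p : Cn k}
    (hL : ∀ u v, Omega (fderiv ℂ φ p u) (fderiv ℂ φ p v) = 0)
    (hK : ∀ u, (∀ v, gam (fderiv ℂ φ p u) (fderiv ℂ φ p v) = 0) → u = 0)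
    (hab : phaseRe k (fderiv ℂ φ p a) = phaseRe k (fderiv ℂ φ p b)) : a = b := by
  rw [← sub_eq_zero]
  apply hK
  intro v
  have h0 : phaseRe k (fderiv ℂ φ p (a - b)) = 0 := by
    rw [map_sub, map_sub, hab, sub_self]
  rw [← conj_gam, gam, tau_of_phaseRe_eq_zero h0, Omega_neg_right, hL]
  simp

lemma isInvertible_fderiv_rePart (hφ : ContDiff ℂ ∞ φ) {p : Cn k}
    (hL : ∀ u v, Omega (fderiv ℂ φ p u) (fderiv ℂ φ p v) = 0)
    (hK : ∀ u, (∀ v, gam (fderiv ℂ φ p u) (fderiv ℂ φ p v) = 0) → u = 0) :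
    (fderiv ℝ (rePart φ) p).IsInvertible := by
  have hinj : Function.Injective (fderiv ℝ (rePart φ) p).toLinearMap := by
    intro a b hab
    simp only [ContinuousLinearMap.coe_coe, fderiv_rePart_apply hφ] at hab
    exact phaseRe_injOn hL hK hab
  have hd : Module.finrank ℝ (Cn k) = Module.finrank ℝ ((Fin k → ℝ) × (Fin k → ℝ)) := by
    simp [Module.finrank_pi_fintype]
    ring
  refine ⟨(LinearEquiv.ofInjectiveOfFinrankEq _ hinj hd).toContinuousLinearEquiv, ?_⟩
  ext1 u
  rfl

/-- The working characterisation of ∇: identities between connection terms are tested after applying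
the injective map d(Re φ), where they become identities between derivatives of φ. -/
lemma phaseRe_fderiv_inducedConn (hφ : ContDiff ℂ ∞ φ) {p : Cn k}
    (hL : ∀ u v, Omega (fderiv ℂ φ p u) (fderiv ℂ φ p v) = 0)
    (hK : ∀ u, (∀ v, gam (fderiv ℂ φ p u) (fderiv ℂ φ p v) = 0) → u = 0) (u v : Cn k) :
    phaseRe k (fderiv ℂ φ p (inducedConn φ p u v)) = phaseRe k (sndDeriv φ p u v) := by
  rw [← fderiv_rePart_apply hφ, inducedConn_eq hφ]
  exact (isInvertible_fderiv_rePart hφ hL hK).self_apply_inverse _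

/-- The real derivative of `γ(dφ v, dφ w)`. -/
lemma hasFDerivAt_gam_fderiv (hφ : ContDiff ℂ ∞ φ) (p v w : Cn k) :
    ∃ L : Cn k →L[ℝ] ℂ, HasFDerivAt (𝕜 := ℝ)
      (fun q => gam (fderiv ℂ φ q v) (fderiv ℂ φ q w)) L p ∧
      ∀ u, L u = gam (sndDeriv φ p u v) (fderiv ℂ φ p w)
        + gam (fderiv ℂ φ p v) (sndDeriv φ p u w) := by
  have h1 := (gamL k).hasFDerivAt.comp p (hasFDerivAt_real_fderiv_apply hφ v p)
  have h2 := h1.clm_apply (hasFDerivAt_real_fderiv_apply hφ w p)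
  refine ⟨_, h2, fun u => ?_⟩
  simp [sndDeriv, add_comm]

lemma hasFDerivAt_realOmega (hφ : ContDiff ℂ ∞ φ) (p v w : Cn k) :
    ∃ L : Cn k →L[ℝ] ℝ, HasFDerivAt (𝕜 := ℝ)
      (fun q => realOmega k (phaseRe k (fderiv ℂ φ q v)) (phaseRe k (fderiv ℂ φ q w))) L p ∧
      ∀ u, L u = realOmega k (phaseRe k (sndDeriv φ p u v)) (phaseRe k (fderiv ℂ φ p w))
        + realOmega k (phaseRe k (fderiv ℂ φ p v)) (phaseRe k (sndDeriv φ p u w)) := by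
  have h0 := fun v => (phaseRe k).hasFDerivAt.comp p (hasFDerivAt_real_fderiv_apply hφ v p)
  have h1 := (realOmega k).hasFDerivAt.comp p (h0 v)
  have h2 := h1.clm_apply (h0 w)
  refine ⟨_, h2, fun u => ?_⟩
  simp [sndDeriv, add_comm]

variable {M : Set (Cn k)}

lemma kform_eq_realOmega {p : Cn k}
    (hL : ∀ u v, Omega (fderiv ℂ φ p u) (fderiv ℂ φ p v) = 0) (v w : Cn k) :
    kform (inducedMetric φ) p v w =
      realOmega k (phaseRe k (fderiv ℂ φ p v)) (phaseRe k (fderiv ℂ φ p w)) := by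
  rw [kform_inducedMetric, im_gam_of_Omega_eq_zero (hL v w)]
  ring

lemma fderiv_kform (hM : IsOpen M) (hφ : ContDiff ℂ ∞ φ)
    (hL : ∀ p ∈ M, ∀ u v, Omega (fderiv ℂ φ p u) (fderiv ℂ φ p v) = 0)
    {p : Cn k} (hp : p ∈ M) (u v w : Cn k) :
    fderiv ℝ (fun q => kform (inducedMetric φ) q v w) p u =
      realOmega k (phaseRe k (sndDeriv φ p u v)) (phaseRe k (fderiv ℂ φ p w))
        + realOmega k (phaseRe k (fderiv ℂ φ p v)) (phaseRe k (sndDeriv φ p u w)) := by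
  obtain ⟨L, h1, h2⟩ := hasFDerivAt_realOmega hφ p v w
  have : (fun q => kform (inducedMetric φ) q v w) =ᶠ[𝓝 p]
      fun q => realOmega k (phaseRe k (fderiv ℂ φ q v)) (phaseRe k (fderiv ℂ φ q w)) := by
    filter_upwards [hM.mem_nhds hp] with q hq
    exact kform_eq_realOmega (hL q hq) v w
  rw [this.fderiv_eq, h1.fderiv, h2]

lemma contDiff_inducedMetric (hφ : ContDiff ℂ ∞ φ) (u v : Cn k) :
    ContDiff ℝ ∞ fun p => inducedMetric φ p u v := by
  have h0 := fun v => (contDiff_fderiv_apply hφ v).restrict_scalars ℝ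
  have h1 : ContDiff ℝ ∞ fun p => gamL k (fderiv ℂ φ p u) (fderiv ℂ φ p v) :=
    ((gamL k).contDiff.comp (h0 u)).clm_apply (h0 v)
  exact (Complex.reCLM.contDiff.comp h1).div_const 2

lemma isPseudoKaehler_inducedMetric (hM : IsOpen M) (hφ : ContDiff ℂ ∞ φ)
    (hL : ∀ p ∈ M, ∀ u v, Omega (fderiv ℂ φ p u) (fderiv ℂ φ p v) = 0)
    (hK : IsKaehlerian M φ) : IsPseudoKaehler M (inducedMetric φ) where
  isOpen := hM
  linear p _ u :=
    { map_add := fun v w => by simp [inducedMetric, gam_add_right]; ring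
      map_smul := fun r v => by
        simp [inducedMetric, ContinuousLinearMap.map_smul_of_tower, gam_real_smul_right]; ring }
  symm p _ u v := by rw [inducedMetric, re_gam_comm, inducedMetric]
  smooth u v := (contDiff_inducedMetric hφ u v).contDiffOn
  nondegenerate p hp u hu := by
    refine hK p hp u fun v => ?_
    -- The metric sees only Re γ; the test vector J v supplies the imaginary part.
    have h1 := hu v
    have h2 := hu (J v)
    simp only [inducedMetric, J, map_smul, gam_smul_right] at h1 h2
    apply Complex.ext
    · simpa using h1
    · simpa using h2
  hermitian p _ u v := by
    simp only [inducedMetric, J, map_smul, gam_smul_left, gam_smul_right]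
    congr 2
    rw [← mul_assoc]
    simp
  closed p hp u v w := by
    -- In the cyclic sum every second derivative occurs twice, in opposite slots of the
    -- antisymmetric form, so the terms cancel.
    rw [fderiv_kform hM hφ hL hp, fderiv_kform hM hφ hL hp, fderiv_kform hM hφ hL hp,
      sndDeriv_comm hφ p w u, sndDeriv_comm hφ p v u, sndDeriv_comm hφ p w v,
      realOmega_neg_swap (phaseRe k (sndDeriv φ p v w)),
      realOmega_neg_swap (phaseRe k (sndDeriv φ p u w)),
      realOmega_neg_swap (phaseRe k (sndDeriv φ p u v))]
    ring

lemma contDiffAt_inducedConn (hφ : ContDiff ℂ ∞ φ) {p : Cn k}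
    (hL : ∀ u v, Omega (fderiv ℂ φ p u) (fderiv ℂ φ p v) = 0)
    (hK : ∀ u, (∀ v, gam (fderiv ℂ φ p u) (fderiv ℂ φ p v) = 0) → u = 0) (u v : Cn k) :
    ContDiffAt ℝ ∞ (fun q => inducedConn φ q u v) p := by
  simp_rw [inducedConn_eq hφ]
  have h1 : ContDiff ℝ ∞ (fderiv ℝ (rePart φ)) :=
    (contDiff_rePart hφ).fderiv_right (m := ∞) (by simp)
  have h2 : ContDiff ℝ ∞ fun p => phaseRe k (sndDeriv φ p u v) :=
    (phaseRe k).contDiff.comp ((contDiff_sndDeriv hφ u v).restrict_scalars ℝ)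
  exact (((isInvertible_fderiv_rePart hφ hL hK).contDiffAt_map_inverse).comp p
    h1.contDiffAt).clm_apply h2.contDiffAt

/-- Kählerian Lagrangian immersions induce affine special Kähler structures. -/
theorem isAffineSpecialKaehler_induced (hM : IsOpen M) (hφ : ContDiff ℂ ∞ φ)
    (hL : ∀ p ∈ M, ∀ u v, Omega (fderiv ℂ φ p u) (fderiv ℂ φ p v) = 0)
    (hK : IsKaehlerian M φ) :
    IsAffineSpecialKaehler M (inducedMetric φ) (inducedConn φ) where
  kaehler := isPseudoKaehler_inducedMetric hM hφ hL hK
  linear_left p _ v :=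
    { map_add := fun u u' => by simp [inducedConn]
      map_smul := fun r u => by simp [inducedConn] }
  linear_right p _ u :=
    { map_add := fun v v' => by
        simp only [inducedConn_eq hφ, sndDeriv_add_right hφ, map_add]
      map_smul := fun r v => by
        have : sndDeriv φ p u (r • v) = r • sndDeriv φ p u v := by
          simpa using sndDeriv_smul_right hφ p (r : ℂ) u v
        simp only [inducedConn_eq hφ, this, map_smul] }
  smooth u v p hp := (contDiffAt_inducedConn hφ (hL p hp) (hK p hp) u v).contDiffWithinAt
  torsion_free p _ u v := by rw [inducedConn_eq hφ, inducedConn_eq hφ, sndDeriv_comm hφ]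
  flat p hp u v w := by
    -- Differentiating d(Re φ)(∇_v w) = Re(∂_v∂_w φ) along u shows that d(Re φ) sends ∇_u∇_v w to
    -- the real part of the third derivative of φ, which is symmetric in u and v.
    have key : ∀ u v, phaseRe k (fderiv ℂ φ p (fderiv ℝ (fun q => inducedConn φ q v w) p u
        + inducedConn φ p u (inducedConn φ p v w)))
        = phaseRe k (sndDeriv (fun q => fderiv ℂ φ q w) p u v) := by
      intro u v
      have hev : (fun q => fderiv ℝ (rePart φ) q (inducedConn φ q v w)) =ᶠ[𝓝 p]
          fun q => phaseRe k (sndDeriv φ q v w) := by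
        filter_upwards [hM.mem_nhds hp] with q hq
        rw [fderiv_rePart_apply hφ, phaseRe_fderiv_inducedConn hφ (hL q hq) (hK q hq)]
      have hA : HasFDerivAt (fderiv ℝ (rePart φ)) (fderiv ℝ (fderiv ℝ (rePart φ)) p) p :=
        (((contDiff_rePart hφ).fderiv_right (m := ∞) (by simp)).differentiable
          (by simp) p).hasFDerivAt
      have hΓ := ((contDiffAt_inducedConn hφ (hL p hp) (hK p hp) v w).differentiableAt
        (by simp)).hasFDerivAt
      have hR : fderiv ℝ (fun q => phaseRe k (sndDeriv φ q v w)) p u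
          = phaseRe k (sndDeriv (fun q => fderiv ℂ φ q w) p u v) := by
        have := (phaseRe k).hasFDerivAt (x := sndDeriv φ p v w) |>.comp p
          (hasFDerivAt_real_fderiv_apply (contDiff_fderiv_apply hφ w) v p)
        exact congrArg (fun L => L u) this.fderiv
      have hS : ∀ x, fderiv ℝ (fderiv ℝ (rePart φ)) p u x = phaseRe k (sndDeriv φ p u x) := by
        intro x
        rw [← fderiv_fderiv_rePart hφ, (hA.clm_apply (hasFDerivAt_const x p)).fderiv]
        simp
      have hE := congrArg (fun L => L u) (hev.fderiv_eq (𝕜 := ℝ))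
      simp only [hR, (hA.clm_apply hΓ).fderiv] at hE
      rw [← hE, map_add, map_add, phaseRe_fderiv_inducedConn hφ (hL p hp) (hK p hp)]
      simp [hS, fderiv_rePart_apply hφ]
    rw [sub_eq_zero]
    apply phaseRe_injOn (hL p hp) (hK p hp)
    rw [key, key, sndDeriv_comm (contDiff_fderiv_apply hφ w)]
  parallel_form p hp u v w := by
    rw [fderiv_kform hM hφ hL hp, kform_eq_realOmega (hL p hp), kform_eq_realOmega (hL p hp),
      phaseRe_fderiv_inducedConn hφ (hL p hp) (hK p hp),
      phaseRe_fderiv_inducedConn hφ (hL p hp) (hK p hp)]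
    ring
  ext_deriv_J p hp u v := by
    -- The second derivative of φ is complex bilinear and symmetric, so the factor i can be moved
    -- from one slot to the other.
    have h1 : inducedConn φ p u (J v) = inducedConn φ p v (J u) := by
      rw [inducedConn_eq hφ, inducedConn_eq hφ, J, J, sndDeriv_smul_right hφ,
        sndDeriv_smul_right hφ, sndDeriv_comm hφ]
    have h2 : inducedConn φ p u v = inducedConn φ p v u := by
      rw [inducedConn_eq hφ, inducedConn_eq hφ, sndDeriv_comm hφ]
    rw [h1, h2, sub_self]

/-- The Levi-Civita connection of the metric induced by a Kählerian immersion. -/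
lemma exists_isLeviCivita_induced (hφ : ContDiff ℂ ∞ φ) (hK : IsKaehlerian M φ) :
    ∃ D : Conn (Cn k), IsLeviCivita M (inducedMetric φ) D ∧
      ∀ p ∈ M, ∀ u v w, gam (fderiv ℂ φ p (D p u v)) (fderiv ℂ φ p w)
        = gam (sndDeriv φ p u v) (fderiv ℂ φ p w) := by
  have hinj : ∀ p ∈ M, ∀ a b, (∀ w, gam (fderiv ℂ φ p a) (fderiv ℂ φ p w)
      = gam (fderiv ℂ φ p b) (fderiv ℂ φ p w)) → a = b := by
    intro p hp a b hab
    rw [← sub_eq_zero]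
    refine hK p hp _ fun v => ?_
    have := gam_add_left (fderiv ℂ φ p (a - b)) (fderiv ℂ φ p b) (fderiv ℂ φ p v)
    rw [← map_add, sub_add_cancel, hab v] at this
    simpa using this
  -- D_u v is the γ-orthogonal projection of ∂_u∂_v φ to the image of dφ. It exists because the real
  -- metric is non-degenerate in finite dimension; testing on w and J w recovers the complex
  -- equation. Off M the value is an irrelevant 0.
  have hex : ∀ p u v, ∃ x, p ∈ M → ∀ w, gam (fderiv ℂ φ p x) (fderiv ℂ φ p w)
      = gam (sndDeriv φ p u v) (fderiv ℂ φ p w) := by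
    intro p u v
    by_cases hp : p ∈ M
    swap
    · exact ⟨0, fun h => absurd h hp⟩
    let B : Cn k →ₗ[ℝ] Cn k →ₗ[ℝ] ℝ := LinearMap.mk₂ ℝ (fun a b => inducedMetric φ p a b)
      (fun a b c => by simp [inducedMetric, gam_add_left]; ring)
      (fun r a b => by
        simp [inducedMetric, ContinuousLinearMap.map_smul_of_tower, gam_real_smul_left]; ring)
      (fun a b c => by simp [inducedMetric, gam_add_right]; ring)
      (fun r a b => by
        simp [inducedMetric, ContinuousLinearMap.map_smul_of_tower, gam_real_smul_right]; ring)
    have hB : Function.Injective B := by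
      rw [← LinearMap.ker_eq_bot, LinearMap.ker_eq_bot']
      intro u hu
      refine hK p hp u fun v => ?_
      have h1 : inducedMetric φ p u v = 0 := congrArg (fun L => L v) hu
      have h2 : inducedMetric φ p u (J v) = 0 := congrArg (fun L => L (J v)) hu
      simp only [inducedMetric, J, map_smul, gam_smul_right] at h1 h2
      apply Complex.ext
      · simpa using h1
      · simpa using h2
    have hsurj : Function.Surjective B :=
      (LinearMap.injective_iff_surjective_of_finrank_eq_finrank
        (Subspace.dual_finrank_eq).symm).1 hB
    let L : Cn k →ₗ[ℝ] ℝ :=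
      { toFun := fun w => (gam (sndDeriv φ p u v) (fderiv ℂ φ p w)).re / 2
        map_add' := fun a b => by simp [gam_add_right]; ring
        map_smul' := fun r a => by
          simp [ContinuousLinearMap.map_smul_of_tower, gam_real_smul_right]; ring }
    obtain ⟨x, hx⟩ := hsurj L
    refine ⟨x, fun _ w => ?_⟩
    have h1 : (gam (fderiv ℂ φ p x) (fderiv ℂ φ p w)).re / 2
      = (gam (sndDeriv φ p u v) (fderiv ℂ φ p w)).re / 2 := congrArg (fun L => L w) hx
    have h2 : (gam (fderiv ℂ φ p x) (fderiv ℂ φ p (J w))).re / 2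
      = (gam (sndDeriv φ p u v) (fderiv ℂ φ p (J w))).re / 2 := congrArg (fun L => L (J w)) hx
    simp only [J, map_smul, gam_smul_right] at h2
    apply Complex.ext
    · linarith
    · simpa using h2
  choose D hD using hex
  refine ⟨D, ⟨fun p hp v => ⟨fun a b => ?_, fun r a => ?_⟩,
    fun p hp u => ⟨fun a b => ?_, fun r a => ?_⟩, fun p hp u v => ?_, fun p hp u v w => ?_⟩,
    fun p hp u v w => hD p u v hp w⟩
  · refine hinj p hp _ _ fun w => ?_
    rw [hD p _ _ hp, map_add, gam_add_left, hD p _ _ hp, hD p _ _ hp, sndDeriv_add_left,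
      gam_add_left]
  · refine hinj p hp _ _ fun w => ?_
    have h1 : r • D p a v = (r : ℂ) • D p a v := by simp
    have h2 : r • a = (r : ℂ) • a := by simp
    rw [hD p _ _ hp, h1, h2, map_smul, gam_smul_left, hD p _ _ hp, sndDeriv_smul_left,
      gam_smul_left]
  · refine hinj p hp _ _ fun w => ?_
    rw [hD p _ _ hp, map_add, gam_add_left, hD p _ _ hp, hD p _ _ hp, sndDeriv_add_right hφ,
      gam_add_left]
  · refine hinj p hp _ _ fun w => ?_
    have h1 : r • D p u a = (r : ℂ) • D p u a := by simp
    have h2 : r • a = (r : ℂ) • a := by simp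
    rw [hD p _ _ hp, h1, h2, map_smul, gam_smul_left, hD p _ _ hp, sndDeriv_smul_right hφ,
      gam_smul_left]
  · refine hinj p hp _ _ fun w => ?_
    rw [hD p _ _ hp, hD p _ _ hp, sndDeriv_comm hφ]
  · obtain ⟨L, hL1, hL2⟩ := hasFDerivAt_gam_fderiv hφ p v w
    have h1 := (Complex.reCLM.hasFDerivAt.comp p hL1).mul_const (1 / 2 : ℝ)
    have h2 : fderiv ℝ (fun q => inducedMetric φ q v w) p u = (L u).re / 2 := by
      have h3 : (fun q => inducedMetric φ q v w) = fun q =>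
          (Complex.reCLM ∘ fun q => gam (fderiv ℂ φ q v) (fderiv ℂ φ q w)) q * (1 / 2 : ℝ) := by
        funext q
        simp [inducedMetric]
        ring
      rw [h3, h1.fderiv]
      simp
      ring
    rw [h2, hL2, inducedMetric, inducedMetric, hD p u v hp, re_gam_comm _ (fderiv ℂ φ p (D p u w)),
      hD p u w hp, re_gam_comm (sndDeriv φ p u w), Complex.add_re]
    ring

/-- A Kählerian Lagrangian immersion that is homogeneous along a vector field `ξ` induces a
conical affine special Kähler structure. -/
theorem isConicalASK_induced {ξ : Cn k → Cn k} (hM : IsOpen M) (hφ : ContDiff ℂ ∞ φ)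
    (hL : ∀ p ∈ M, ∀ u v, Omega (fderiv ℂ φ p u) (fderiv ℂ φ p v) = 0)
    (hK : IsKaehlerian M φ) (hξ : ContDiff ℂ ∞ ξ) (hom : ∀ p, fderiv ℂ φ p (ξ p) = φ p)
    (h0 : ∀ p ∈ M, gam (φ p) (φ p) ≠ 0) :
    IsConicalASK M (inducedMetric φ) (inducedConn φ) ξ := by
  have hd : ∀ p u, fderiv ℝ ξ p u = fderiv ℂ ξ p u := fun p u => by
    rw [((hξ.differentiable (by simp) p).hasFDerivAt.restrictScalars ℝ).fderiv]
    rfl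
  -- This is the derivative of dφ(ξ) = φ. Both ∇ and D are determined by the second derivative of φ,
  -- so this one relation gives both ∇ξ = Id and Dξ = Id.
  have key : ∀ p u, sndDeriv φ p u (ξ p) = fderiv ℂ φ p (u - fderiv ℝ ξ p u) := by
    intro p u
    have h1 : HasFDerivAt (fderiv ℂ φ) (fderiv ℂ (fderiv ℂ φ) p) p :=
      ((hφ.fderiv_right (m := ∞) (by simp)).differentiable (by simp) p).hasFDerivAt
    have h2 := (h1.clm_apply (hξ.differentiable (by simp) p).hasFDerivAt).fderiv
    have h3 : (fun q => fderiv ℂ φ q (ξ q)) = φ := funext hom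
    rw [h3] at h2
    have h4 := congrArg (fun L => L u) h2
    simp only [add_apply, ContinuousLinearMap.comp_apply,
      ContinuousLinearMap.flip_apply] at h4
    rw [map_sub, h4, hd, sndDeriv_eq hφ]
    simp
  refine ⟨isAffineSpecialKaehler_induced hM hφ hL hK, (hξ.restrict_scalars ℝ).contDiffOn,
    fun p hp => ?_, fun p hp u => ?_, ?_⟩
  · rw [inducedMetric, hom]
    intro h
    apply h0 p hp
    have h1 : (gam (φ p) (φ p)).im = 0 := Complex.conj_eq_iff_im.1 (conj_gam _ _)
    apply Complex.ext
    · simpa using h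
    · simpa using h1
  · rw [← eq_sub_iff_add_eq']
    apply phaseRe_injOn (hL p hp) (hK p hp)
    rw [phaseRe_fderiv_inducedConn hφ (hL p hp) (hK p hp), key]
  · obtain ⟨D, hD, hD'⟩ := exists_isLeviCivita_induced hφ hK
    refine ⟨D, hD, fun p hp u => ?_⟩
    rw [← eq_sub_iff_add_eq', ← sub_eq_zero]
    refine hK p hp _ fun w => ?_
    have := gam_add_left (fderiv ℂ φ p (D p u (ξ p) - (u - fderiv ℝ ξ p u)))
      (fderiv ℂ φ p (u - fderiv ℝ ξ p u)) (fderiv ℂ φ p w)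
    rw [← map_add, sub_add_cancel, hD' p hp, key] at this
    simpa using this

end Induced

/-! ### The domains `U_c` -/

section Domain

variable {n : ℕ} {h : MvPolynomial (Fin n) ℝ} {U : Set (Fin n → ℝ)} {c : ℝ}

lemma realFun_smul (hh : h.IsHomogeneous 3) (r : ℝ) (x : Fin n → ℝ) :
    realFun h (r • x) = r ^ 3 * realFun h x := by
  simp [polar_self_real hh]
  ring

lemma Uc_subset : Uc h U c ⊆ U := fun _ hx => hx.1

lemma add_pos_of_mem_Uc {x : Fin n → ℝ} (hx : x ∈ Uc h U c) : 0 < realFun h x + c := by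
  rcases le_or_gt c 0 with hc | hc
  · exact hx.2.1 hc
  · linarith [hx.2.2 hc]

lemma sub_pos_of_mem_Uc (hU : IsProjectiveSpecialReal h U) {x : Fin n → ℝ} (hx : x ∈ Uc h U c) :
    0 < realFun h x - 2 * c := by
  rcases le_or_gt c 0 with hc | hc
  · linarith [hU.pos x hx.1]
  · exact hx.2.2 hc

/-- The maximum is -c for c ≤ 0 and 2c for c > 0. A single lower bound on h allows both signs to be
treated together. -/
lemma Uc_eq (h : MvPolynomial (Fin n) ℝ) (U : Set (Fin n → ℝ)) (c : ℝ) :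
    Uc h U c = {x ∈ U | max (-c) (2 * c) < realFun h x} := by
  ext x
  constructor
  · rintro ⟨hx, h1, h2⟩
    refine ⟨hx, max_lt ?_ ?_⟩
    · rcases le_or_gt c 0 with hc | hc
      · linarith [h1 hc]
      · linarith [h2 hc]
    · rcases le_or_gt c 0 with hc | hc
      · linarith [h1 hc]
      · linarith [h2 hc]
  · rintro ⟨hx, h1⟩
    rw [max_lt_iff] at h1
    exact ⟨hx, fun _ => by linarith, fun _ => by linarith⟩

lemma isOpen_Uc (hU : IsProjectiveSpecialReal h U) (c : ℝ) : IsOpen (Uc h U c) := by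
  rw [Uc_eq]
  have : Continuous (realFun h) := (contDiff_realFun hU.homogeneous (m := 0)).continuous
  exact hU.isOpen.inter (isOpen_lt continuous_const this)

lemma Uc_zero (hU : IsProjectiveSpecialReal h U) : Uc h U 0 = U := by
  rw [Uc_eq]
  ext x
  simp only [neg_zero, mul_zero, max_self, mem_ofPred_eq, and_iff_left_iff_imp]
  exact hU.pos x

lemma smul_mem_Uc (hU : IsProjectiveSpecialReal h U) {r : ℝ} (hr : 0 < r) {c' : ℝ}
    (hc : c' = r ^ 3 * c) {x : Fin n → ℝ} (hx : x ∈ Uc h U c) : r • x ∈ Uc h U c' := by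
  have h3 : 0 < r ^ 3 := by positivity
  refine ⟨hU.cone r hr x hx.1, fun _ => ?_, fun _ => ?_⟩
  · rw [realFun_smul hU.homogeneous, hc, ← mul_add]
    exact mul_pos h3 (add_pos_of_mem_Uc hx)
  · rw [realFun_smul hU.homogeneous, hc]
    have := mul_pos h3 (sub_pos_of_mem_Uc hU hx)
    linarith

lemma rpow_third_pow {a : ℝ} (ha : 0 ≤ a) : (a ^ (1 / 3 : ℝ)) ^ 3 = a := by
  rw [← Real.rpow_natCast, ← Real.rpow_mul ha]
  norm_num

/-- Moving along rays so that h increases by a = max(-c, 2c) maps U continuously onto U_c. -/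
lemma isConnected_Uc (hU : IsProjectiveSpecialReal h U) (c : ℝ) : IsConnected (Uc h U c) := by
  set a := max (-c) (2 * c) with ha
  have ha0 : 0 ≤ a := by
    rcases le_or_gt c 0 with hc | hc
    · exact le_max_of_le_left (by linarith)
    · exact le_max_of_le_right (by linarith)
  have hcont : Continuous (realFun h) := (contDiff_realFun hU.homogeneous (m := 0)).continuous
  have himg : Uc h U c
      = (fun x => (((realFun h x + a) / realFun h x) ^ (1 / 3 : ℝ)) • x) '' U := by
    rw [Uc_eq]
    ext x
    constructor
    · rintro ⟨hx, hx2⟩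
      have hx0 := hU.pos x hx
      have hq : 0 < (realFun h x - a) / realFun h x := div_pos (by linarith) hx0
      set r := ((realFun h x - a) / realFun h x) ^ (1 / 3 : ℝ) with hr
      have hr0 : 0 < r := Real.rpow_pos_of_pos hq _
      have hr3 : r ^ 3 = (realFun h x - a) / realFun h x := rpow_third_pow hq.le
      refine ⟨r • x, hU.cone r hr0 x hx, ?_⟩
      have e : realFun h (r • x) = realFun h x - a := by
        rw [realFun_smul hU.homogeneous, hr3]
        field_simp
      have hpos : 0 < realFun h x - a := by linarith
      have e2 : ((realFun h x - a + a) / (realFun h x - a)) ^ (1 / 3 : ℝ) = r⁻¹ := by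
        rw [hr, ← Real.inv_rpow hq.le, inv_div]
        simp
      simp only [e, e2, smul_smul]
      rw [inv_mul_cancel₀ hr0.ne', one_smul]
    · rintro ⟨y, hy, rfl⟩
      have hy0 := hU.pos y hy
      have hq : 0 < (realFun h y + a) / realFun h y := div_pos (by linarith) hy0
      refine ⟨hU.cone _ (Real.rpow_pos_of_pos hq _) y hy, ?_⟩
      rw [realFun_smul hU.homogeneous, rpow_third_pow hq.le, div_mul_cancel₀ _ hy0.ne']
      linarith
  rw [himg]
  refine hU.connected.image _ ?_
  refine ContinuousOn.smul (ContinuousOn.rpow_const ?_ fun x hx => Or.inr (by norm_num))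
    continuousOn_id
  exact ((hcont.add continuous_const).continuousOn).div hcont.continuousOn
    fun x hx => (hU.pos x hx).ne'

/-- The complexification of a real vector. -/
def ofRealVec (x : Fin n → ℝ) : Cn n := fun i => (x i : ℂ)

lemma continuous_ofRealVec : Continuous (ofRealVec : (Fin n → ℝ) → Cn n) :=
  continuous_pi fun i => Complex.continuous_ofReal.comp (continuous_apply i)

/-- The imaginary part as a continuous linear map. -/
def imPartL (n : ℕ) : Cn n →L[ℝ] (Fin n → ℝ) :=
  ContinuousLinearMap.pi fun i => Complex.imCLM.comp (ContinuousLinearMap.proj i)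

/-- The real part as a continuous linear map. -/
def rePtL (n : ℕ) : Cn n →L[ℝ] (Fin n → ℝ) :=
  ContinuousLinearMap.pi fun i => Complex.reCLM.comp (ContinuousLinearMap.proj i)

@[simp] lemma imPartL_apply (z : Cn n) : imPartL n z = imPart z := rfl

@[simp] lemma rePtL_apply (z : Cn n) : rePtL n z = rePt z := rfl

lemma imPart_J (u : Cn n) : imPart (J u) = rePt u := by
  funext i; simp [imPart, J, rePt]

lemma rePt_J (u : Cn n) : rePt (J u) = -imPart u := by
  funext i; simp [imPart, J, rePt]

lemma eq_rePt_add_imPart (u : Cn n) :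
    u = ofRealVec (rePt u) + Complex.I • ofRealVec (imPart u) := by
  funext i
  simp only [ofRealVec, rePt, imPart, Pi.add_apply, Pi.smul_apply, smul_eq_mul]
  rw [mul_comm, Complex.re_add_im]

lemma imPart_add_mul_I (x y : Fin n → ℝ) : imPart (ofRealVec y + Complex.I • ofRealVec x) = x := by
  funext i; simp [imPart, ofRealVec]

lemma isOpen_tube {V : Set (Fin n → ℝ)} (hV : IsOpen V) : IsOpen (tube V) :=
  hV.preimage (imPartL n).continuous

lemma isConnected_tube {V : Set (Fin n → ℝ)} (hV : IsConnected V) : IsConnected (tube V) := by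
  have himg : tube V = (fun q : (Fin n → ℝ) × (Fin n → ℝ) =>
      ofRealVec q.1 + Complex.I • ofRealVec q.2) '' (univ ×ˢ V) := by
    ext z
    constructor
    · intro hz
      exact ⟨(rePt z, imPart z), ⟨mem_univ _, hz⟩, (eq_rePt_add_imPart z).symm⟩
    · rintro ⟨q, ⟨_, hq⟩, rfl⟩
      simpa only [tube, mem_ofPred_eq, imPart_add_mul_I] using hq
  rw [himg]
  refine (isConnected_univ.prod hV).image _ (Continuous.continuousOn ?_)
  have h1 : Continuous fun q : (Fin n → ℝ) × (Fin n → ℝ) => ofRealVec q.2 :=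
    continuous_ofRealVec.comp continuous_snd
  have h2 : Continuous fun q : (Fin n → ℝ) × (Fin n → ℝ) => Complex.I • ofRealVec q.2 :=
    continuous_pi fun i => continuous_const.mul ((continuous_apply i).comp h1)
  exact (continuous_ofRealVec.comp continuous_fst).add h2

/-! ### Positivity -/

/-- The form P(x, v, v) is linear in x and the tangency condition is invariant under scaling of x,
so the sign on the level set spreads along rays. -/
lemma polar_neg_of_tangent (hU : IsProjectiveSpecialReal h U) {x : Fin n → ℝ} (hx : x ∈ U)
    {v : Fin n → ℝ} (hv : polar ℝ h x x v = 0) (hv0 : v ≠ 0) : polar ℝ h x v v < 0 := by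
  have hx0 := hU.pos x hx
  set r := (realFun h x)⁻¹ ^ (1 / 3 : ℝ) with hr
  have hr0 : 0 < r := Real.rpow_pos_of_pos (inv_pos.2 hx0) _
  have hr3 : r ^ 3 = (realFun h x)⁻¹ := rpow_third_pow (inv_pos.2 hx0).le
  have hmem : r • x ∈ levelSet h U := by
    refine ⟨hU.cone r hr0 x hx, ?_⟩
    rw [realFun_smul hU.homogeneous, hr3, inv_mul_cancel₀ hx0.ne']
  have := hU.posDef _ hmem v (by simp [fderiv_realFun hU.homogeneous, hv]) hv0
  rw [gU_eq hU.homogeneous] at this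
  simp only [map_smul, smul_apply, smul_eq_mul] at this
  nlinarith

/-- The reversed Cauchy-Schwarz inequality. -/
lemma polar_mul_self_lt (hU : IsProjectiveSpecialReal h U) {x : Fin n → ℝ} (hx : x ∈ U)
    {v : Fin n → ℝ} (hv : v ≠ (polar ℝ h x x v / realFun h x) • x) :
    polar ℝ h x v v < polar ℝ h x x v ^ 2 / realFun h x := by
  have hx0 := hU.pos x hx
  -- With this t the vector v - tx is tangent to the level set of h through x.
  set t := polar ℝ h x x v / realFun h x with ht
  have hxx : polar ℝ h x x x = realFun h x := (polar_self_real hU.homogeneous x).symm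
  have hta : t * realFun h x = polar ℝ h x x v := div_mul_cancel₀ _ hx0.ne'
  have h1 : polar ℝ h x x (v - t • x) = 0 := by
    rw [map_sub, map_smul, hxx, smul_eq_mul, hta, sub_self]
  have h2 := polar_neg_of_tangent hU hx h1 (sub_ne_zero.2 hv)
  have h3 : polar ℝ h x (v - t • x) (v - t • x)
      = polar ℝ h x v v - polar ℝ h x x v ^ 2 / realFun h x := by
    simp only [map_sub, map_smul, sub_apply, smul_apply, smul_eq_mul, hxx,
      polar_swap_right h x v x]
    rw [ht]
    field_simp
    ring
  linarith

lemma polar_mul_self_le (hU : IsProjectiveSpecialReal h U) {x : Fin n → ℝ} (hx : x ∈ U)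
    (v : Fin n → ℝ) : polar ℝ h x v v ≤ polar ℝ h x x v ^ 2 / realFun h x := by
  by_cases hv : v = (polar ℝ h x x v / realFun h x) • x
  · have hx0 := hU.pos x hx
    have hxx : polar ℝ h x x x = realFun h x := (polar_self_real hU.homogeneous x).symm
    set t := polar ℝ h x x v / realFun h x with ht
    have hta : polar ℝ h x x v = t * realFun h x := (div_mul_cancel₀ _ hx0.ne').symm
    rw [hta, hv]
    simp only [map_smul, smul_apply, smul_eq_mul, hxx]
    apply le_of_eq
    field_simp
  · exact (polar_mul_self_lt hU hx hv).le

/-- The metric `-∂² log (h + c)`. -/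
def logMetric (h : MvPolynomial (Fin n) ℝ) (c : ℝ) : Tensor2 (Fin n → ℝ) := fun x u v =>
  -(6 * polar ℝ h x u v) / (realFun h x + c)
    + 9 * (polar ℝ h x x u * polar ℝ h x x v) / (realFun h x + c) ^ 2

/-- The first summand vanishes on the line ℝx and the second on vectors tangent to the level set of
h. The factor h - 2c is what decides positivity in the radial direction, whence the bound h > 2c for
c > 0. -/
lemma logMetric_self_eq (hU : IsProjectiveSpecialReal h U) {x : Fin n → ℝ} (hx : x ∈ Uc h U c)
    (v : Fin n → ℝ) : logMetric h c x v v =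
      6 * (polar ℝ h x x v ^ 2 / realFun h x - polar ℝ h x v v) / (realFun h x + c)
        + 3 * polar ℝ h x x v ^ 2 * (realFun h x - 2 * c)
          / (realFun h x * (realFun h x + c) ^ 2) := by
  have h0 := (hU.pos x hx.1).ne'
  have h1 := (add_pos_of_mem_Uc hx).ne'
  rw [logMetric]
  field_simp
  ring

/-- Off the line ℝx the reversed Cauchy-Schwarz inequality is strict; on it the radial summand is
positive. -/
lemma logMetric_pos (hU : IsProjectiveSpecialReal h U) {x : Fin n → ℝ} (hx : x ∈ Uc h U c)
    {v : Fin n → ℝ} (hv : v ≠ 0) : 0 < logMetric h c x v v := by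
  have h0 := hU.pos x hx.1
  have h1 := add_pos_of_mem_Uc hx
  have h2 := sub_pos_of_mem_Uc hU hx
  rw [logMetric_self_eq hU hx]
  by_cases hvx : v = (polar ℝ h x x v / realFun h x) • x
  · have ha : polar ℝ h x x v ≠ 0 := by
      intro ha
      rw [ha] at hvx
      simp at hvx
      exact hv hvx
    have h3 := polar_mul_self_le hU hx.1 v
    have h4 : 0 < polar ℝ h x x v ^ 2 := by positivity
    have h5 : 0 ≤ 6 * (polar ℝ h x x v ^ 2 / realFun h x - polar ℝ h x v v) / (realFun h x + c) :=
      div_nonneg (by linarith) h1.le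
    positivity
  · have h3 := polar_mul_self_lt hU hx.1 hvx
    have h5 : 0 < 6 * (polar ℝ h x x v ^ 2 / realFun h x - polar ℝ h x v v) / (realFun h x + c) :=
      div_pos (by linarith) h1
    positivity

lemma logMetric_nonneg (hU : IsProjectiveSpecialReal h U) {x : Fin n → ℝ} (hx : x ∈ Uc h U c)
    (v : Fin n → ℝ) : 0 ≤ logMetric h c x v v := by
  by_cases hv : v = 0
  · simp [hv, logMetric]
  · exact (logMetric_pos hU hx hv).le

/-- Such an a is tangent to the level set, where P(x, a, a) < 0 unless a = 0. -/
lemma eq_zero_of_polar_eq_zero (hU : IsProjectiveSpecialReal h U) {x : Fin n → ℝ} (hx : x ∈ U)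
    {a : Fin n → ℝ} (ha : ∀ w, polar ℝ h x a w = 0) : a = 0 := by
  by_contra ha0
  have h1 : polar ℝ h x x a = 0 := by rw [polar_swap_right, ha]
  have := polar_neg_of_tangent hU hx h1 ha0
  rw [ha] at this
  exact lt_irrefl _ this

lemma hess_log (hh : h.IsHomogeneous 3) {x : Fin n → ℝ} (hx : realFun h x + c ≠ 0)
    (u v : Fin n → ℝ) :
    hess (fun x => Real.log (realFun h x + c)) x u v = -logMetric h c x u v := by
  have hcont : Continuous (realFun h) := (contDiff_realFun hh (m := 0)).continuous
  have hev : (fun y => fderiv ℝ (fun x => Real.log (realFun h x + c)) y v) =ᶠ[𝓝 x]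
      fun y => 3 * polar ℝ h y y v / (realFun h y + c) := by
    have hopen : IsOpen {y | realFun h y + c ≠ 0} :=
      isOpen_ne_fun (hcont.add continuous_const) continuous_const
    filter_upwards [hopen.mem_nhds hx] with y hy
    have h1 := ((hasFDerivAt_realFun hh y).add_const c).log hy
    rw [h1.fderiv]
    simp
    ring
  have h2 := ((hasFDerivAt_polar_diag h v x).const_mul 3).mul
    ((hasDerivAt_inv hx).comp_hasFDerivAt x ((hasFDerivAt_realFun hh x).add_const c))
  rw [hess, hev.fderiv_eq, logMetric]
  refine (congrArg (fun L => L u) h2.fderiv).trans ?_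
  simp [polar_swap_right h x v u]
  field_simp
  ring

lemma deformedMetric_eq (hh : h.IsHomogeneous 3) {z : Cn n} (hz : realFun h (imPart z) + c ≠ 0)
    (u v : Cn n) : deformedMetric h c z u v =
      (logMetric h c (imPart z) (rePt u) (rePt v) + logMetric h c (imPart z) (imPart u) (imPart v))
        / 4 := by
  rw [deformedMetric, hess_log hh hz, hess_log hh hz]
  ring

lemma deformedMetric_pos (hU : IsProjectiveSpecialReal h U) {z : Cn n} (hz : z ∈ tube (Uc h U c))
    {u : Cn n} (hu : u ≠ 0) : 0 < deformedMetric h c z u u := by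
  have hz' : imPart z ∈ Uc h U c := hz
  rw [deformedMetric_eq hU.homogeneous (add_pos_of_mem_Uc hz').ne']
  have h1 := logMetric_nonneg hU hz' (rePt u)
  have h2 := logMetric_nonneg hU hz' (imPart u)
  by_cases h3 : rePt u = 0
  · have h4 : imPart u ≠ 0 := by
      intro h4
      apply hu
      rw [eq_rePt_add_imPart u, h3, h4]
      funext i
      simp [ofRealVec]
    have := logMetric_pos hU hz' h4
    linarith
  · have := logMetric_pos hU hz' h3
    linarith

end Domain

/-! ### The immersion `dF` and its conification -/

section Components

variable {k m : ℕ} {f : Cn m → Phase k} {z : Cn m}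

lemma fderiv_fst_eq (hf : DifferentiableAt ℂ f z) (i : Fin k) {L : Cn m →L[ℂ] ℂ}
    (hL : HasFDerivAt (fun z => (f z).1 i) L z) (u : Cn m) : (fderiv ℂ f z u).1 i = L u := by
  have h1 := ((ContinuousLinearMap.proj i : Cn k →L[ℂ] ℂ).comp
    (ContinuousLinearMap.fst ℂ (Cn k) (Cn k))).hasFDerivAt.comp z hf.hasFDerivAt
  exact congrArg (fun L => L u) (h1.unique hL)

lemma fderiv_snd_eq (hf : DifferentiableAt ℂ f z) (i : Fin k) {L : Cn m →L[ℂ] ℂ}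
    (hL : HasFDerivAt (fun z => (f z).2 i) L z) (u : Cn m) : (fderiv ℂ f z u).2 i = L u := by
  have h1 := ((ContinuousLinearMap.proj i : Cn k →L[ℂ] ℂ).comp
    (ContinuousLinearMap.snd ℂ (Cn k) (Cn k))).hasFDerivAt.comp z hf.hasFDerivAt
  exact congrArg (fun L => L u) (h1.unique hL)

end Components

section Graph

variable {n : ℕ} {h : MvPolynomial (Fin n) ℝ} {c : ℝ}

lemma prepot_eq (hh : h.IsHomogeneous 3) (c : ℝ) :
    prepot h c = fun z => -polar ℂ h z z z - 2 * Complex.I * (c : ℂ) := by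
  funext z
  rw [prepot, polar_self hh]

lemma hasFDerivAt_prepot (hh : h.IsHomogeneous 3) (c : ℝ) (z : Cn n) :
    HasFDerivAt (prepot h c) (-((3 : ℂ) • polar ℂ h z z)) z := by
  rw [prepot_eq hh]
  exact (hasFDerivAt_polar_self h z).neg.sub_const _

lemma fderiv_prepot (hh : h.IsHomogeneous 3) (c : ℝ) (z u : Cn n) :
    fderiv ℂ (prepot h c) z u = -(3 * polar ℂ h z z u) := by
  rw [(hasFDerivAt_prepot hh c z).fderiv]
  simp

lemma graphOfDifferential_eq (hh : h.IsHomogeneous 3) (c : ℝ) (z : Cn n) :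
    graphOfDifferential (prepot h c) z
      = (z, fun i => -(3 * polar ℂ h z z (Pi.single i 1))) := by
  simp only [graphOfDifferential, fderiv_prepot hh]

lemma sum_mul_polar_single (a z w : Cn n) :
    ∑ i, a i * polar ℂ h z w (Pi.single i 1) = polar ℂ h z w a := by
  conv_rhs => rw [pi_eq_sum_univ' a, map_sum]
  refine Finset.sum_congr rfl fun i _ => ?_
  rw [map_smul, smul_eq_mul]

lemma contDiff_graphOfDifferential (hh : h.IsHomogeneous 3) (c : ℝ) :
    ContDiff ℂ ∞ (graphOfDifferential (prepot h c)) := by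
  rw [funext (graphOfDifferential_eq hh c)]
  refine contDiff_id.prodMk (contDiff_pi.2 fun i => ?_)
  exact (contDiff_const.mul (contDiff_polar contDiff_id contDiff_id contDiff_const)).neg

lemma fderiv_graphOfDifferential (hh : h.IsHomogeneous 3) (c : ℝ) (z u : Cn n) :
    fderiv ℂ (graphOfDifferential (prepot h c)) z u
      = (u, fun i => -(6 * polar ℂ h z u (Pi.single i 1))) := by
  have hd := (contDiff_graphOfDifferential hh c).differentiable (by simp) z
  have h1 := graphOfDifferential_eq hh c
  refine Prod.ext (funext fun i => ?_) (funext fun i => ?_)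
  · refine fderiv_fst_eq hd i (L := ContinuousLinearMap.proj i) ?_ u
    simp_rw [h1]
    exact (ContinuousLinearMap.proj i : Cn n →L[ℂ] ℂ).hasFDerivAt
  · have h2 := ((hasFDerivAt_polar_diag h (Pi.single i 1) z).const_mul 3).neg
    rw [fderiv_snd_eq hd i (by simp_rw [h1]; exact h2) u]
    simp [polar_swap_right h z (Pi.single i 1) u]
    ring

/-- The vector `(1, z, h(z) - 4 i c, -∂h(z))`. -/
def conePoint (h : MvPolynomial (Fin n) ℝ) (c : ℝ) (z : Cn n) : Phase (n + 1) :=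
  (Fin.cons 1 z, Fin.cons (polar ℂ h z z z - 4 * Complex.I * (c : ℂ))
    (fun i => -(3 * polar ℂ h z z (Pi.single i 1))))

/-- The derivative of `conePoint`. -/
def coneTangent (h : MvPolynomial (Fin n) ℝ) (z u : Cn n) : Phase (n + 1) :=
  (Fin.cons 0 u, Fin.cons (3 * polar ℂ h z z u)
    (fun i => -(6 * polar ℂ h z u (Pi.single i 1))))

/-- By Euler's relation z^t w = -3h, so 2F - z^t w = -2h - 4ic + 3h = h - 4ic. The constant is
invisible to dF and enters only through this component. -/
lemma con_eq (hh : h.IsHomogeneous 3) (c : ℝ) (Z : Cn (n + 1)) :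
    con (graphOfDifferential (prepot h 0)) (prepot h c) Z = Z 0 • conePoint h c (base Z) := by
  have h1 : 2 * prepot h c (base Z) - ∑ i, base Z i *
      -(3 * polar ℂ h (base Z) (base Z) (Pi.single i 1))
      = polar ℂ h (base Z) (base Z) (base Z) - 4 * Complex.I * (c : ℂ) := by
    have h2 : ∑ i, base Z i * -(3 * polar ℂ h (base Z) (base Z) (Pi.single i 1))
        = -(3 * polar ℂ h (base Z) (base Z) (base Z)) := by
      conv_rhs => rw [← sum_mul_polar_single (h := h) (base Z)]
      rw [Finset.mul_sum, ← Finset.sum_neg_distrib]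
      exact Finset.sum_congr rfl fun i _ => by ring
    rw [h2, prepot_eq hh]
    ring
  rw [con, graphOfDifferential_eq hh]
  simp only [h1]
  rfl

/-- The projection `base` as a continuous linear map. -/
def baseL (n : ℕ) : Cn (n + 1) →L[ℂ] Cn n :=
  ContinuousLinearMap.pi fun i => ContinuousLinearMap.proj i.succ

@[simp] lemma baseL_apply (Z : Cn (n + 1)) : baseL n Z = base Z := rfl

lemma contDiff_base : ContDiff ℂ ∞ (base : Cn (n + 1) → Cn n) := (baseL n).contDiff

lemma contDiff_finCons {E : Type*} [NormedAddCommGroup E] [NormedSpace ℂ E] {f : E → ℂ}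
    {g : E → Cn n} (hf : ContDiff ℂ ∞ f) (hg : ContDiff ℂ ∞ g) :
    ContDiff ℂ ∞ fun x => (Fin.cons (f x) (g x) : Cn (n + 1)) := by
  refine contDiff_pi.2 fun i => ?_
  refine Fin.cases ?_ (fun j => ?_) i
  · simpa using hf
  · simpa using contDiff_pi.1 hg j

lemma contDiff_conePoint (h : MvPolynomial (Fin n) ℝ) (c : ℝ) : ContDiff ℂ ∞ (conePoint h c) := by
  refine (contDiff_finCons contDiff_const contDiff_id).prodMk (contDiff_finCons ?_ ?_)
  · exact (contDiff_polar contDiff_id contDiff_id contDiff_id).sub contDiff_const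
  · exact contDiff_pi.2 fun i =>
      (contDiff_const.mul (contDiff_polar contDiff_id contDiff_id contDiff_const)).neg

lemma fderiv_conePoint (h : MvPolynomial (Fin n) ℝ) (c : ℝ) (z u : Cn n) :
    fderiv ℂ (conePoint h c) z u = coneTangent h z u := by
  have hd := (contDiff_conePoint h c).differentiable (by simp) z
  refine Prod.ext (funext fun i => ?_) (funext fun i => ?_)
  · refine Fin.cases ?_ (fun j => ?_) i
    · rw [fderiv_fst_eq hd 0 (by simpa [conePoint] using hasFDerivAt_const (1 : ℂ) z) u]
      simp [coneTangent]
    · rw [fderiv_fst_eq hd j.succ (L := ContinuousLinearMap.proj j) ?_ u]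
      · simp [coneTangent]
      · simp only [conePoint, Fin.cons_succ]
        exact (ContinuousLinearMap.proj j : Cn n →L[ℂ] ℂ).hasFDerivAt
  · refine Fin.cases ?_ (fun j => ?_) i
    · have h2 := (hasFDerivAt_polar_self h z).sub_const (4 * Complex.I * (c : ℂ))
      rw [fderiv_snd_eq hd 0 (by simpa only [conePoint, Fin.cons_zero] using h2) u]
      simp [coneTangent]
    · have h2 := ((hasFDerivAt_polar_diag h (Pi.single j 1) z).const_mul 3).neg
      rw [fderiv_snd_eq hd j.succ (by simp only [conePoint, Fin.cons_succ]; exact h2) u]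
      simp [coneTangent, polar_swap_right h z (Pi.single j 1) u]
      ring

lemma contDiff_con (hh : h.IsHomogeneous 3) (c : ℝ) :
    ContDiff ℂ ∞ (con (graphOfDifferential (prepot h 0)) (prepot h c)) := by
  rw [funext (con_eq hh c)]
  exact (contDiff_apply ℂ ℂ 0).smul ((contDiff_conePoint h c).comp contDiff_base)

lemma fderiv_con (hh : h.IsHomogeneous 3) (c : ℝ) (Z u : Cn (n + 1)) :
    fderiv ℂ (con (graphOfDifferential (prepot h 0)) (prepot h c)) Z u
      = u 0 • conePoint h c (base Z) + Z 0 • coneTangent h (base Z) (base u) := by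
  have h1 : HasFDerivAt (fun Z : Cn (n + 1) => conePoint h c (base Z))
      ((fderiv ℂ (conePoint h c) (base Z)).comp (baseL n)) Z :=
    ((contDiff_conePoint h c).differentiable (by simp) (base Z)).hasFDerivAt.comp Z
      (baseL n).hasFDerivAt
  have h2 := ((ContinuousLinearMap.proj 0 : Cn (n + 1) →L[ℂ] ℂ).hasFDerivAt (x := Z)).smul h1
  rw [funext (con_eq hh c)]
  refine (congrArg (fun L => L u) h2.fderiv).trans ?_
  simp [fderiv_conePoint, add_comm]

lemma coneTangent_zero (z : Cn n) : coneTangent h z 0 = 0 := by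
  simp only [← fderiv_conePoint h 0, map_zero]

/-! ### The forms `Ω` and `γ` on the cone -/

lemma sub_star_eq (z : Cn n) : z - star z = (2 * Complex.I) • ofRealVec (imPart z) := by
  funext i
  simp only [Pi.sub_apply, Pi.star_apply, ofRealVec, imPart, Pi.smul_apply, smul_eq_mul]
  apply Complex.ext <;> simp
  ring

/-- Differences of arguments z and z̄ depend only on x; through this the real part y drops out of
all values of γ below. -/
lemma polar_sub_star (z a b : Cn n) : polar ℂ h z a b - polar ℂ h (star z) a b
    = 2 * Complex.I * polar ℂ h (ofRealVec (imPart z)) a b := by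
  rw [← sub_apply, ← sub_apply, ← map_sub, sub_star_eq]
  simp

lemma gam_cons (a b a' b' : ℂ) (v w v' w' : Cn n) :
    gam ((Fin.cons a v, Fin.cons b w) : Phase (n + 1)) (Fin.cons a' v', Fin.cons b' w')
      = Complex.I * (a * (starRingEnd ℂ) b' - b * (starRingEnd ℂ) a') + gam (v, w) (v', w') := by
  rw [gam_eq, gam_eq, Fin.sum_univ_succ]
  simp
  ring

lemma Omega_cons (a b a' b' : ℂ) (v w v' w' : Cn n) :
    Omega ((Fin.cons a v, Fin.cons b w) : Phase (n + 1)) (Fin.cons a' v', Fin.cons b' w')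
      = (a * b' - b * a') + Omega (v, w) (v', w') := by
  rw [Omega, Omega, Fin.sum_univ_succ]
  simp

lemma Omega_graph (r s : ℂ) (z z' w w' u v : Cn n) :
    Omega (u, fun i => -(r * polar ℂ h z w (Pi.single i 1)))
      (v, fun i => -(s * polar ℂ h z' w' (Pi.single i 1)))
      = r * polar ℂ h z w v - s * polar ℂ h z' w' u := by
  rw [Omega, ← sum_mul_polar_single (h := h) v, ← sum_mul_polar_single (h := h) u,
    Finset.mul_sum, Finset.mul_sum, ← Finset.sum_sub_distrib]
  exact Finset.sum_congr rfl fun i _ => by ring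

lemma gam_graph (r s : ℝ) (z z' w w' u v : Cn n) :
    gam (u, fun i => -((r : ℂ) * polar ℂ h z w (Pi.single i 1)))
      (v, fun i => -((s : ℂ) * polar ℂ h z' w' (Pi.single i 1)))
      = Complex.I * (r * polar ℂ h z w (star v) - s * polar ℂ h (star z') (star w') u) := by
  have h1 : tau (v, fun i => -((s : ℂ) * polar ℂ h z' w' (Pi.single i 1)))
      = (star v, fun i => -((s : ℂ) * polar ℂ h (star z') (star w') (Pi.single i 1))) := by
    refine Prod.ext rfl (funext fun i => ?_)
    simp only [tau, map_neg, map_mul, Complex.conj_ofReal, polar_conj]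
    congr 3
    funext j
    by_cases hj : j = i
    · subst hj; simp
    · simp [hj]
  rw [gam, h1, Omega_graph]

lemma gam_graph_fderiv (hh : h.IsHomogeneous 3) (z u v : Cn n) :
    gam (fderiv ℂ (graphOfDifferential (prepot h 0)) z u)
      (fderiv ℂ (graphOfDifferential (prepot h 0)) z v)
      = -(12 * polar ℂ h (ofRealVec (imPart z)) u (star v)) := by
  rw [fderiv_graphOfDifferential hh, fderiv_graphOfDifferential hh]
  have := gam_graph (h := h) 6 6 z z u v u v
  push_cast at this
  rw [this, polar_swap_right h (star z) (star v) u]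
  have h1 := polar_sub_star (h := h) z u (star v)
  linear_combination (6 * Complex.I) * h1
    + (12 * polar ℂ h (ofRealVec (imPart z)) u (star v)) * Complex.I_mul_I

lemma gam_coneTangent (z u v : Cn n) : gam (coneTangent h z u) (coneTangent h z v)
      = -(12 * polar ℂ h (ofRealVec (imPart z)) u (star v)) := by
  rw [coneTangent, coneTangent, gam_cons]
  have := gam_graph (h := h) 6 6 z z u v u v
  push_cast at this
  rw [this, polar_swap_right h (star z) (star v) u]
  have h1 := polar_sub_star (h := h) z u (star v)
  simp only [map_zero, zero_mul, mul_zero, sub_zero, zero_add]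
  linear_combination (6 * Complex.I) * h1
    + (12 * polar ℂ h (ofRealVec (imPart z)) u (star v)) * Complex.I_mul_I

/-- This is P(z - z̄, z - z̄, u) with z - z̄ = 2ix. -/
lemma polar_sub_star_sub_star (z u : Cn n) :
    polar ℂ h z z u + polar ℂ h (star z) (star z) u - 2 * polar ℂ h z (star z) u
      = -(4 * polar ℂ h (ofRealVec (imPart z)) (ofRealVec (imPart z)) u) := by
  have h1 := polar_sub_star (h := h) z z u
  have h2 := polar_sub_star (h := h) z (star z) u
  have h3 := polar_sub_star (h := h) z (ofRealVec (imPart z)) u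
  rw [polar_swap_left h (star z) z u] at h1
  rw [polar_swap_left h z, polar_swap_left h (star z) (ofRealVec (imPart z))] at h3
  linear_combination h1 - h2 + 2 * Complex.I * h3
    + 4 * polar ℂ h (ofRealVec (imPart z)) (ofRealVec (imPart z)) u * Complex.I_mul_I

lemma gam_coneTangent_conePoint (z u : Cn n) :
    gam (coneTangent h z u) (conePoint h c z)
      = 12 * Complex.I * polar ℂ h (ofRealVec (imPart z)) (ofRealVec (imPart z)) u := by
  rw [coneTangent, conePoint, gam_cons]
  have := gam_graph (h := h) 6 3 z z u z u z
  push_cast at this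
  rw [this, polar_swap_right h z u (star z)]
  have h1 := polar_sub_star_sub_star (h := h) z u
  simp only [map_one, zero_mul, mul_one]
  linear_combination (-3 * Complex.I) * h1

/-- The part without c is -i P(z - z̄, z - z̄, z - z̄) = -i(2i)³h(x) = -8h(x), and the entry -4ic
contributes i(4ic + 4ic) = -8c. -/
lemma gam_conePoint (hh : h.IsHomogeneous 3) (z : Cn n) :
    gam (conePoint h c z) (conePoint h c z) = ((-(8 * (realFun h (imPart z) + c)) : ℝ) : ℂ) := by
  rw [conePoint, gam_cons]
  have := gam_graph (h := h) 3 3 z z z z z z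
  push_cast at this
  rw [this]
  have h1 := polar_sub_star_sub_star (h := h) z z
  have h2 := polar_sub_star_sub_star (h := h) z (star z)
  have h3 := polar_sub_star (h := h) z (ofRealVec (imPart z)) (ofRealVec (imPart z))
  rw [polar_rotate h z (ofRealVec (imPart z)), polar_rotate h (star z) (ofRealVec (imPart z))] at h3
  have h4 : polar ℂ h (ofRealVec (imPart z)) (ofRealVec (imPart z)) (ofRealVec (imPart z))
      = (realFun h (imPart z) : ℂ) := by
    rw [polar_self_real hh]
    exact polar_ofReal h _ _ _
  rw [h4] at h3
  simp only [map_one, one_mul, mul_one, map_sub, map_mul, Complex.conj_ofReal, Complex.conj_I,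
    map_ofNat, polar_conj]
  rw [polar_swap_right h z (star z) z] at h1
  rw [polar_rotate h z (star z) (star z)] at h2
  push_cast
  linear_combination -Complex.I * h1 + Complex.I * h2 + 4 * Complex.I * h3
    + 8 * ((realFun h (imPart z) : ℂ) + c) * Complex.I_mul_I

lemma Omega_fderiv_graph (hh : h.IsHomogeneous 3) (z u v : Cn n) :
    Omega (fderiv ℂ (graphOfDifferential (prepot h 0)) z u)
      (fderiv ℂ (graphOfDifferential (prepot h 0)) z v) = 0 := by
  rw [fderiv_graphOfDifferential hh, fderiv_graphOfDifferential hh, Omega_graph,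
    polar_swap_right h z u v, sub_self]

lemma Omega_comm_neg {k : ℕ} (a b : Phase k) : Omega a b = -Omega b a := by
  simp only [Omega, ← Finset.sum_neg_distrib]
  exact Finset.sum_congr rfl fun i _ => by ring

lemma Omega_add_left {k : ℕ} (a b d : Phase k) : Omega (a + b) d = Omega a d + Omega b d := by
  simp only [Omega, ← Finset.sum_add_distrib]
  exact Finset.sum_congr rfl fun i _ => by simp; ring

lemma Omega_smul_left {k : ℕ} (r : ℂ) (a b : Phase k) : Omega (r • a) b = r * Omega a b := by
  simp only [Omega, Finset.mul_sum]
  exact Finset.sum_congr rfl fun i _ => by simp; ring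

lemma Omega_add_right {k : ℕ} (a b d : Phase k) : Omega a (b + d) = Omega a b + Omega a d := by
  rw [Omega_comm_neg, Omega_add_left, Omega_comm_neg b, Omega_comm_neg d]
  ring

lemma Omega_smul_right {k : ℕ} (r : ℂ) (a b : Phase k) : Omega a (r • b) = r * Omega a b := by
  rw [Omega_comm_neg, Omega_smul_left, Omega_comm_neg b]
  ring

lemma Omega_fderiv_con (hh : h.IsHomogeneous 3) (c : ℝ) (Z u v : Cn (n + 1)) :
    Omega (fderiv ℂ (con (graphOfDifferential (prepot h 0)) (prepot h c)) Z u)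
      (fderiv ℂ (con (graphOfDifferential (prepot h 0)) (prepot h c)) Z v) = 0 := by
  have h1 : ∀ a : Phase (n + 1), Omega a a = 0 := fun a => by
    have := Omega_comm_neg a a
    linear_combination this / 2
  have h2 : ∀ z u, Omega (conePoint h c z) (coneTangent h z u) = 0 := fun z u => by
    rw [conePoint, coneTangent, Omega_cons, Omega_graph, polar_swap_right h z u z]
    ring
  have h3 : ∀ z u v, Omega (coneTangent h z u) (coneTangent h z v) = 0 := fun z u v => by
    rw [coneTangent, coneTangent, Omega_cons, Omega_graph, polar_swap_right h z u v]
    ring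
  rw [fderiv_con hh, fderiv_con hh]
  simp only [Omega_add_left, Omega_add_right, Omega_smul_left, Omega_smul_right, h1, h2, h3]
  rw [Omega_comm_neg, h2]
  ring

end Graph

/-! ### Non-degeneracy and the metrics -/

section Metrics

variable {n : ℕ} {h : MvPolynomial (Fin n) ℝ} {U : Set (Fin n → ℝ)} {c : ℝ}

lemma polar_ofRealVec_conj_re (x : Fin n → ℝ) (u v : Cn n) :
    (polar ℂ h (ofRealVec x) u (star v)).re
      = polar ℝ h x (rePt u) (rePt v) + polar ℝ h x (imPart u) (imPart v) := by
  have hv : star v = ofRealVec (rePt v) - Complex.I • ofRealVec (imPart v) := by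
    funext i
    apply Complex.ext <;> simp [ofRealVec, rePt, imPart]
  have hp : ∀ a b : Fin n → ℝ, polar ℂ h (ofRealVec x) (ofRealVec a) (ofRealVec b)
      = (polar ℝ h x a b : ℂ) := polar_ofReal h x
  conv_lhs => rw [eq_rePt_add_imPart u, hv]
  simp only [map_add, map_sub, map_smul, add_apply, smul_apply, hp, smul_eq_mul]
  simp

lemma polar_ofRealVec_ofRealVec (x : Fin n → ℝ) (u : Cn n) :
    polar ℂ h (ofRealVec x) (ofRealVec x) u
      = (polar ℝ h x x (rePt u) : ℂ) + Complex.I * (polar ℝ h x x (imPart u) : ℂ) := by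
  have hp : ∀ a : Fin n → ℝ, polar ℂ h (ofRealVec x) (ofRealVec x) (ofRealVec a)
      = (polar ℝ h x x a : ℂ) := polar_ofReal h x x
  conv_lhs => rw [eq_rePt_add_imPart u]
  simp only [map_add, map_smul, hp, smul_eq_mul]

/-- The metric on the quotient in terms of the cone. -/
lemma deformedMetric_eq_re (hh : h.IsHomogeneous 3) {z : Cn n}
    (hz : realFun h (imPart z) + c ≠ 0) (u v : Cn n) :
    deformedMetric h c z u v =
      (gam (coneTangent h z u) (coneTangent h z v)).re / (8 * (realFun h (imPart z) + c))
        + (gam (coneTangent h z u) (conePoint h c z)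
            * (starRingEnd ℂ) (gam (coneTangent h z v) (conePoint h c z))).re
          / (8 * (realFun h (imPart z) + c)) ^ 2 := by
  have h1 : (-(12 * polar ℂ h (ofRealVec (imPart z)) u (star v))).re
      = -(12 * (polar ℂ h (ofRealVec (imPart z)) u (star v)).re) := by
    simp
  rw [deformedMetric_eq hh hz, gam_coneTangent, gam_coneTangent_conePoint,
    gam_coneTangent_conePoint, h1, polar_ofRealVec_conj_re, polar_ofRealVec_ofRealVec,
    polar_ofRealVec_ofRealVec, logMetric, logMetric]
  simp
  field_simp
  ring

/-- Up to a factor, the real part of γ is P(x,·,·) on real parts plus P(x,·,·) on imaginary parts.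
Real and purely imaginary test vectors reduce the claim to non-degeneracy of P(x,·,·). -/
lemma isKaehlerian_graph (hU : IsProjectiveSpecialReal h U) {V : Set (Fin n → ℝ)} (hV : V ⊆ U) :
    IsKaehlerian (tube V) (graphOfDifferential (prepot h 0)) := by
  intro z hz u hu
  have h1 : ∀ v, (polar ℂ h (ofRealVec (imPart z)) u (star v)).re = 0 := by
    intro v
    have := hu v
    rw [gam_graph_fderiv hU.homogeneous, neg_eq_zero] at this
    rcases mul_eq_zero.1 this with h | h
    · norm_num at h
    · rw [h, Complex.zero_re]
  simp only [polar_ofRealVec_conj_re] at h1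
  have hx : imPart z ∈ U := hV hz
  have h2 : rePt u = 0 := eq_zero_of_polar_eq_zero hU hx fun w => by
    have := h1 (ofRealVec w)
    have e1 : rePt (ofRealVec w) = w := by funext i; simp [rePt, ofRealVec]
    have e2 : imPart (ofRealVec w) = 0 := by funext i; simp [imPart, ofRealVec]
    simpa [e1, e2] using this
  have h3 : imPart u = 0 := eq_zero_of_polar_eq_zero hU hx fun w => by
    have := h1 (Complex.I • ofRealVec w)
    have e1 : rePt (Complex.I • ofRealVec w) = 0 := by funext i; simp [rePt, ofRealVec]
    have e2 : imPart (Complex.I • ofRealVec w) = w := by funext i; simp [imPart, ofRealVec]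
    simpa [e1, e2] using this
  rw [eq_rePt_add_imPart u, h2, h3]
  funext i
  simp [ofRealVec]

/-- γ is negative along Φ, and on the γ-orthogonal complement of Φ its quadratic form is 8|z⁰|²(h +
c) times the positive definite deformed metric. -/
lemma isNondegeneratePair_prepot (hU : IsProjectiveSpecialReal h U) (c : ℝ) :
    IsNondegeneratePair (tube (Uc h U c)) (graphOfDifferential (prepot h 0)) (prepot h c) := by
  have hh := hU.homogeneous
  refine ⟨?_, ?_⟩
  · rintro Z ⟨hZ0, hZ⟩ u hu
    have hpos : 0 < realFun h (imPart (base Z)) + c := add_pos_of_mem_Uc hZ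
    have hposC : ((realFun h (imPart (base Z)) : ℂ) + c) ≠ 0 := by
      exact_mod_cast hpos.ne'
    simp only [fderiv_con hh] at hu
    set P := conePoint h c (base Z) with hP
    set q := gam (coneTangent h (base Z) (base u)) P with hq
    set r := 8 * (realFun h (imPart (base Z)) + c) with hr
    have hr0 : 0 < r := by positivity
    have hPP : gam P P = -(r : ℂ) := by rw [hP, gam_conePoint hh]; push_cast [hr]; rfl
    have hrC : (r : ℂ) ≠ 0 := by exact_mod_cast hr0.ne'
    have hqc : gam P (coneTangent h (base Z) (base u)) = (starRingEnd ℂ) q := (conj_gam _ _).symm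
    have hb0 : base u = 0 := by
      by_contra hne
      have hm := deformedMetric_pos hU hZ hne
      rw [deformedMetric_eq_re hh hpos.ne', ← hP, ← hq, ← hr] at hm
      -- The fibre component Z⁰q/r makes the image of the test vector γ-orthogonal to P, since γ(P,
      -- P) = -r. The unknown component u⁰ then drops out of the pairing.
      have h1 := hu (Fin.cons (Z 0 * (q / r)) (base u))
      have h2 : base (Fin.cons (Z 0 * (q / r)) (base u) : Cn (n + 1)) = base u := by
        funext i; simp [base]
      simp only [Fin.cons_zero, h2, gam_add_left, gam_add_right, gam_smul_left, gam_smul_right,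
        hPP, hqc, ← hq, map_mul, map_div₀, Complex.conj_ofReal] at h1
      have h3 : Z 0 * (starRingEnd ℂ) (Z 0) *
          (gam (coneTangent h (base Z) (base u)) (coneTangent h (base Z) (base u))
            + q * (starRingEnd ℂ) q / r) = 0 := by
        rw [← h1]
        field_simp
        ring
      have h4 : gam (coneTangent h (base Z) (base u)) (coneTangent h (base Z) (base u))
            + q * (starRingEnd ℂ) q / r = 0 := by
        rcases mul_eq_zero.1 h3 with h | h
        · exact absurd h (mul_ne_zero hZ0 ((map_ne_zero _).2 hZ0))
        · exact h
      have h5 := congrArg Complex.re h4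
      rw [Complex.add_re, Complex.div_ofReal_re, Complex.zero_re] at h5
      have h6 : (gam (coneTangent h (base Z) (base u)) (coneTangent h (base Z) (base u))).re / r
          + (q * (starRingEnd ℂ) q).re / r ^ 2 = 0 := by
        have : (gam (coneTangent h (base Z) (base u)) (coneTangent h (base Z) (base u))).re / r
          + (q * (starRingEnd ℂ) q).re / r ^ 2
          = ((gam (coneTangent h (base Z) (base u)) (coneTangent h (base Z) (base u))).re
            + (q * (starRingEnd ℂ) q).re / r) / r := by
          field_simp
        rw [this, h5, zero_div]
      linarith
    -- With the base component gone, pairing with the fibre direction leaves -u⁰r.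
    have h1 := hu (Fin.cons 1 0)
    have h2 : base (Fin.cons 1 0 : Cn (n + 1)) = 0 := by
      funext i; simp [base]
    rw [hb0, h2, coneTangent_zero, smul_zero, add_zero, add_zero, gam_smul_left, Fin.cons_zero,
      one_smul, hPP] at h1
    have h3 : u 0 = 0 := by simpa [hrC] using h1
    funext i
    refine Fin.cases h3 (fun j => ?_) i
    exact congrFun hb0 j
  · rintro Z ⟨hZ0, hZ⟩
    have hpos : 0 < realFun h (imPart (base Z)) + c := add_pos_of_mem_Uc hZ
    rw [con_eq hh, gam_smul_left, gam_smul_right, gam_conePoint hh]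
    refine mul_ne_zero hZ0 (mul_ne_zero ((map_ne_zero _).2 hZ0) ?_)
    rw [Complex.ofReal_ne_zero]
    linarith

lemma coneField_zero (Z : Cn (n + 1)) : coneField Z 0 = Z 0 := rfl

lemma base_coneField (Z : Cn (n + 1)) : base (coneField Z) = 0 := by
  funext i
  simp [base, coneField]

lemma fderiv_con_coneField (hh : h.IsHomogeneous 3) (c : ℝ) (Z : Cn (n + 1)) :
    fderiv ℂ (con (graphOfDifferential (prepot h 0)) (prepot h c)) Z (coneField Z)
      = con (graphOfDifferential (prepot h 0)) (prepot h c) Z := by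
  rw [fderiv_con hh, con_eq hh, coneField_zero, base_coneField, coneTangent_zero, smul_zero,
    add_zero]

lemma contDiff_coneField : ContDiff ℂ ∞ (coneField : Cn (n + 1) → Cn (n + 1)) :=
  contDiff_finCons (contDiff_apply ℂ ℂ 0) contDiff_const

lemma isOpen_cstarProd {V : Set (Cn n)} (hV : IsOpen V) : IsOpen (cstarProd V) :=
  (isOpen_ne_fun (continuous_apply 0) continuous_const).inter
    (hV.preimage (baseL n).continuous)

lemma isConicalASK_con (hU : IsProjectiveSpecialReal h U) (c : ℝ) :
    IsConicalASK (cstarProd (tube (Uc h U c)))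
      (inducedMetric (con (graphOfDifferential (prepot h 0)) (prepot h c)))
      (inducedConn (con (graphOfDifferential (prepot h 0)) (prepot h c))) coneField :=
  isConicalASK_induced (isOpen_cstarProd (isOpen_tube (isOpen_Uc hU c)))
    (contDiff_con hU.homogeneous c) (fun Z _ => Omega_fderiv_con hU.homogeneous c Z)
    (isNondegeneratePair_prepot hU c).1 contDiff_coneField
    (fderiv_con_coneField hU.homogeneous c) (isNondegeneratePair_prepot hU c).2

/-- For a homogeneous map, `K = γ(Φ, Φ) / 2`. -/
lemma conePotential_eq {Φ : Cn (n + 1) → Phase (n + 1)}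
    (hom : ∀ Z, fderiv ℂ Φ Z (coneField Z) = Φ Z) (Z : Cn (n + 1)) :
    conePotential (inducedMetric Φ) Z = (gam (Φ Z) (Φ Z)).re / 2 := by
  rw [conePotential, inducedMetric, hom]

/-- The differential of K is u ↦ Re γ(dΦ u, Φ). As γ is complex linear in its first slot, the
(1,0)-part restores the full complex value, with a factor 1/2. -/
lemma delForm_conePotential {Φ : Cn (n + 1) → Phase (n + 1)} (hΦ : ContDiff ℂ ∞ Φ)
    (hom : ∀ Z, fderiv ℂ Φ Z (coneField Z) = Φ Z) (Z u : Cn (n + 1)) :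
    delForm (conePotential (inducedMetric Φ)) Z u = gam (fderiv ℂ Φ Z u) (Φ Z) / 2 := by
  have hd : ∀ v, fderiv ℝ (conePotential (inducedMetric Φ)) Z v
      = (gam (fderiv ℂ Φ Z v) (Φ Z)).re := by
    intro v
    have h0 := (hΦ.differentiable (by simp) Z).hasFDerivAt.restrictScalars ℝ
    have h1 := ((gamL (n + 1)).hasFDerivAt.comp Z h0).clm_apply h0
    have h2 := (Complex.reCLM.hasFDerivAt.comp Z h1).mul_const (1 / 2 : ℝ)
    have h3 : conePotential (inducedMetric Φ) = fun Z =>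
        (Complex.reCLM ∘ fun Z => gamL (n + 1) (Φ Z) (Φ Z)) Z * (1 / 2 : ℝ) := by
      funext Z
      rw [conePotential_eq hom]
      simp
      ring
    rw [h3]
    refine (congrArg (fun L => L v) h2.fderiv).trans ?_
    simp
    rw [re_gam_comm (Φ Z)]
    ring
  rw [delForm, hd, hd, J, map_smul, gam_smul_left]
  apply Complex.ext <;> simp

/-- The correction term (∂K)(∂̄K)/K² removes the component along Φ, as in an orthogonal projection,
and the division by K removes |z⁰|². -/
lemma horizontalTensor_con (hU : IsProjectiveSpecialReal h U) {Z : Cn (n + 1)}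
    (hZ : Z ∈ cstarProd (tube (Uc h U c))) (u v : Cn (n + 1)) :
    horizontalTensor (inducedMetric (con (graphOfDifferential (prepot h 0)) (prepot h c))) Z u v
      = deformedMetric h c (base Z) (base u) (base v) := by
  have hh := hU.homogeneous
  have hpos : 0 < realFun h (imPart (base Z)) + c := add_pos_of_mem_Uc hZ.2
  have hom := fderiv_con_coneField hh c
  set Φ := con (graphOfDifferential (prepot h 0)) (prepot h c) with hΦ
  rw [horizontalTensor, delForm_conePotential (contDiff_con hh c) hom,
    delForm_conePotential (contDiff_con hh c) hom, conePotential_eq hom,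
    deformedMetric_eq_re hh hpos.ne', inducedMetric, hΦ, fderiv_con hh, fderiv_con hh, con_eq hh]
  set P := conePoint h c (base Z) with hP
  set Q := coneTangent h (base Z) (base u) with hQ
  set R := coneTangent h (base Z) (base v) with hR
  set r := 8 * (realFun h (imPart (base Z)) + c) with hr
  have hr0 : 0 < r := by positivity
  have hPP : gam P P = -(r : ℂ) := by rw [hP, gam_conePoint hh]; push_cast [hr]; rfl
  have hN : Z 0 * (starRingEnd ℂ) (Z 0) = (Complex.normSq (Z 0) : ℂ) := Complex.mul_conj _
  have hN0 : Complex.normSq (Z 0) ≠ 0 := by simpa using hZ.1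
  have hK : (gam (Z 0 • P) (Z 0 • P)).re = -(Complex.normSq (Z 0) * r) := by
    rw [gam_smul_left, gam_smul_right, ← mul_assoc, hN, hPP]
    simp
  have hPR : gam P R = (starRingEnd ℂ) (gam R P) := (conj_gam _ _).symm
  -- The identity after clearing denominators. All terms with u⁰ or v⁰ cancel because γ(P, P) = -r.
  have key : Complex.normSq (Z 0) * (gam (u 0 • P + Z 0 • Q) (v 0 • P + Z 0 • R)).re * r
      + (gam (u 0 • P + Z 0 • Q) (Z 0 • P) * (starRingEnd ℂ) (gam (v 0 • P + Z 0 • R) (Z 0 • P))).re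
      = Complex.normSq (Z 0) ^ 2
        * ((gam Q R).re * r + (gam Q P * (starRingEnd ℂ) (gam R P)).re) := by
    have e : (Complex.normSq (Z 0) : ℂ) * gam (u 0 • P + Z 0 • Q) (v 0 • P + Z 0 • R) * r
        + gam (u 0 • P + Z 0 • Q) (Z 0 • P) * (starRingEnd ℂ) (gam (v 0 • P + Z 0 • R) (Z 0 • P))
        = (Complex.normSq (Z 0) : ℂ) ^ 2 * (gam Q R * r + gam Q P * (starRingEnd ℂ) (gam R P)) := by
      rw [← hN]
      simp only [gam_add_left, gam_add_right, gam_smul_left, gam_smul_right, hPP, hPR, map_add,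
        map_mul, map_neg, Complex.conj_ofReal, Complex.conj_conj]
      ring
    have e2 := congrArg Complex.re e
    rw [← Complex.ofReal_pow, Complex.add_re, Complex.re_mul_ofReal, Complex.re_ofReal_mul,
      Complex.re_ofReal_mul, Complex.add_re, Complex.re_mul_ofReal] at e2
    exact e2
  have e3 : (gam (u 0 • P + Z 0 • Q) (Z 0 • P) / 2
      * (starRingEnd ℂ) (gam (v 0 • P + Z 0 • R) (Z 0 • P) / 2)).re
      = (gam (u 0 • P + Z 0 • Q) (Z 0 • P)
        * (starRingEnd ℂ) (gam (v 0 • P + Z 0 • R) (Z 0 • P))).re / 4 := by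
    have : ∀ a b : ℂ, a / 2 * (starRingEnd ℂ) (b / 2) = a * (starRingEnd ℂ) b / ((4 : ℝ) : ℂ) := by
      intro a b
      rw [map_div₀, map_ofNat]
      push_cast
      ring
    rw [this, Complex.div_ofReal_re]
  rw [e3, hK]
  field_simp
  linear_combination 4 * key

end Metrics

/-! ### Analytic continuation of a global pair -/

section Continuation

/-- The identity theorem for holomorphic maps on balls of `ℂ^k`. -/
lemma eqOn_ball_of_eventuallyEq {k : ℕ} {G : Type*} [NormedAddCommGroup G] [NormedSpace ℂ G]
    [CompleteSpace G] {f g : Cn k → G} {p a : Cn k} {r : ℝ}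
    (hf : DifferentiableOn ℂ f (Metric.ball p r)) (hg : DifferentiableOn ℂ g (Metric.ball p r))
    (ha : a ∈ Metric.ball p r) (hfg : f =ᶠ[𝓝 a] g) : EqOn f g (Metric.ball p r) := by
  intro b hb
  -- Restriction to the complex line through a and b reduces the claim to one variable; the part of
  -- the line inside the ball is convex, hence connected.
  let l : ℂ → Cn k := fun t => a + t • (b - a)
  have hl : Differentiable ℂ l :=
    (differentiable_const a).add (differentiable_id.smul_const (b - a))
  have hl0 : l 0 = a := by simp [l]
  have hl1 : l 1 = b := by simp [l]
  set S := l ⁻¹' Metric.ball p r with hS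
  have hopen : IsOpen S := Metric.isOpen_ball.preimage hl.continuous
  have hconv : Convex ℝ S := by
    intro s hs t ht α β hα hβ hαβ
    have : l (α • s + β • t) = α • l s + β • l t := by
      have e : a = (α : ℂ) • a + (β : ℂ) • a := by
        rw [← add_smul, ← Complex.ofReal_add, hαβ, Complex.ofReal_one, one_smul]
      simp only [l, smul_add, ← Complex.coe_smul]
      nth_rw 1 [e]
      module
    simp only [hS, mem_preimage, this]
    exact convex_ball p r hs ht hα hβ hαβ
  have hfl : AnalyticOnNhd ℂ (f ∘ l) S :=
    (hf.comp hl.differentiableOn fun t ht => ht).analyticOnNhd hopen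
  have hgl : AnalyticOnNhd ℂ (g ∘ l) S :=
    (hg.comp hl.differentiableOn fun t ht => ht).analyticOnNhd hopen
  have h0 : (0 : ℂ) ∈ S := by simpa [hS, hl0] using ha
  have h1 : (1 : ℂ) ∈ S := by simpa [hS, hl1] using hb
  have hev : f ∘ l =ᶠ[𝓝 0] g ∘ l := by
    have : Tendsto l (𝓝 0) (𝓝 a) := hl0 ▸ hl.continuous.continuousAt
    exact this.eventually hfg
  have := hfl.eqOn_of_preconnected_of_eventuallyEq hgl hconv.isPreconnected h0 hev h1
  simpa [hl1] using this

variable {n : ℕ} {M : Set (Cn n)} {g : Tensor2 (Cn n)} {Γ : Conn (Cn n)}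
  {φ : Cn n → Phase n} {F : Cn n → ℂ}

/-- The continuation of the germ of a global pair consists of the germs of this pair. -/
lemma IsContinuation.eventuallyEq (hφ : DifferentiableOn ℂ φ M) (hF : DifferentiableOn ℂ F M)
    {p q : Cn n} {c : Path p q} {φs : unitInterval → Cn n → Phase n}
    {Fs : unitInterval → Cn n → ℂ} (hc : IsContinuation M g Γ φ F c φs Fs) (t : unitInterval) :
    φs t =ᶠ[𝓝 (c t)] φ ∧ Fs t =ᶠ[𝓝 (c t)] F := by
  -- The set of times at which the continuation agrees with the global pair is open, closed and
  -- contains 0.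
  set A : Set unitInterval := {t | φs t =ᶠ[𝓝 (c t)] φ ∧ Fs t =ᶠ[𝓝 (c t)] F} with hA
  have hopen : IsOpen A := by
    rw [isOpen_iff_eventually]
    rintro t ⟨h1, h2⟩
    have h1' : ∀ᶠ s in 𝓝 t, φs t =ᶠ[𝓝 (c s)] φ :=
      c.continuous.continuousAt.eventually h1.eventuallyEq_nhds
    have h2' : ∀ᶠ s in 𝓝 t, Fs t =ᶠ[𝓝 (c s)] F :=
      c.continuous.continuousAt.eventually h2.eventuallyEq_nhds
    filter_upwards [hc.locally_const t, h1', h2'] with s hs hs1 hs2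
    exact ⟨hs.1.trans hs1, hs.2.trans hs2⟩
  have hclosed : IsClosed A := by
    refine isClosed_of_closure_subset fun t ht => ?_
    rw [mem_closure_iff_frequently] at ht
    -- At a limit time t the local pair is holomorphic on a ball around c(t). For some nearby time s
    -- in A, the point c(s) lies in that ball and the local pair agrees with the global one there,
    -- so the identity theorem applies.
    obtain ⟨V, htV, hVM, hV⟩ := hc.pair t
    obtain ⟨r, hr, hball⟩ := Metric.isOpen_iff.1 hV.isOpen _ htV
    have hev : ∀ᶠ s in 𝓝 t, c s ∈ Metric.ball (c t) r :=
      c.continuous.continuousAt.eventually (Metric.ball_mem_nhds _ hr)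
    obtain ⟨s, hsA, hs, hsb⟩ := (ht.and_eventually ((hc.locally_const t).and hev)).exists
    have e1 : φs t =ᶠ[𝓝 (c s)] φ := hs.1.symm.trans hsA.1
    have e2 : Fs t =ᶠ[𝓝 (c s)] F := hs.2.symm.trans hsA.2
    have hbM := hball.trans hVM
    have f1 := eqOn_ball_of_eventuallyEq (hV.immersion.holomorphic.mono hball) (hφ.mono hbM) hsb e1
    have f2 := eqOn_ball_of_eventuallyEq (hV.prepotential.holomorphic.mono hball) (hF.mono hbM)
      hsb e2
    exact ⟨f1.eventuallyEq_of_mem (Metric.ball_mem_nhds _ hr),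
      f2.eventuallyEq_of_mem (Metric.ball_mem_nhds _ hr)⟩
  have h0 : (0 : unitInterval) ∈ A := by
    have := hc.start
    simpa [hA] using this
  have : A = univ := IsClopen.eq_univ ⟨hclosed, hopen⟩ ⟨0, h0⟩
  exact (this ▸ mem_univ t : t ∈ A)

lemma isContinuation_const (hpair : IsSpecialKaehlerPair g Γ M φ F) {p q : Cn n} {c : Path p q}
    (hc : ∀ t, c t ∈ M) : IsContinuation M g Γ φ F c (fun _ => φ) (fun _ => F) where
  mem := hc
  start := ⟨EventuallyEq.rfl, EventuallyEq.rfl⟩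
  pair t := ⟨M, hc t, Subset.rfl, hpair⟩
  locally_const _ := Eventually.of_forall fun _ => ⟨EventuallyEq.rfl, EventuallyEq.rfl⟩

/-- An open connected set is path connected, and the constant family given by the global pair is a
non-degenerate continuation along every path in M. -/
lemma nondegDomain_eq (hM : IsConnected M) (hpair : IsSpecialKaehlerPair g Γ M φ F)
    (hnd : IsNondegeneratePair M φ F) {p : Cn n} (hp : p ∈ M) :
    nondegDomain M g Γ p φ F = M := by
  apply Subset.antisymm
  · rintro q ⟨c, φs, Fs, hc, _⟩
    simpa using hc.mem 1
  · intro q hq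
    have hpc : IsPathConnected M := (hpair.isOpen.isConnected_iff_isPathConnected).1 hM
    have hj := hpc.joinedIn p hp q hq
    refine ⟨hj.somePath, fun _ => φ, fun _ => F,
      isContinuation_const hpair hj.somePath_mem, fun t => ?_⟩
    exact ⟨M, hj.somePath_mem t, Subset.rfl, hpair, hnd⟩

lemma affAct_one (a : Phase n) : affAct 1 0 a = a := by
  have h1 : (1 : Matrix (Fin n ⊕ Fin n) (Fin n ⊕ Fin n) ℝ).map Complex.ofReal = 1 := by
    simp
  refine Prod.ext (funext fun i => ?_) (funext fun i => ?_)
  · simp [affAct, h1]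
  · simp [affAct, h1]

/-- Continuation of a global pair along a loop returns the same germ, so the identity element of the
group suffices. -/
lemma holonomyInG_of_pair (hpair : IsSpecialKaehlerPair g Γ M φ F) (p : Cn n) :
    HolonomyInG M g Γ p φ F := by
  intro c φs Fs hc
  have h1 := hc.eventuallyEq hpair.immersion.holomorphic hpair.prepotential.holomorphic 1
  have hφ : actPhi 1 0 φ = φ := funext fun q => affAct_one (φ q)
  have hF : actF 1 0 0 φ F = F := by
    funext q
    simp [actF, hφ, Omega]
  refine ⟨1, one_mem _, 0, 0, ?_, ?_⟩
  · rw [hφ]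
    simpa using h1.1
  · rw [hF]
    simpa using h1.2

lemma con_eventuallyEq {φ' : Cn n → Phase n} {F' : Cn n → ℂ} {Z : Cn (n + 1)}
    (h1 : φ' =ᶠ[𝓝 (base Z)] φ) (h2 : F' =ᶠ[𝓝 (base Z)] F) :
    con φ' F' =ᶠ[𝓝 Z] con φ F := by
  have hb : Tendsto base (𝓝 Z) (𝓝 (base Z)) := (baseL n).continuous.continuousAt
  filter_upwards [hb.eventually h1, hb.eventually h2] with Y h3 h4
  rw [con, con, h3, h4]

lemma inducedMetric_congr {k : ℕ} {Φ Ψ : Cn k → Phase k} {p : Cn k} (e : Φ =ᶠ[𝓝 p] Ψ)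
    (u v : Cn k) : inducedMetric Φ p u v = inducedMetric Ψ p u v := by
  rw [inducedMetric, inducedMetric, e.fderiv_eq]

lemma inducedConn_congr {k : ℕ} {Φ Ψ : Cn k → Phase k} {p : Cn k} (e : Φ =ᶠ[𝓝 p] Ψ)
    (u v : Cn k) : inducedConn Φ p u v = inducedConn Ψ p u v := by
  have e1 : rePart Φ =ᶠ[𝓝 p] rePart Ψ := by
    filter_upwards [e] with q hq
    rw [rePart, rePart, hq]
  have e2 : (fun q => fderiv ℝ (rePart Φ) q v) =ᶠ[𝓝 p] fun q => fderiv ℝ (rePart Ψ) q v := by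
    filter_upwards [e1.fderiv (𝕜 := ℝ)] with q hq
    rw [hq]
  rw [inducedConn, inducedConn, e1.fderiv_eq, e2.fderiv_eq]

/-- The ASK/PSK-correspondence for the germs of a global pair. -/
lemma isASKPSKImage_of_pair (hM : IsConnected M) (hask : IsAffineSpecialKaehler M g Γ)
    (hpair : IsSpecialKaehlerPair g Γ M φ F) (hnd : IsNondegeneratePair M φ F)
    {gbar : Tensor2 (Cn n)}
    (hq : IsPSKQuotient (inducedMetric (con φ F)) (inducedConn (con φ F)) M gbar)
    {p : Cn n} (hp : p ∈ M) : IsASKPSKImage M g Γ p φ F M gbar where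
  connected := hM
  ask := hask
  germ := ⟨M, hp, Subset.rfl, hpair, hnd⟩
  holonomy := holonomyInG_of_pair hpair p
  domain_eq := (nondegDomain_eq hM hpair hnd hp).symm
  quotient := by
    refine ⟨_, _, hq, ?_⟩
    intro q c φs Fs hc Z _ hZq u v
    have h1 := hc.1.eventuallyEq hpair.immersion.holomorphic hpair.prepotential.holomorphic 1
    rw [Path.target, ← hZq] at h1
    have e := con_eventuallyEq h1.1 h1.2
    exact ⟨(inducedMetric_congr e u v).symm, (inducedConn_congr e u v).symm⟩

end Continuation

/-! ### The deformed metric is a Kähler metric -/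

section Kaehler

variable {n : ℕ} {h : MvPolynomial (Fin n) ℝ} {U : Set (Fin n → ℝ)} {c : ℝ}

/-- The derivative of `logMetric`. -/
def logCubic (h : MvPolynomial (Fin n) ℝ) (c : ℝ) (x u v w : Fin n → ℝ) : ℝ :=
  -(6 * polar ℝ h u v w) / (realFun h x + c)
    + 18 * (polar ℝ h x u v * polar ℝ h x x w + polar ℝ h x v w * polar ℝ h x x u
        + polar ℝ h x w u * polar ℝ h x x v) / (realFun h x + c) ^ 2
    - 54 * (polar ℝ h x x u * polar ℝ h x x v * polar ℝ h x x w) / (realFun h x + c) ^ 3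

/-- Together with `logCubic_swap_right` this is the total symmetry of the third derivative of -log(h
+ c), from which closedness of the Kähler form follows. -/
lemma logCubic_swap_left (x u v w : Fin n → ℝ) :
    logCubic h c x u v w = logCubic h c x v u w := by
  rw [logCubic, logCubic, polar_swap_left h u v w, polar_swap_right h x u v,
    polar_swap_right h x v w, polar_swap_right h x w u]
  ring

lemma logCubic_swap_right (x u v w : Fin n → ℝ) :
    logCubic h c x u v w = logCubic h c x u w v := by
  rw [logCubic, logCubic, polar_swap_right h u v w, polar_swap_right h x u v,
    polar_swap_right h x v w, polar_swap_right h x w u]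
  ring

lemma hasFDerivAt_logMetric (hh : h.IsHomogeneous 3) {x : Fin n → ℝ} (hx : realFun h x + c ≠ 0)
    (v w : Fin n → ℝ) : ∃ L : (Fin n → ℝ) →L[ℝ] ℝ,
      HasFDerivAt (fun y => logMetric h c y v w) L x ∧ ∀ u, L u = logCubic h c x u v w := by
  have hi := (hasDerivAt_inv hx).comp_hasFDerivAt x ((hasFDerivAt_realFun hh x).add_const c)
  have h1 := (((hasFDerivAt_polar_left h v w x).const_mul (6 : ℝ)).neg).mul hi
  have h2 := (((hasFDerivAt_polar_diag h v x).mul (hasFDerivAt_polar_diag h w x)).const_mul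
    (9 : ℝ)).mul (hi.mul hi)
  refine ⟨_, (h1.add h2).congr_of_eventuallyEq (Eventually.of_forall fun y => ?_), fun u => ?_⟩
  · simp only [logMetric, div_eq_mul_inv, Pi.add_apply, Pi.mul_apply, Pi.neg_apply,
      Function.comp_apply, ← inv_pow]
    ring
  · simp [logCubic, polar_rotate h u v w, polar_swap_right h x u v]
    field_simp
    ring

lemma contDiffOn_logMetric (hh : h.IsHomogeneous 3) (u v : Fin n → ℝ) :
    ContDiffOn ℝ ∞ (fun x => logMetric h c x u v) {x | realFun h x + c ≠ 0} := by
  have h0 : ContDiffOn ℝ ∞ (fun x => realFun h x + c) {x | realFun h x + c ≠ 0} :=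
    ((contDiff_realFun hh).add contDiff_const).contDiffOn
  have h1 : ContDiff ℝ ∞ fun x => -(6 * polar ℝ h x u v) :=
    (contDiff_const.mul (contDiff_polar contDiff_id contDiff_const contDiff_const)).neg
  have h2 : ContDiff ℝ ∞ fun x => 9 * (polar ℝ h x x u * polar ℝ h x x v) :=
    contDiff_const.mul ((contDiff_polar contDiff_id contDiff_id contDiff_const).mul
      (contDiff_polar contDiff_id contDiff_id contDiff_const))
  exact (h1.contDiffOn.div h0 fun x hx => hx).add
    (h2.contDiffOn.div (h0.pow 2) fun x hx => pow_ne_zero 2 hx)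

lemma logMetric_comm (x u v : Fin n → ℝ) : logMetric h c x u v = logMetric h c x v u := by
  rw [logMetric, logMetric, polar_swap_right h x u v]
  ring

lemma logMetric_neg_right (x u v : Fin n → ℝ) : logMetric h c x u (-v) = -logMetric h c x u v := by
  simp only [logMetric, map_neg]
  ring

lemma logMetric_neg_left (x u v : Fin n → ℝ) : logMetric h c x (-u) v = -logMetric h c x u v := by
  rw [logMetric_comm, logMetric_neg_right, logMetric_comm]

lemma isPseudoKaehler_deformedMetric (hU : IsProjectiveSpecialReal h U) (c : ℝ) :
    IsPseudoKaehler (tube (Uc h U c)) (deformedMetric h c) := by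
  have hh := hU.homogeneous
  have hopen := isOpen_tube (isOpen_Uc hU c)
  have hne : ∀ z ∈ tube (Uc h U c), realFun h (imPart z) + c ≠ 0 := fun z hz =>
    (add_pos_of_mem_Uc hz).ne'
  refine ⟨hopen, fun p hp u => ⟨fun v w => ?_, fun r v => ?_⟩, fun p hp u v => ?_, fun u v => ?_,
    fun p hp u hu => ?_, fun p hp u v => ?_, ?_⟩
  · simp only [deformedMetric_eq hh (hne p hp), ← imPartL_apply, ← rePtL_apply, map_add, logMetric]
    ring
  · simp only [deformedMetric_eq hh (hne p hp), ← imPartL_apply, ← rePtL_apply, map_smul, logMetric,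
      smul_eq_mul]
    ring
  · simp only [deformedMetric_eq hh (hne p hp)]
    rw [logMetric_comm, logMetric_comm _ (imPart u)]
  · have h1 : ∀ a b, ContDiffOn ℝ ∞ (fun z => logMetric h c (imPart z) a b) (tube (Uc h U c)) :=
      fun a b => (contDiffOn_logMetric hh a b).comp (imPartL n).contDiff.contDiffOn hne
    exact (((h1 (rePt u) (rePt v)).add (h1 (imPart u) (imPart v))).div_const 4).congr
      fun z hz => deformedMetric_eq hh (hne z hz) u v
  · by_contra hu0
    exact (deformedMetric_pos hU hp hu0).ne' (hu u)
  · simp only [deformedMetric_eq hh (hne p hp), imPart_J, rePt_J, logMetric_neg_left,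
      logMetric_neg_right]
    ring
  · have hd : ∀ p ∈ tube (Uc h U c), ∀ u v w,
        fderiv ℝ (fun q => kform (deformedMetric h c) q v w) p u
        = (-logCubic h c (imPart p) (imPart u) (rePt v) (imPart w)
          + logCubic h c (imPart p) (imPart u) (imPart v) (rePt w)) / 4 := by
      intro p hp u v w
      have hev : (fun q => kform (deformedMetric h c) q v w) =ᶠ[𝓝 p] fun q =>
          (-(logMetric h c (imPart q) (rePt v) (imPart w))
            + logMetric h c (imPart q) (imPart v) (rePt w)) * (1 / 4) := by
        filter_upwards [hopen.mem_nhds hp] with q hq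
        rw [kform, deformedMetric_eq hh (hne q hq), rePt_J, imPart_J, logMetric_neg_right]
        ring
      obtain ⟨L1, h1, h1'⟩ := hasFDerivAt_logMetric hh (hne p hp) (rePt v) (imPart w)
      obtain ⟨L2, h2, h2'⟩ := hasFDerivAt_logMetric hh (hne p hp) (imPart v) (rePt w)
      have h3 := ((h1.comp p (imPartL n).hasFDerivAt).neg.add
        (h2.comp p (imPartL n).hasFDerivAt)).mul_const (1 / 4 : ℝ)
      rw [hev.fderiv_eq]
      refine (congrArg (fun L => L u) h3.fderiv).trans ?_
      simp [h1', h2']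
      ring
    intro p hp u v w
    -- By total symmetry each cubic term depends only on which argument enters by its real part;
    -- every choice occurs once with each sign.
    rw [hd p hp, hd p hp, hd p hp, logCubic_swap_right _ (imPart u) (rePt v),
      logCubic_swap_left _ (imPart u) (imPart w), logCubic_swap_right _ (imPart v) (rePt w),
      logCubic_swap_left _ (imPart v) (imPart u), logCubic_swap_right _ (imPart w) (rePt u),
      logCubic_swap_left _ (imPart w) (imPart v)]
    ring

end Kaehler

/-! ### The deformed supergravity r-map -/

section RMap

variable {n : ℕ} {h : MvPolynomial (Fin n) ℝ} {U : Set (Fin n → ℝ)}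

lemma isSpecialKaehlerPair_prepot (hU : IsProjectiveSpecialReal h U) (c : ℝ) :
    IsSpecialKaehlerPair (inducedMetric (graphOfDifferential (prepot h 0)))
      (inducedConn (graphOfDifferential (prepot h 0))) (tube (Uc h U c))
      (graphOfDifferential (prepot h 0)) (prepot h c) where
  isOpen := isOpen_tube (isOpen_Uc hU c)
  immersion :=
    { holomorphic := ((contDiff_graphOfDifferential hU.homogeneous 0).differentiable
        (by simp)).differentiableOn
      immersion := fun p _ u v huv => by
        rw [fderiv_graphOfDifferential hU.homogeneous, fderiv_graphOfDifferential hU.homogeneous]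
          at huv
        exact congrArg Prod.fst huv
      lagrangian := fun p _ u v => Omega_fderiv_graph hU.homogeneous p u v }
  kaehlerian := isKaehlerian_graph hU Uc_subset
  metric_eq _ _ _ _ := rfl
  conn_eq _ _ _ _ := rfl
  prepotential :=
    { holomorphic := fun z _ =>
        (hasFDerivAt_prepot hU.homogeneous c z).differentiableAt.differentiableWithinAt
      deriv_eq := fun z _ u => by
        rw [fderiv_graphOfDifferential hU.homogeneous, graphOfDifferential_eq hU.homogeneous,
          fderiv_prepot hU.homogeneous, ← sum_mul_polar_single (h := h) u, Finset.mul_sum,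
          ← Finset.sum_neg_distrib]
        exact Finset.sum_congr rfl fun i _ => by ring }

lemma isPSKQuotient_deformedMetric (hU : IsProjectiveSpecialReal h U) (c : ℝ) :
    IsPSKQuotient (inducedMetric (con (graphOfDifferential (prepot h 0)) (prepot h c)))
      (inducedConn (con (graphOfDifferential (prepot h 0)) (prepot h c)))
      (tube (Uc h U c)) (deformedMetric h c) where
  conical := isConicalASK_con hU c
  kaehler := isPseudoKaehler_deformedMetric hU c
  pullback _ hZ u v := (horizontalTensor_con hU hZ u v).symm

lemma isConnected_tube_Uc (hU : IsProjectiveSpecialReal h U) (c : ℝ) :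
    IsConnected (tube (Uc h U c)) := isConnected_tube (isConnected_Uc hU c)

lemma isASKPSKImage_deformedMetric (hU : IsProjectiveSpecialReal h U) (c : ℝ) {p : Cn n}
    (hp : p ∈ tube (Uc h U c)) :
    IsASKPSKImage (tube (Uc h U c)) (inducedMetric (graphOfDifferential (prepot h 0)))
      (inducedConn (graphOfDifferential (prepot h 0))) p
      (graphOfDifferential (prepot h 0)) (prepot h c) (tube (Uc h U c)) (deformedMetric h c) :=
  isASKPSKImage_of_pair (isConnected_tube_Uc hU c)
    (isAffineSpecialKaehler_induced (isOpen_tube (isOpen_Uc hU c))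
      (contDiff_graphOfDifferential hU.homogeneous 0)
      (fun p _ => Omega_fderiv_graph hU.homogeneous p) (isKaehlerian_graph hU Uc_subset))
    (isSpecialKaehlerPair_prepot hU c) (isNondegeneratePair_prepot hU c)
    (isPSKQuotient_deformedMetric hU c) hp

lemma hess_comp_clm {E G : Type*} [NormedAddCommGroup E] [NormedSpace ℝ E] [NormedAddCommGroup G]
    [NormedSpace ℝ G] {f : G → ℝ} (L : E →L[ℝ] G) {z : E} (hf : ContDiffAt ℝ 2 f (L z)) (u v : E) :
    hess (fun y => f (L y)) z u v = hess f (L z) (L u) (L v) := by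
  have h1 : ∀ᶠ y in 𝓝 z, ContDiffAt ℝ 2 f (L y) :=
    L.continuous.continuousAt.eventually (hf.eventually (by simp))
  have h2 : (fun y => fderiv ℝ (fun y => f (L y)) y v) =ᶠ[𝓝 z]
      fun y => (fun x => fderiv ℝ f x (L v)) (L y) := by
    filter_upwards [h1] with y hy
    have := (hy.differentiableAt (by simp)).hasFDerivAt.comp y L.hasFDerivAt
    exact congrArg (fun T => T v) this.fderiv
  have h3 : DifferentiableAt ℝ (fun x => fderiv ℝ f x (L v)) (L z) :=
    ((hf.fderiv_right (m := 1) (by norm_num)).clm_apply contDiffAt_const).differentiableAt (by simp)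
  rw [hess, h2.fderiv_eq, hess]
  exact congrArg (fun T => T u) (h3.hasFDerivAt.comp z L.hasFDerivAt).fderiv

/-- The potential depends only on x, and Im(Ju) = Re u. Hence the Hessian on (u, v) gives the
x-block and that on (Ju, Jv) the y-block. -/
lemma deformedMetric_zero_eq_rMapMetric (hU : IsProjectiveSpecialReal h U) {z : Cn n}
    (hz : z ∈ tube U) (u v : Cn n) : deformedMetric h 0 z u v = rMapMetric h z u v := by
  have hx : realFun h (imPart z) ≠ 0 := (hU.pos _ hz).ne'
  have h0 : ContDiffAt ℝ 2 (fun x => -Real.log (realFun h x)) (imPartL n z) :=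
    ((contDiff_realFun hU.homogeneous).contDiffAt.log hx).neg
  have h1 : ∀ a b, hess (fun z : Cn n => -Real.log (realFun h (imPart z))) z a b
      = -hess (fun x => Real.log (realFun h x)) (imPart z) (imPart a) (imPart b) := by
    intro a b
    refine (hess_comp_clm (imPartL n) h0 a b).trans ?_
    simp [hess]
  rw [rMapMetric, metricOfPotential, h1, h1, imPart_J, imPart_J, deformedMetric]
  simp only [add_zero]
  ring

/-- When c' = r³c, the dilation multiplies h + c by r³, and both quotients in `logMetric` are
invariant. -/
lemma deformedMetric_smul (hU : IsProjectiveSpecialReal h U) {c c' r : ℝ} (hr : 0 < r)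
    (hc : c' = r ^ 3 * c) {z : Cn n} (hz : z ∈ tube (Uc h U c)) (u v : Cn n) :
    deformedMetric h c' (r • z) (r • u) (r • v) = deformedMetric h c z u v := by
  have hh := hU.homogeneous
  have hi : ∀ z : Cn n, imPart (r • z) = r • imPart z := fun z => (imPartL n).map_smul r z
  have hre : ∀ z : Cn n, rePt (r • z) = r • rePt z := fun z => (rePtL n).map_smul r z
  have h1 : realFun h (imPart z) + c ≠ 0 := (add_pos_of_mem_Uc hz).ne'
  have h2 : realFun h (imPart (r • z)) + c' = r ^ 3 * (realFun h (imPart z) + c) := by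
    rw [hi, realFun_smul hh, hc]
    ring
  have h3 : realFun h (imPart (r • z)) + c' ≠ 0 := by
    rw [h2]
    positivity
  have h4 : ∀ a b, logMetric h c' (imPart (r • z)) (r • a) (r • b)
      = logMetric h c (imPart z) a b := by
    intro a b
    rw [logMetric, logMetric, h2, hi]
    simp only [map_smul, smul_apply, smul_eq_mul]
    field_simp
  rw [deformedMetric_eq hh h3, deformedMetric_eq hh h1, hre, hre, hi u, hi v, h4, h4]

lemma areIsometric_deformedMetric (hU : IsProjectiveSpecialReal h U) {c c' : ℝ}
    (hc : 0 < c * c') : AreIsometric (tube (Uc h U c)) (deformedMetric h c)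
      (tube (Uc h U c')) (deformedMetric h c') := by
  have hc0 : c ≠ 0 := by rintro rfl; simp at hc
  have hq : 0 < c' / c := by
    have : c' / c = c * c' / (c * c) := by field_simp
    rw [this]
    exact div_pos hc (mul_self_pos.2 hc0)
  -- The equal signs of c and c' make this a positive dilation factor, with r³c = c'.
  set r := (c' / c) ^ (1 / 3 : ℝ) with hr
  have hr0 : 0 < r := Real.rpow_pos_of_pos hq _
  have hr3 : r ^ 3 = c' / c := rpow_third_pow hq.le
  have hcc : c' = r ^ 3 * c := by rw [hr3, div_mul_cancel₀ _ hc0]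
  have hcc' : c = r⁻¹ ^ 3 * c' := by rw [hcc]; field_simp
  have hi : ∀ (s : ℝ) (z : Cn n), imPart (s • z) = s • imPart z :=
    fun s z => (imPartL n).map_smul s z
  refine ⟨fun z => r • z, fun z => r⁻¹ • z, fun z hz => ?_, fun z hz => ?_, ⟨fun z _ => ?_,
    fun z _ => ?_⟩, (contDiff_const_smul r).contDiffOn, (contDiff_const_smul r⁻¹).contDiffOn,
    fun z hz u v => ?_⟩
  · show imPart (r • z) ∈ Uc h U c'
    rw [hi]
    exact smul_mem_Uc hU hr0 hcc hz
  · show imPart (r⁻¹ • z) ∈ Uc h U c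
    rw [hi]
    exact smul_mem_Uc hU (inv_pos.2 hr0) hcc' hz
  · exact inv_smul_smul₀ hr0.ne' z
  · exact smul_inv_smul₀ hr0.ne' z
  · have hd : ∀ u, fderiv ℝ (fun z : Cn n => r • z) z u = r • u := by
      intro u
      have := ((hasFDerivAt_id z).const_smul r).fderiv (𝕜 := ℝ)
      exact congrArg (fun L => L u) this
    rw [hd, hd]
    exact deformedMetric_smul hU hr0 hcc hz u v

end RMap

/-! ### Lengths of curves -/

section Curves

variable {E : Type*} [NormedAddCommGroup E] [NormedSpace ℝ E]

lemma enorm_sub_le_lintegral_derivWithin [CompleteSpace E] {f : ℝ → E}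
    (hf : ContDiffOn ℝ 1 f (Icc 0 1)) {a b : ℝ} (ha : a ∈ Icc (0 : ℝ) 1) (hb : b ∈ Icc (0 : ℝ) 1) :
    ‖f b - f a‖ₑ ≤ ∫⁻ t in Icc (0 : ℝ) 1, ‖derivWithin f (Icc 0 1) t‖ₑ := by
  wlog hab : a ≤ b generalizing a b
  · rw [← enorm_neg, neg_sub]
    exact this hb ha (le_of_not_ge hab)
  have hsub : Icc a b ⊆ Icc 0 1 := Icc_subset_Icc ha.1 hb.2
  refine (enorm_sub_le_lintegral_deriv_of_contDiffOn_Icc (hf.mono hsub) hab).trans ?_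
  rw [← setLIntegral_congr (Ioo_ae_eq_Icc (μ := volume) (a := a) (b := b))]
  have h1 : ∫⁻ t in Ioo a b, ‖deriv f t‖ₑ = ∫⁻ t in Ioo a b, ‖derivWithin f (Icc 0 1) t‖ₑ := by
    refine setLIntegral_congr_fun measurableSet_Ioo fun t ht => ?_
    have : Icc (0 : ℝ) 1 ∈ 𝓝 t :=
      mem_of_superset (Ioo_mem_nhds ht.1 ht.2) (Ioo_subset_Icc_self.trans hsub)
    simp only [derivWithin_of_mem_nhds this]
  rw [h1]
  exact lintegral_mono_set (Ioo_subset_Icc_self.trans hsub)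

/-- A bound for the displacement along a curve by an integral of a bound for the speed. -/
lemma norm_sub_lt_of_lintegral_lt [CompleteSpace E] {f : ℝ → E} {ℓ : ℝ → ℝ} {C δ : ℝ} (hC : 0 ≤ C)
    (hf : ContDiffOn ℝ 1 f (Icc 0 1))
    (hbound : ∀ t ∈ Icc (0 : ℝ) 1, ‖derivWithin f (Icc 0 1) t‖ ≤ C * ℓ t)
    (hℓ : ∫⁻ t in Icc (0 : ℝ) 1, ENNReal.ofReal (ℓ t) < ENNReal.ofReal δ)
    {a b : ℝ} (ha : a ∈ Icc (0 : ℝ) 1) (hb : b ∈ Icc (0 : ℝ) 1) : ‖f b - f a‖ ≤ C * δ := by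
  have hδ : 0 ≤ δ := by
    by_contra h
    rw [ENNReal.ofReal_of_nonpos (not_le.1 h).le] at hℓ
    exact not_lt_bot hℓ
  have h1 : ‖f b - f a‖ₑ ≤ ENNReal.ofReal (C * δ) := by
    refine (enorm_sub_le_lintegral_derivWithin hf ha hb).trans ?_
    calc ∫⁻ t in Icc (0 : ℝ) 1, ‖derivWithin f (Icc 0 1) t‖ₑ
        ≤ ∫⁻ t in Icc (0 : ℝ) 1, ENNReal.ofReal C * ENNReal.ofReal (ℓ t) := by
          refine setLIntegral_mono' measurableSet_Icc fun t ht => ?_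
          rw [← ofReal_norm, ← ENNReal.ofReal_mul hC]
          exact ENNReal.ofReal_le_ofReal (hbound t ht)
      _ = ENNReal.ofReal C * ∫⁻ t in Icc (0 : ℝ) 1, ENNReal.ofReal (ℓ t) :=
          lintegral_const_mul' _ _ ENNReal.ofReal_ne_top
      _ ≤ ENNReal.ofReal C * ENNReal.ofReal δ := by gcongr
      _ = ENNReal.ofReal (C * δ) := (ENNReal.ofReal_mul hC).symm
  rw [← ofReal_norm] at h1
  exact (ENNReal.ofReal_le_ofReal_iff (mul_nonneg hC hδ)).1 h1

/-- Short curves that meet a small ball stay in a larger one. -/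
lemma exists_confinement [FiniteDimensional ℝ E] (x₀ : E) {r : ℝ} (hr : 0 < r) :
    ∃ L : ℝ, 0 < L ∧ ∀ (γ : ℝ → E) (ℓ : ℝ → ℝ) (C δ : ℝ), 0 ≤ C → (∀ t, 0 ≤ ℓ t) →
      ContDiffOn ℝ 1 γ (Icc 0 1) →
      (∀ t ∈ Icc (0 : ℝ) 1, γ t ∈ Metric.closedBall x₀ r →
        ‖derivWithin γ (Icc 0 1) t‖ ≤ C * ℓ t) →
      ∫⁻ t in Icc (0 : ℝ) 1, ENNReal.ofReal (ℓ t) < ENNReal.ofReal δ → L * C * δ < 1 →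
      ∀ t₀ ∈ Icc (0 : ℝ) 1, γ t₀ ∈ Metric.closedBall x₀ (r / 2) →
      ∀ t ∈ Icc (0 : ℝ) 1, γ t ∈ Metric.ball x₀ r := by
  -- The bump function ψ is 1 on the ball of radius r/2 and 0 outside that of radius r, so a curve
  -- that escapes changes ψ by 1. Since dψ vanishes off the closed r-ball, a speed bound there
  -- already limits the change of ψ to a constant times Cδ.
  let ψ : ContDiffBump x₀ := ⟨r / 2, r, by positivity, by linarith⟩
  have hψ : ContDiff ℝ 1 ψ := ψ.contDiff
  obtain ⟨L, hL⟩ := (ψ.hasCompactSupport.fderiv ℝ).exists_bound_of_continuous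
    (hψ.continuous_fderiv (by simp))
  have hL0 : 0 ≤ L := (norm_nonneg _).trans (hL x₀)
  -- The summand 1 ensures a positive constant even when the bound L is 0.
  refine ⟨L + 1, by linarith, ?_⟩
  intro γ ℓ C δ hC hℓ0 hγ hbound hℓ hsmall t₀ ht₀ hmem t ht
  by_contra hout
  have hfc : ContDiffOn ℝ 1 (fun t => ψ (γ t)) (Icc 0 1) := hψ.comp_contDiffOn hγ
  have hu : UniqueDiffOn ℝ (Icc (0 : ℝ) 1) := uniqueDiffOn_Icc zero_lt_one
  have hb : ∀ t ∈ Icc (0 : ℝ) 1,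
      ‖derivWithin (fun t => ψ (γ t)) (Icc 0 1) t‖ ≤ (L + 1) * C * ℓ t := by
    intro t ht
    have h1 : HasDerivWithinAt γ (derivWithin γ (Icc 0 1) t) (Icc 0 1) t :=
      ((hγ.differentiableOn (by simp)) t ht).hasDerivWithinAt
    have h2 := ((hψ.differentiable (by simp) (γ t)).hasFDerivAt.comp_hasDerivWithinAt t h1)
    have h3 : derivWithin (fun t => ψ (γ t)) (Icc 0 1) t
        = fderiv ℝ ψ (γ t) (derivWithin γ (Icc 0 1) t) := h2.derivWithin (hu t ht)
    rw [h3]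
    have h5 : 0 ≤ C * ℓ t := mul_nonneg hC (hℓ0 t)
    by_cases hin : γ t ∈ Metric.closedBall x₀ r
    · have h4 := hbound t ht hin
      calc ‖fderiv ℝ ψ (γ t) (derivWithin γ (Icc 0 1) t)‖
          ≤ ‖fderiv ℝ ψ (γ t)‖ * ‖derivWithin γ (Icc 0 1) t‖ := ContinuousLinearMap.le_opNorm _ _
        _ ≤ L * (C * ℓ t) := mul_le_mul (hL _) h4 (norm_nonneg _) hL0
        _ ≤ (L + 1) * C * ℓ t := by nlinarith
    · have h6 : fderiv ℝ ψ (γ t) = 0 := by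
        by_contra hne
        have := support_fderiv_subset ℝ (f := ψ) (Function.mem_support.2 hne)
        rw [ψ.tsupport_eq] at this
        exact hin this
      rw [h6]
      simp
      nlinarith
  have h7 := norm_sub_lt_of_lintegral_lt (by positivity) hfc hb hℓ ht ht₀
  have h8 : ψ (γ t₀) = 1 := ψ.one_of_mem_closedBall hmem
  have h9 : ψ (γ t) = 0 := ψ.zero_of_le_dist (not_lt.1 hout)
  simp only [h8, h9] at h7
  norm_num at h7
  linarith

lemma exists_curve_of_riemDist_lt {S : Set E} {g : Tensor2 E} {x y : E} {δ : ℝ≥0∞}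
    (hδ : riemDist S g x y < δ) : ∃ c : ℝ → E, ContDiffOn ℝ 1 c (Icc 0 1) ∧
      MapsTo c (Icc 0 1) S ∧ c 0 = x ∧ c 1 = y ∧ curveLength g c < δ := by
  obtain ⟨c, hc⟩ := iInf_lt_iff.1 hδ
  obtain ⟨⟨h1, h2, h3, h4⟩, h5⟩ := iInf_lt_iff.1 hc
  exact ⟨c, h1, h2, h3, h4, h5⟩

lemma riemDist_le_curveLength {S : Set E} {g : Tensor2 E} {c : ℝ → E}
    (hc : ContDiffOn ℝ 1 c (Icc 0 1)) (hS : MapsTo c (Icc 0 1) S) :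
    riemDist S g (c 0) (c 1) ≤ curveLength g c :=
  iInf₂_le c ⟨hc, hS, rfl, rfl⟩

/-- Straight segments bound the Riemannian distance from above. -/
lemma riemDist_le_of_segment {S : Set E} {g : Tensor2 E} {x y : E} {K : ℝ}
    (hS : ∀ t ∈ Icc (0 : ℝ) 1, x + t • (y - x) ∈ S)
    (hK : ∀ t ∈ Icc (0 : ℝ) 1, Real.sqrt (g (x + t • (y - x)) (y - x) (y - x)) ≤ K) :
    riemDist S g x y ≤ ENNReal.ofReal K := by
  have hd : ∀ t, HasDerivAt (fun t : ℝ => x + t • (y - x)) (y - x) t := by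
    intro t
    simpa using ((hasDerivAt_id t).smul_const (y - x)).const_add x
  have hc : ContDiffOn ℝ 1 (fun t : ℝ => x + t • (y - x)) (Icc 0 1) :=
    (contDiff_const.add (contDiff_id.smul contDiff_const)).contDiffOn
  have h1 := riemDist_le_curveLength (g := g) hc hS
  simp only [zero_smul, add_zero, one_smul, add_sub_cancel] at h1
  refine h1.trans ?_
  calc curveLength g (fun t : ℝ => x + t • (y - x))
      ≤ ∫⁻ _ in Icc (0 : ℝ) 1, ENNReal.ofReal K := by
        refine setLIntegral_mono' measurableSet_Icc fun t ht => ?_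
        rw [(hd t).hasDerivWithinAt.derivWithin (uniqueDiffOn_Icc zero_lt_one t ht)]
        exact ENNReal.ofReal_le_ofReal (hK t ht)
    _ = ENNReal.ofReal K := by simp

end Curves

/-! ### Bounds for the metrics on compact sets -/

section Bounds

variable {n : ℕ} {h : MvPolynomial (Fin n) ℝ} {U : Set (Fin n → ℝ)} {c : ℝ}

lemma continuousOn_logMetric_self (hU : IsProjectiveSpecialReal h U) :
    ContinuousOn (fun q : (Fin n → ℝ) × (Fin n → ℝ) => logMetric h c q.1 q.2 q.2)
      (Uc h U c ×ˢ univ) := by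
  have hh := hU.homogeneous
  have h0 : Continuous fun q : (Fin n → ℝ) × (Fin n → ℝ) => realFun h q.1 + c :=
    ((contDiff_realFun hh (m := 0)).continuous.comp continuous_fst).add continuous_const
  have h1 : Continuous fun q : (Fin n → ℝ) × (Fin n → ℝ) => polar ℝ h q.1 q.2 q.2 :=
    (contDiff_polar (m := 0) contDiff_fst contDiff_snd contDiff_snd).continuous
  have h2 : Continuous fun q : (Fin n → ℝ) × (Fin n → ℝ) => polar ℝ h q.1 q.1 q.2 :=
    (contDiff_polar (m := 0) contDiff_fst contDiff_fst contDiff_snd).continuous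
  refine ContinuousOn.add (ContinuousOn.div ?_ h0.continuousOn ?_)
    (ContinuousOn.div ?_ (h0.pow 2).continuousOn ?_)
  · exact (continuous_const.mul h1).neg.continuousOn
  · rintro q ⟨hq, _⟩
    exact (add_pos_of_mem_Uc hq).ne'
  · exact (continuous_const.mul (h2.mul h2)).continuousOn
  · rintro q ⟨hq, _⟩
    exact pow_ne_zero 2 (add_pos_of_mem_Uc hq).ne'

lemma logMetric_smul_self (x v : Fin n → ℝ) (r : ℝ) :
    logMetric h c x (r • v) (r • v) = r ^ 2 * logMetric h c x v v := by
  simp only [logMetric, map_smul, smul_apply, smul_eq_mul]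
  ring

/-- Quadratic homogeneity reduces bounds over all v to a compact set of directions; for v = 0 both
sides vanish. -/
lemma logMetric_self_scale (x v : Fin n → ℝ) :
    logMetric h c x v v = ‖v‖ ^ 2 * logMetric h c x (‖v‖⁻¹ • v) (‖v‖⁻¹ • v) := by
  by_cases hv : v = 0
  · simp [hv, logMetric]
  · have : ‖v‖ ≠ 0 := norm_ne_zero_iff.2 hv
    rw [logMetric_smul_self]
    field_simp

lemma exists_logMetric_ge (hU : IsProjectiveSpecialReal h U) {K : Set (Fin n → ℝ)}
    (hK : IsCompact K) (hKU : K ⊆ Uc h U c) :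
    ∃ C : ℝ, 0 < C ∧ ∀ x ∈ K, ∀ v, ‖v‖ ≤ C * Real.sqrt (logMetric h c x v v) := by
  have hcont := (continuousOn_logMetric_self (c := c) hU).mono
    (prod_mono hKU (subset_univ (Metric.sphere (0 : Fin n → ℝ) 1)))
  -- A positive lower bound m over K times the unit sphere; the required constant is 1/√m.
  obtain ⟨m, hm, hm'⟩ := (hK.prod (isCompact_sphere _ _)).exists_forall_le' hcont (a := 0)
    (by
      rintro ⟨x, v⟩ ⟨hx, hv⟩
      refine logMetric_pos hU (hKU hx) ?_
      rintro rfl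
      simp at hv)
  refine ⟨(Real.sqrt m)⁻¹, inv_pos.2 (Real.sqrt_pos.2 hm), fun x hx v => ?_⟩
  by_cases hv : v = 0
  · simp only [hv, norm_zero]
    positivity
  have h1 : m ≤ logMetric h c x (‖v‖⁻¹ • v) (‖v‖⁻¹ • v) := by
    refine hm' (x, ‖v‖⁻¹ • v) ⟨hx, ?_⟩
    have : ‖v‖ ≠ 0 := norm_ne_zero_iff.2 hv
    simp [norm_smul, this]
  have h2 : ‖v‖ ^ 2 * m ≤ logMetric h c x v v := by
    rw [logMetric_self_scale]
    gcongr
  have h3 : Real.sqrt (‖v‖ ^ 2 * m) ≤ Real.sqrt (logMetric h c x v v) := Real.sqrt_le_sqrt h2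
  rw [Real.sqrt_mul (by positivity), Real.sqrt_sq (norm_nonneg _)] at h3
  rw [inv_mul_eq_div, le_div_iff₀ (Real.sqrt_pos.2 hm)]
  exact h3

lemma exists_logMetric_le (hU : IsProjectiveSpecialReal h U) {K : Set (Fin n → ℝ)}
    (hK : IsCompact K) (hKU : K ⊆ Uc h U c) :
    ∃ C : ℝ, 0 ≤ C ∧ ∀ x ∈ K, ∀ v, logMetric h c x v v ≤ C * ‖v‖ ^ 2 := by
  have hcont := (continuousOn_logMetric_self (c := c) hU).mono
    -- The ball, unlike the sphere, also contains ‖v‖⁻¹ • v for v = 0, where the inverse is 0.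
    (prod_mono hKU (subset_univ (Metric.closedBall (0 : Fin n → ℝ) 1)))
  obtain ⟨C, hC⟩ := (hK.prod (isCompact_closedBall _ _)).exists_bound_of_continuousOn hcont
  refine ⟨max C 0, le_max_right _ _, fun x hx v => ?_⟩
  have h1 : logMetric h c x (‖v‖⁻¹ • v) (‖v‖⁻¹ • v) ≤ max C 0 := by
    refine ((le_abs_self _).trans (hC (x, ‖v‖⁻¹ • v) ⟨hx, ?_⟩)).trans (le_max_left _ _)
    simp only [Metric.mem_closedBall, dist_zero_right, norm_smul, norm_inv, norm_norm]
    exact inv_mul_le_one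
  rw [logMetric_self_scale, mul_comm]
  gcongr

lemma norm_imPart_le (u : Cn n) : ‖imPart u‖ ≤ ‖u‖ :=
  (pi_norm_le_iff_of_nonneg (norm_nonneg _)).2 fun i =>
    (Complex.abs_im_le_norm (u i)).trans (norm_le_pi_norm u i)

lemma norm_rePt_le (u : Cn n) : ‖rePt u‖ ≤ ‖u‖ :=
  (pi_norm_le_iff_of_nonneg (norm_nonneg _)).2 fun i =>
    (Complex.abs_re_le_norm (u i)).trans (norm_le_pi_norm u i)

/-- The factor 2 undoes the 1/4 in the deformed metric; the other block is non-negative and is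
discarded. -/
lemma sqrt_logMetric_imPart_le (hU : IsProjectiveSpecialReal h U) {z : Cn n}
    (hz : z ∈ tube (Uc h U c)) (u : Cn n) :
    Real.sqrt (logMetric h c (imPart z) (imPart u) (imPart u))
      ≤ 2 * Real.sqrt (deformedMetric h c z u u) := by
  have hz' : imPart z ∈ Uc h U c := hz
  have h1 := logMetric_nonneg hU hz' (rePt u)
  have h2 : (2 : ℝ) = Real.sqrt 4 := by
    rw [show (4 : ℝ) = 2 ^ 2 by norm_num, Real.sqrt_sq (by norm_num)]
  rw [h2, ← Real.sqrt_mul (by norm_num),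
    deformedMetric_eq hU.homogeneous (add_pos_of_mem_Uc hz').ne']
  exact Real.sqrt_le_sqrt (by linarith)

lemma sqrt_logMetric_rePt_le (hU : IsProjectiveSpecialReal h U) {z : Cn n}
    (hz : z ∈ tube (Uc h U c)) (u : Cn n) :
    Real.sqrt (logMetric h c (imPart z) (rePt u) (rePt u))
      ≤ 2 * Real.sqrt (deformedMetric h c z u u) := by
  have hz' : imPart z ∈ Uc h U c := hz
  have h1 := logMetric_nonneg hU hz' (imPart u)
  have h2 : (2 : ℝ) = Real.sqrt 4 := by
    rw [show (4 : ℝ) = 2 ^ 2 by norm_num, Real.sqrt_sq (by norm_num)]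
  rw [h2, ← Real.sqrt_mul (by norm_num),
    deformedMetric_eq hU.homogeneous (add_pos_of_mem_Uc hz').ne']
  exact Real.sqrt_le_sqrt (by linarith)

end Bounds

/-! ### The radial projection to the level set -/

section Projection

variable {n : ℕ} {h : MvPolynomial (Fin n) ℝ} {U : Set (Fin n → ℝ)} {c : ℝ}

/-- The projection `x ↦ h(x)^{-1/3} x` to the level set `{h = 1}`. -/
def radialProj (h : MvPolynomial (Fin n) ℝ) (x : Fin n → ℝ) : Fin n → ℝ :=
  (realFun h x) ^ (-(1 / 3) : ℝ) • x

lemma rpow_neg_third_pow {a : ℝ} (ha : 0 ≤ a) : (a ^ (-(1 / 3) : ℝ)) ^ 3 = a⁻¹ := by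
  rw [Real.rpow_neg ha, inv_pow, rpow_third_pow ha]

lemma radialProj_mem (hU : IsProjectiveSpecialReal h U) {x : Fin n → ℝ} (hx : x ∈ U) :
    radialProj h x ∈ levelSet h U := by
  have h0 := hU.pos x hx
  refine ⟨hU.cone _ (Real.rpow_pos_of_pos h0 _) x hx, ?_⟩
  rw [radialProj, realFun_smul hU.homogeneous, rpow_neg_third_pow h0.le, inv_mul_cancel₀ h0.ne']

lemma smul_radialProj (hU : IsProjectiveSpecialReal h U) {x : Fin n → ℝ} (hx : x ∈ U) :
    (realFun h x) ^ (1 / 3 : ℝ) • radialProj h x = x := by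
  have h0 := hU.pos x hx
  rw [radialProj, smul_smul, ← Real.rpow_add h0]
  simp

lemma contDiffOn_radialProj (hU : IsProjectiveSpecialReal h U) :
    ContDiffOn ℝ 1 (radialProj h) U := by
  have h1 : ContDiffOn ℝ 1 (fun x => realFun h x ^ (-(1 / 3) : ℝ)) U :=
    (contDiff_realFun hU.homogeneous).contDiffOn.rpow_const_of_ne fun x hx => (hU.pos x hx).ne'
  exact h1.smul contDiffOn_id

lemma hasFDerivAt_radialProj (hU : IsProjectiveSpecialReal h U) {x : Fin n → ℝ} (hx : x ∈ U) :
    ∃ L : (Fin n → ℝ) →L[ℝ] (Fin n → ℝ), HasFDerivAt (radialProj h) L x ∧ ∀ v, L v =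
      (realFun h x) ^ (-(1 / 3) : ℝ) • (v - (polar ℝ h x x v / realFun h x) • x) := by
  have h0 := hU.pos x hx
  have h1 := (hasFDerivAt_realFun hU.homogeneous x).rpow_const (p := -(1 / 3)) (Or.inl h0.ne')
  refine ⟨_, h1.smul (hasFDerivAt_id x), fun v => ?_⟩
  rw [Real.rpow_sub_one h0.ne']
  generalize (realFun h x) ^ (-(1 / 3) : ℝ) = r
  funext i
  simp
  field_simp
  ring

/-- The projection kills the radial direction and scales the cubic form by 1/h. The result is the
first summand of `logMetric_self_eq` with h in place of h + c. -/
lemma gU_radialProj (hU : IsProjectiveSpecialReal h U) {x : Fin n → ℝ} (hx : x ∈ U)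
    (v : Fin n → ℝ) (w : Fin n → ℝ) (hw : w =
      (realFun h x) ^ (-(1 / 3) : ℝ) • (v - (polar ℝ h x x v / realFun h x) • x)) :
    gU h (radialProj h x) w w
      = 6 * (polar ℝ h x x v ^ 2 / realFun h x - polar ℝ h x v v) / realFun h x := by
  have h0 := hU.pos x hx
  have h3 := rpow_neg_third_pow h0.le
  set r := (realFun h x) ^ (-(1 / 3) : ℝ) with hr
  have hxx : polar ℝ h x x x = realFun h x := (polar_self_real hU.homogeneous x).symm
  have hrp : radialProj h x = r • x := rfl
  rw [gU_eq hU.homogeneous, hrp, hw]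
  simp only [map_sub, map_smul, sub_apply, smul_apply, smul_eq_mul, hxx, polar_swap_right h x v x]
  trans -(6 * (r ^ 3 * (polar ℝ h x v v
    - polar ℝ h x x v / realFun h x * (2 * polar ℝ h x x v)
    + (polar ℝ h x x v / realFun h x) ^ 2 * realFun h x)))
  · ring
  rw [h3]
  field_simp
  ring

/-- For c ≤ 0 one has h + c ≤ h, which favours the first summand of `logMetric_self_eq`; the second
is non-negative. -/
lemma gU_radialProj_le (hU : IsProjectiveSpecialReal h U) (hc : c ≤ 0) {x : Fin n → ℝ}
    (hx : x ∈ Uc h U c) (v : Fin n → ℝ) :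
    6 * (polar ℝ h x x v ^ 2 / realFun h x - polar ℝ h x v v) / realFun h x
      ≤ logMetric h c x v v := by
  have h0 := hU.pos x hx.1
  have h1 := add_pos_of_mem_Uc hx
  have h2 := sub_pos_of_mem_Uc hU hx
  have h3 := polar_mul_self_le hU hx.1 v
  rw [logMetric_self_eq hU hx]
  have h4 : 6 * (polar ℝ h x x v ^ 2 / realFun h x - polar ℝ h x v v) / realFun h x
      ≤ 6 * (polar ℝ h x x v ^ 2 / realFun h x - polar ℝ h x v v) / (realFun h x + c) :=
    div_le_div_of_nonneg_left (by linarith) h1 (by linarith)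
  have h5 : 0 ≤ 3 * polar ℝ h x x v ^ 2 * (realFun h x - 2 * c)
      / (realFun h x * (realFun h x + c) ^ 2) := by positivity
  linarith

/-- For c ≤ 0 one has h - 2c ≥ h, so the radial summand alone is at least a third of the left side.
The constant 3 would do; 4 is a square. -/
lemma sq_dlog_le (hU : IsProjectiveSpecialReal h U) (hc : c ≤ 0) {x : Fin n → ℝ}
    (hx : x ∈ Uc h U c) (v : Fin n → ℝ) :
    (3 * polar ℝ h x x v / (realFun h x + c)) ^ 2 ≤ 4 * logMetric h c x v v := by
  have h0 := hU.pos x hx.1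
  have h1 := add_pos_of_mem_Uc hx
  have h3 := polar_mul_self_le hU hx.1 v
  rw [logMetric_self_eq hU hx]
  have h4 : 0 ≤ 6 * (polar ℝ h x x v ^ 2 / realFun h x - polar ℝ h x v v) / (realFun h x + c) :=
    div_nonneg (by linarith) h1.le
  have h5 : 3 * polar ℝ h x x v ^ 2 / (realFun h x + c) ^ 2
      ≤ 3 * polar ℝ h x x v ^ 2 * (realFun h x - 2 * c)
      / (realFun h x * (realFun h x + c) ^ 2) := by
    rw [div_le_div_iff₀ (by positivity) (by positivity)]
    have : 0 ≤ 3 * polar ℝ h x x v ^ 2 * (realFun h x + c) ^ 2 := by positivity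
    nlinarith
  have h6 : (3 * polar ℝ h x x v / (realFun h x + c)) ^ 2
      = 3 * (3 * polar ℝ h x x v ^ 2 / (realFun h x + c) ^ 2) := by
    field_simp
  have h7 : 0 ≤ 3 * polar ℝ h x x v ^ 2 / (realFun h x + c) ^ 2 := by positivity
  rw [h6]
  linarith

end Projection

/-! ### Completeness -/

section Completeness

variable {n : ℕ} {h : MvPolynomial (Fin n) ℝ} {U : Set (Fin n → ℝ)} {c : ℝ}

lemma hasDerivWithinAt_of_contDiffOn {E : Type*} [NormedAddCommGroup E] [NormedSpace ℝ E]
    {γ : ℝ → E} (hγ : ContDiffOn ℝ 1 γ (Icc 0 1)) {t : ℝ} (ht : t ∈ Icc (0 : ℝ) 1) :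
    HasDerivWithinAt γ (derivWithin γ (Icc 0 1) t) (Icc 0 1) t :=
  ((hγ.differentiableOn (by simp)) t ht).hasDerivWithinAt

/-- The radial projection of curves increases lengths at most by the factor `2`. -/
lemma riemDist_radialProj_le (hU : IsProjectiveSpecialReal h U) (hc : c ≤ 0) {γ : ℝ → Cn n}
    (hγ : ContDiffOn ℝ 1 γ (Icc 0 1)) (hmem : MapsTo γ (Icc 0 1) (tube (Uc h U c))) :
    riemDist (levelSet h U) (gU h) (radialProj h (imPart (γ 0))) (radialProj h (imPart (γ 1)))
      ≤ 2 * curveLength (deformedMetric h c) γ := by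
  have hmemU : ∀ t ∈ Icc (0 : ℝ) 1, imPart (γ t) ∈ U := fun t ht => (hmem ht).1
  have h1 : ContDiffOn ℝ 1 (fun t => radialProj h (imPart (γ t))) (Icc 0 1) :=
    (contDiffOn_radialProj hU).comp ((imPartL n).contDiff.comp_contDiffOn hγ) hmemU
  refine (riemDist_le_curveLength (g := gU h) h1
    fun t ht => radialProj_mem hU (hmemU t ht)).trans ?_
  -- The comparison is between speeds at each time: the factor 2 comes only from the 1/4 in the
  -- deformed metric.
  rw [curveLength, curveLength, ← lintegral_const_mul' _ _ (by simp)]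
  refine setLIntegral_mono' measurableSet_Icc fun t ht => ?_
  obtain ⟨L, hL, hL'⟩ := hasFDerivAt_radialProj hU (hmemU t ht)
  have h2 : HasDerivWithinAt (fun t => imPart (γ t)) (imPart (derivWithin γ (Icc 0 1) t))
      (Icc 0 1) t :=
    (imPartL n).hasFDerivAt.comp_hasDerivWithinAt t (hasDerivWithinAt_of_contDiffOn hγ ht)
  have h2' : HasDerivWithinAt (fun t => radialProj h (imPart (γ t)))
      (L (imPart (derivWithin γ (Icc 0 1) t))) (Icc 0 1) t :=
    HasFDerivAt.comp_hasDerivWithinAt (l := radialProj h) (l' := L) t hL h2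
  have h3 : derivWithin (fun t => radialProj h (imPart (γ t))) (Icc 0 1) t
      = L (imPart (derivWithin γ (Icc 0 1) t)) :=
    h2'.derivWithin (uniqueDiffOn_Icc zero_lt_one t ht)
  rw [gU_radialProj hU (hmemU t ht) _ _ (h3.trans (hL' _))]
  rw [show (2 : ℝ≥0∞) = ENNReal.ofReal 2 by simp, ← ENNReal.ofReal_mul (by norm_num)]
  apply ENNReal.ofReal_le_ofReal
  exact (Real.sqrt_le_sqrt (gU_radialProj_le hU hc (hmem ht) _)).trans
    (sqrt_logMetric_imPart_le hU (hmem ht) _)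

/-- The function log(h + c) is Lipschitz with constant 4: a factor 2 from `sq_dlog_le` and a factor
2 from `sqrt_logMetric_imPart_le`. It puts the boundary part h = -c at infinite distance. -/
lemma abs_log_sub_le (hU : IsProjectiveSpecialReal h U) (hc : c ≤ 0) {γ : ℝ → Cn n} {δ : ℝ}
    (hγ : ContDiffOn ℝ 1 γ (Icc 0 1)) (hmem : MapsTo γ (Icc 0 1) (tube (Uc h U c)))
    (hδ : curveLength (deformedMetric h c) γ < ENNReal.ofReal δ) :
    |Real.log (realFun h (imPart (γ 1)) + c) - Real.log (realFun h (imPart (γ 0)) + c)|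
      ≤ 4 * δ := by
  have hne : ∀ t ∈ Icc (0 : ℝ) 1, realFun h (imPart (γ t)) + c ≠ 0 := fun t ht =>
    (add_pos_of_mem_Uc (hmem ht)).ne'
  have h1 : ContDiffOn ℝ 1 (fun t => Real.log (realFun h (imPart (γ t)) + c)) (Icc 0 1) :=
    (((contDiff_realFun hU.homogeneous).comp (imPartL n).contDiff).comp_contDiffOn hγ
      |>.add contDiffOn_const).log hne
  refine norm_sub_lt_of_lintegral_lt (by norm_num) h1 (fun t ht => ?_) hδ
    (left_mem_Icc.2 zero_le_one) (right_mem_Icc.2 zero_le_one)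
  have h2 : HasDerivWithinAt (fun t => imPart (γ t)) (imPart (derivWithin γ (Icc 0 1) t))
      (Icc 0 1) t :=
    (imPartL n).hasFDerivAt.comp_hasDerivWithinAt t (hasDerivWithinAt_of_contDiffOn hγ ht)
  have h2' : HasDerivWithinAt (fun t => realFun h (imPart (γ t)))
      (((3 : ℝ) • polar ℝ h (imPart (γ t)) (imPart (γ t))) (imPart (derivWithin γ (Icc 0 1) t)))
      (Icc 0 1) t :=
    HasFDerivAt.comp_hasDerivWithinAt (l := realFun h) t
      (hasFDerivAt_realFun hU.homogeneous (imPart (γ t))) h2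
  have h3 := (h2'.add_const c).log (hne t ht)
  have h4 := h3.derivWithin (uniqueDiffOn_Icc zero_lt_one t ht)
  have h5 : derivWithin (fun t => Real.log (realFun h (imPart (γ t)) + c)) (Icc 0 1) t
      = 3 * polar ℝ h (imPart (γ t)) (imPart (γ t)) (imPart (derivWithin γ (Icc 0 1) t))
        / (realFun h (imPart (γ t)) + c) := by
    refine h4.trans ?_
    simp
  rw [h5, Real.norm_eq_abs, ← Real.sqrt_sq_eq_abs]
  refine (Real.sqrt_le_sqrt (sq_dlog_le hU hc (hmem ht) _)).trans ?_
  have h6 := sqrt_logMetric_imPart_le hU (hmem ht) (derivWithin γ (Icc 0 1) t)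
  rw [Real.sqrt_mul (by norm_num), show (4 : ℝ) = 2 ^ 2 by norm_num, Real.sqrt_sq (by norm_num)]
  calc 2 * Real.sqrt (logMetric h c (imPart (γ t)) (imPart (derivWithin γ (Icc 0 1) t))
        (imPart (derivWithin γ (Icc 0 1) t)))
      ≤ 2 * (2 * Real.sqrt (deformedMetric h c (γ t) (derivWithin γ (Icc 0 1) t)
        (derivWithin γ (Icc 0 1) t))) := by gcongr
    _ = _ := by ring

/-- Convergence for the Riemannian distance of the level set implies convergence. -/
lemma tendsto_of_tendsto_riemDist_levelSet (hU : IsProjectiveSpecialReal h U)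
    {a : ℕ → Fin n → ℝ} {x : Fin n → ℝ} (hx : x ∈ levelSet h U)
    (ha : Tendsto (fun m => riemDist (levelSet h U) (gU h) (a m) x) atTop (𝓝 0)) :
    Tendsto a atTop (𝓝 x) := by
  have hh := hU.homogeneous
  rw [Metric.tendsto_atTop]
  intro ε hε
  obtain ⟨r₀, hr₀, hball⟩ := Metric.nhds_basis_closedBall.mem_iff.1 (hU.isOpen.mem_nhds hx.1)
  set r := min r₀ ε with hr
  have hr0 : 0 < r := lt_min hr₀ hε
  have hsub : Metric.closedBall x r ⊆ Uc h U 0 := by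
    rw [Uc_zero hU]
    exact (Metric.closedBall_subset_closedBall (min_le_left _ _)).trans hball
  obtain ⟨C, hC, hC'⟩ := exists_logMetric_ge hU (isCompact_closedBall x r) hsub
  obtain ⟨L, hL, hL'⟩ := exists_confinement x hr0
  -- This choice makes L C δ = 1/2, below the threshold 1 for confinement.
  set δ := (2 * (L * C))⁻¹ with hδ
  have hδ0 : 0 < δ := by positivity
  have hev : ∀ᶠ m in atTop, riemDist (levelSet h U) (gU h) (a m) x < ENNReal.ofReal δ :=
    ha.eventually (gt_mem_nhds (ENNReal.ofReal_pos.2 hδ0))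
  obtain ⟨N, hN⟩ := eventually_atTop.1 hev
  refine ⟨N, fun m hm => ?_⟩
  obtain ⟨γ, hγ, hmem, h0, h1, hlen⟩ := exists_curve_of_riemDist_lt (hN m hm)
  -- Velocities of curves in {h = 1} satisfy P(γ, γ, γ') = 0. On them -∂²h agrees with the metric
  -- -∂² log h, which is definite in all directions and so has a lower bound on the ball.
  have hb : ∀ t ∈ Icc (0 : ℝ) 1, γ t ∈ Metric.closedBall x r → ‖derivWithin γ (Icc 0 1) t‖ ≤
      C * Real.sqrt (gU h (γ t) (derivWithin γ (Icc 0 1) t) (derivWithin γ (Icc 0 1) t)) := by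
    intro t ht hin
    have hd := (hasFDerivAt_realFun hh (γ t)).comp_hasDerivWithinAt t
      (hasDerivWithinAt_of_contDiffOn hγ ht)
    have hd2 : HasDerivWithinAt (realFun h ∘ γ) 0 (Icc 0 1) t :=
      (hasDerivWithinAt_const t (Icc 0 1) (1 : ℝ)).congr (fun s hs => (hmem hs).2) (hmem ht).2
    have htan := (uniqueDiffOn_Icc zero_lt_one t ht).eq_deriv _ hd hd2
    have htan' : polar ℝ h (γ t) (γ t) (derivWithin γ (Icc 0 1) t) = 0 := by
      simpa using htan
    refine (hC' _ hin _).trans (le_of_eq ?_)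
    rw [gU_eq hh, logMetric, htan', (hmem ht).2]
    simp
  have hLC : L * C * δ < 1 := by
    rw [hδ]
    field_simp
    norm_num
  -- Confinement is anchored at time 1, where the curve is at x, and read off at time 0.
  have := hL' γ _ C δ hC.le (fun t => Real.sqrt_nonneg _) hγ hb hlen hLC 1
    (right_mem_Icc.2 zero_le_one) (by rw [h1]; exact Metric.mem_closedBall_self (by positivity))
    0 (left_mem_Icc.2 zero_le_one)
  rw [h0] at this
  exact lt_of_lt_of_le this (min_le_right _ _)

/-- In a sequence that is Cauchy for the deformed metric and whose imaginary parts converge, the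
real parts form a Cauchy sequence. -/
lemma cauchySeq_rePt (hU : IsProjectiveSpecialReal h U) {a : ℕ → Cn n} {x : Fin n → ℝ}
    (hx : x ∈ Uc h U c) (hax : Tendsto (fun m => imPart (a m)) atTop (𝓝 x))
    (ha : ∀ δ : ℝ, 0 < δ → ∃ N, ∀ m ≥ N, ∀ l ≥ N, ∃ γ : ℝ → Cn n, ContDiffOn ℝ 1 γ (Icc 0 1) ∧
      MapsTo γ (Icc 0 1) (tube (Uc h U c)) ∧ γ 0 = a m ∧ γ 1 = a l ∧
      curveLength (deformedMetric h c) γ < ENNReal.ofReal δ) :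
    CauchySeq fun m => rePt (a m) := by
  obtain ⟨r, hr, hball⟩ := Metric.nhds_basis_closedBall.mem_iff.1 ((isOpen_Uc hU c).mem_nhds hx)
  obtain ⟨C, hC, hC'⟩ := exists_logMetric_ge hU (isCompact_closedBall x r) hball
  obtain ⟨L, hL, hL'⟩ := exists_confinement x hr
  rw [Metric.cauchySeq_iff]
  intro ε hε
  -- The first bound confines the imaginary part of the curve to the ball, the second limits the
  -- displacement of the real part to ε/2.
  set δ := min (2 * (L * (C * 2)))⁻¹ (ε / (2 * (C * 2))) with hδ
  have hδ0 : 0 < δ := lt_min (by positivity) (by positivity)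
  have hδ1 : L * (C * 2) * δ < 1 := by
    calc L * (C * 2) * δ ≤ L * (C * 2) * (2 * (L * (C * 2)))⁻¹ := by gcongr; exact min_le_left _ _
      _ < 1 := by
        field_simp
        norm_num
  have hδ2 : C * 2 * δ < ε := by
    calc C * 2 * δ ≤ C * 2 * (ε / (2 * (C * 2))) := by gcongr; exact min_le_right _ _
      _ = ε / 2 := by field_simp
      _ < ε := by linarith
  obtain ⟨N, hN⟩ := ha δ hδ0
  obtain ⟨N', hN'⟩ := eventually_atTop.1
    (hax.eventually (Metric.closedBall_mem_nhds x (by positivity : 0 < r / 2)))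
  refine ⟨max N N', fun m hm l hl => ?_⟩
  obtain ⟨γ, hγ, hmem, h0, h1, hlen⟩ := hN l (le_of_max_le_left hl) m (le_of_max_le_left hm)
  set ℓ : ℝ → ℝ := fun t => Real.sqrt (deformedMetric h c (γ t) (derivWithin γ (Icc 0 1) t)
    (derivWithin γ (Icc 0 1) t)) with hℓ
  have hu : ∀ t ∈ Icc (0 : ℝ) 1, UniqueDiffWithinAt ℝ (Icc (0 : ℝ) 1) t :=
    uniqueDiffOn_Icc zero_lt_one
  have hi : ∀ t ∈ Icc (0 : ℝ) 1, derivWithin (fun t => imPart (γ t)) (Icc 0 1) t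
      = imPart (derivWithin γ (Icc 0 1) t) := fun t ht =>
    ((imPartL n).hasFDerivAt.comp_hasDerivWithinAt t
      (hasDerivWithinAt_of_contDiffOn hγ ht)).derivWithin (hu t ht)
  have hre : ∀ t ∈ Icc (0 : ℝ) 1, derivWithin (fun t => rePt (γ t)) (Icc 0 1) t
      = rePt (derivWithin γ (Icc 0 1) t) := fun t ht =>
    ((rePtL n).hasFDerivAt.comp_hasDerivWithinAt t
      (hasDerivWithinAt_of_contDiffOn hγ ht)).derivWithin (hu t ht)
  -- The metric depends only on the imaginary part, so confining this part suffices for a uniform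
  -- lower bound on both blocks.
  have hin : ∀ t ∈ Icc (0 : ℝ) 1, imPart (γ t) ∈ Metric.ball x r := by
    refine hL' (fun t => imPart (γ t)) ℓ (C * 2) δ (by positivity) (fun t => Real.sqrt_nonneg _)
      ((imPartL n).contDiff.comp_contDiffOn hγ) (fun t ht hin => ?_) hlen hδ1 0
      (left_mem_Icc.2 zero_le_one) (by simp only [h0]; exact hN' l (le_of_max_le_right hl))
    rw [hi t ht, mul_assoc]
    refine (hC' _ hin _).trans ?_
    gcongr
    exact sqrt_logMetric_imPart_le hU (hmem ht) _
  have := norm_sub_lt_of_lintegral_lt (f := fun t => rePt (γ t)) (ℓ := ℓ) (C := C * 2) (δ := δ)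
    (by positivity) ((rePtL n).contDiff.comp_contDiffOn hγ) (fun t ht => by
      rw [hre t ht, mul_assoc]
      refine (hC' _ (Metric.ball_subset_closedBall (hin t ht)) _).trans ?_
      gcongr
      exact sqrt_logMetric_rePt_le hU (hmem ht) _) hlen (left_mem_Icc.2 zero_le_one)
    (right_mem_Icc.2 zero_le_one)
  simp only [h0, h1] at this
  rw [dist_eq_norm]
  exact lt_of_le_of_lt this hδ2

/-- Convergence in `ℂ^n` implies convergence for the Riemannian distance. -/
lemma tendsto_riemDist_of_tendsto (hU : IsProjectiveSpecialReal h U) {a : ℕ → Cn n} {z : Cn n}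
    (hz : z ∈ tube (Uc h U c)) (ha : Tendsto a atTop (𝓝 z)) :
    Tendsto (fun m => riemDist (tube (Uc h U c)) (deformedMetric h c) (a m) z) atTop (𝓝 0) := by
  have hz' : imPart z ∈ Uc h U c := hz
  obtain ⟨r, hr, hball⟩ := Metric.nhds_basis_closedBall.mem_iff.1 ((isOpen_Uc hU c).mem_nhds hz')
  obtain ⟨C, hC, hC'⟩ := exists_logMetric_le hU (isCompact_closedBall (imPart z) r) hball
  have hev : ∀ᶠ m in atTop, riemDist (tube (Uc h U c)) (deformedMetric h c) (a m) z
      ≤ ENNReal.ofReal (Real.sqrt C * ‖z - a m‖) := by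
    filter_upwards [ha.eventually (Metric.ball_mem_nhds z hr)] with m hm
    have hin : ∀ t ∈ Icc (0 : ℝ) 1,
        imPart (a m + t • (z - a m)) ∈ Metric.closedBall (imPart z) r := by
      intro t ht
      have h1 : a m + t • (z - a m) ∈ Metric.ball z r :=
        (convex_ball z r).add_smul_sub_mem hm (Metric.mem_ball_self hr) ht
      rw [Metric.mem_closedBall, dist_eq_norm]
      rw [Metric.mem_ball, dist_eq_norm] at h1
      exact (norm_imPart_le (a m + t • (z - a m) - z)).trans h1.le
    refine riemDist_le_of_segment (fun t ht => hball (hin t ht)) fun t ht => ?_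
    have hpos := add_pos_of_mem_Uc (hball (hin t ht))
    rw [deformedMetric_eq hU.homogeneous hpos.ne']
    have h1 := hC' _ (hin t ht) (rePt (z - a m))
    have h2 := hC' _ (hin t ht) (imPart (z - a m))
    have h3 : C * ‖rePt (z - a m)‖ ^ 2 ≤ C * ‖z - a m‖ ^ 2 := by
      gcongr
      exact norm_rePt_le _
    have h4 : C * ‖imPart (z - a m)‖ ^ 2 ≤ C * ‖z - a m‖ ^ 2 := by
      gcongr
      exact norm_imPart_le _
    have h5 : 0 ≤ C * ‖z - a m‖ ^ 2 := by positivity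
    have h6 : Real.sqrt C * ‖z - a m‖ = Real.sqrt (C * ‖z - a m‖ ^ 2) := by
      rw [Real.sqrt_mul hC, Real.sqrt_sq (norm_nonneg _)]
    rw [h6]
    exact Real.sqrt_le_sqrt (by linarith)
  have hlim : Tendsto (fun m => ENNReal.ofReal (Real.sqrt C * ‖z - a m‖)) atTop (𝓝 0) := by
    have h1 : Tendsto (fun m => Real.sqrt C * ‖z - a m‖) atTop (𝓝 (Real.sqrt C * ‖z - z‖)) :=
      ((tendsto_const_nhds.sub ha).norm).const_mul _
    have h2 := ENNReal.tendsto_ofReal h1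
    simpa using h2
  exact tendsto_of_tendsto_of_tendsto_of_le_of_le' tendsto_const_nhds hlim
    (Eventually.of_forall fun _ => zero_le) hev

/-- A point is recovered from its radial projection, from log(h + c) and from its real part. Each of
these converges along a Cauchy sequence, and the limit they determine lies in the tube. -/
theorem isRiemComplete_deformedMetric (hU : IsProjectiveSpecialReal h U) (hc : c < 0)
    (hcomp : IsRiemComplete (levelSet h U) (gU h)) :
    IsRiemComplete (tube (Uc h U c)) (deformedMetric h c) := by
  intro a ha hcauchy
  have hcurve : ∀ δ : ℝ, 0 < δ → ∃ N, ∀ m ≥ N, ∀ l ≥ N, ∃ γ : ℝ → Cn n,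
      ContDiffOn ℝ 1 γ (Icc 0 1) ∧ MapsTo γ (Icc 0 1) (tube (Uc h U c)) ∧ γ 0 = a m ∧ γ 1 = a l ∧
      curveLength (deformedMetric h c) γ < ENNReal.ofReal δ := by
    intro δ hδ
    obtain ⟨N, hN⟩ := hcauchy _ (ENNReal.ofReal_pos.2 hδ)
    exact ⟨N, fun m hm l hl => exists_curve_of_riemDist_lt (hN m hm l hl)⟩
  have hmem : ∀ m, imPart (a m) ∈ Uc h U c := ha
  obtain ⟨ζ, hζ, hζlim⟩ := hcomp (fun m => radialProj h (imPart (a m)))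
    (fun m => radialProj_mem hU (hmem m).1) (by
      intro ε hε
      obtain ⟨δ, hδ, hδε⟩ := ENNReal.lt_iff_exists_nnreal_btwn.1 hε
      -- Half of δ compensates for the factor 2 in `riemDist_radialProj_le`.
      have hδ0 : 0 < (δ : ℝ) / 2 := by
        have : 0 < (δ : ℝ) := by exact_mod_cast hδ
        positivity
      obtain ⟨N, hN⟩ := hcurve _ hδ0
      refine ⟨N, fun m hm l hl => ?_⟩
      obtain ⟨γ, hγ, hγmem, h0, h1, hlen⟩ := hN m hm l hl
      have := riemDist_radialProj_le hU hc.le hγ hγmem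
      rw [h0, h1] at this
      refine lt_of_le_of_lt (this.trans ?_) hδε
      calc 2 * curveLength (deformedMetric h c) γ ≤ ENNReal.ofReal 2 * ENNReal.ofReal (δ / 2) := by
            gcongr
            simp
        _ = ENNReal.ofReal δ := by
            rw [← ENNReal.ofReal_mul (by norm_num)]
            congr 1
            ring
        _ = δ := ENNReal.ofReal_coe_nnreal)
  have hζE := tendsto_of_tendsto_riemDist_levelSet hU hζ hζlim
  have hs : CauchySeq fun m => Real.log (realFun h (imPart (a m)) + c) := by
    rw [Metric.cauchySeq_iff]
    intro ε hε
    obtain ⟨N, hN⟩ := hcurve (ε / 8) (by positivity)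
    refine ⟨N, fun m hm l hl => ?_⟩
    obtain ⟨γ, hγ, hγmem, h0, h1, hlen⟩ := hN l hl m hm
    have := abs_log_sub_le hU hc.le hγ hγmem hlen
    rw [h0, h1] at this
    rw [Real.dist_eq]
    linarith
  obtain ⟨s, hs⟩ := cauchySeq_tendsto_of_complete hs
  have hh : Tendsto (fun m => realFun h (imPart (a m))) atTop (𝓝 (Real.exp s - c)) := by
    have h1 := ((Real.continuous_exp.tendsto s).comp hs).sub_const c
    refine h1.congr fun m => ?_
    simp only [Function.comp_apply]
    rw [Real.exp_log (add_pos_of_mem_Uc (hmem m))]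
    ring
  -- The limit has h + c = exp s > 0, so it stays off the boundary h = -c; its direction ζ lies in U
  -- by completeness of the level set.
  have hpos : 0 < Real.exp s - c := by linarith [Real.exp_pos s]
  set x := (Real.exp s - c) ^ (1 / 3 : ℝ) • ζ with hx
  have hxU : x ∈ Uc h U c := by
    have hx1 : realFun h x = Real.exp s - c := by
      rw [hx, realFun_smul hU.homogeneous, rpow_third_pow hpos.le, hζ.2, mul_one]
    refine ⟨hU.cone _ (Real.rpow_pos_of_pos hpos _) _ hζ.1, fun _ => ?_, fun h => by linarith⟩
    rw [hx1]
    linarith [Real.exp_pos s]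
  have hxlim : Tendsto (fun m => imPart (a m)) atTop (𝓝 x) := by
    have h1 : Tendsto (fun m => realFun h (imPart (a m)) ^ (1 / 3 : ℝ)) atTop
        (𝓝 ((Real.exp s - c) ^ (1 / 3 : ℝ))) := hh.rpow_const (Or.inr (by norm_num))
    exact (h1.smul hζE).congr fun m => smul_radialProj hU (hmem m).1
  obtain ⟨y, hy⟩ := cauchySeq_tendsto_of_complete (cauchySeq_rePt hU hxU hxlim hcurve)
  have hz : ofRealVec y + Complex.I • ofRealVec x ∈ tube (Uc h U c) := by
    show imPart _ ∈ Uc h U c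
    rw [imPart_add_mul_I]
    exact hxU
  refine ⟨_, hz, tendsto_riemDist_of_tendsto hU hz ?_⟩
  have h1 : Tendsto (fun m => ofRealVec (rePt (a m)) + Complex.I • ofRealVec (imPart (a m))) atTop
      (𝓝 (ofRealVec y + Complex.I • ofRealVec x)) :=
    ((continuous_ofRealVec.tendsto y).comp hy).add
      (((continuous_ofRealVec.tendsto x).comp hxlim).const_smul Complex.I)
  exact h1.congr fun m => (eq_rePt_add_imPart (a m)).symm

end Completeness

end

end SpecialGeometry

theorem mainTheorem2 (n : ℕ) (h : MvPolynomial (Fin n) ℝ) (U : Set (Fin n → ℝ))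
    (hU : IsProjectiveSpecialReal h U) :
    (∀ c : ℝ,
      (tube (Uc h U c)).Nonempty ∧
      IsSpecialKaehlerPair (inducedMetric (graphOfDifferential (prepot h 0)))
        (inducedConn (graphOfDifferential (prepot h 0))) (tube (Uc h U c))
        (graphOfDifferential (prepot h 0)) (prepot h c) ∧
      IsNondegeneratePair (tube (Uc h U c)) (graphOfDifferential (prepot h 0)) (prepot h c) ∧
      (∀ p ∈ tube (Uc h U c),
        IsASKPSKImage (tube (Uc h U c)) (inducedMetric (graphOfDifferential (prepot h 0)))
          (inducedConn (graphOfDifferential (prepot h 0))) p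
          (graphOfDifferential (prepot h 0)) (prepot h c)
          (tube (Uc h U c)) (deformedMetric h c)) ∧
      (∀ z ∈ tube (Uc h U c), ∀ u, u ≠ 0 → 0 < deformedMetric h c z u u)) ∧
    (tube (Uc h U 0) = tube U ∧
      ∀ z ∈ tube U, ∀ u v, deformedMetric h 0 z u v = rMapMetric h z u v) ∧
    (∀ c c' : ℝ, 0 < c * c' →
      AreIsometric (tube (Uc h U c)) (deformedMetric h c)
        (tube (Uc h U c')) (deformedMetric h c')) ∧
    (∀ c : ℝ, c < 0 → IsRiemComplete (levelSet h U) (gU h) →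
      IsRiemComplete (tube (Uc h U c)) (deformedMetric h c)) := by
  refine ⟨fun c => ⟨(isConnected_tube_Uc hU c).nonempty, isSpecialKaehlerPair_prepot hU c,
    isNondegeneratePair_prepot hU c, fun p hp => isASKPSKImage_deformedMetric hU c hp,
    fun z hz u hu => deformedMetric_pos hU hz hu⟩, ⟨by rw [Uc_zero hU], fun z hz u v =>
    deformedMetric_zero_eq_rMapMetric hU hz u v⟩, fun c c' hc => areIsometric_deformedMetric hU hc,
    fun c hc hcomp => isRiemComplete_deformedMetric hU hc hcomp⟩
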